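/- **Theorem 1.** Repeated indices are summed over $1,2,3$; $\varepsilon^{ijk}$ is the Levi-Civita symbol. Let $\nu\ge 0$ and let $(\Omega,\mathcal F,\mathbb P)$ be a probability space. Let $U(x,t)$ be a random velocity field and $P(x,t)$ a random pressure ($x\in\mathbb R^3$, $t>0$), differentiable in $x$, every realization of which solves $$\frac{\partial U^i}{\partial t}+U^j\frac{\partial U^i}{\partial x^j}=\nu\Delta U^i-\frac{\partial P}{\partial x^i},\qquad \frac{\partial U^j}{\partial x^j}=0,$$ and let $W=\nabla\wedge U$, $W^i=\varepsilon^{ijk}\partial U^k/\partial x^j$, be the vorticity. Assume: 1. Every realization of $U$ is smooth in $(x,t)$, and for each order $n\ge0$ and each compact $K\subset(0,\infty)$ there is a square-integrable random variable $M$ such that all derivatives of $U$ of order $n$ in $(x,t)$ are bounded by $M\,(1+|x|)^{-3}$ for $x\in\mathbb R^3$, $t\in K$ (hence the same holds for $W$). 2. For $t>0$, $W(x,t)$ has a positive probability density $f(w;x,t)$, smooth in $(w,x,t)$, with $\int_{\mathbb R^3}|w|^nf(w;x,t)\,dw<\infty$ for every $n$; and for $x\ne y$, $(W(x,t),W(y,t))$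 has a positive probability density $f_2(w_1,w_2;x,y,t)$, smooth in $(w_1,w_2)$. 3. The conditional mean $$\mu^i(x,y,w,t)=\mathbb E\left[W^i(y,t)-W^i(x,t)\,\middle|\,W(x,t)=w\right]=\int_{\mathbb R^3}(w_1^i-w^i)\frac{f_2(w,w_1;x,y,t)}{f(w;x,t)}\,dw_1\quad(x\ne y),\qquad \mu^i(x,x,w,t)=0,$$ is smooth in $(x,y,w,t)$, $t>0$; its gradient $\partial_y\mu$ and all derivatives of $\partial_y\mu$ in $(x,y,w,t)$ are $O(|y|^{-3})$ as $|y|\to\infty$, uniformly for $(x,w,t)$ in compact subsets of $\mathbb R^3\times\mathbb R^3\times(0,\infty)$; and, as $y\to x$, $$\mu^i(x,y,w,t)=a^i_k(x,w,t)(y^k-x^k)+b^i_{jk}(x,w,t)(y^k-x^k)(y^j-x^j)+o(|y-x|^2)$$ with coefficients $a^i_k$, $b^i_{jk}$ continuous in $(x,w,t)$. Put $b^i=b^i_{kk}$. Define $$B^i(x,w,t)=\int_{\mathbb R^3}\frac{1}{4\pi|y-x|}\varepsilon^{ijk}\frac{\partial\mu^k}{\partial y^j}(x,y,w,t)\,dy,\qquad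 D^i(x,w,t)=w^l\int_{\mathbb R^3}\frac{y^l-x^l}{4\pi|y-x|^3}\varepsilon^{ijk}\frac{\partial\mu^k}{\partial y^j}(x,y,w,t)\,dy.$$ Then these integrals converge absolutely, all derivatives below exist, and for all $w,x\in\mathbb R^3$ and $t>0$ $$\left(\frac{\partial}{\partial t}+\frac{\partial B^i}{\partial x^i}+B^i\frac{\partial}{\partial x^i}-\nu\Delta_x\right)f=\nu\frac{\partial}{\partial w^i}\left(\frac{\partial}{\partial x^k}\left(fa^i_k\right)-2b^if\right)-\frac{\partial}{\partial w^i}\left(fD^i\right),$$ where $(\partial B^i/\partial x^i)$ acts on $f$ by multiplication. -/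

import Mathlib

open MeasureTheory Filter Topology Asymptotics
open scoped ContDiff

namespace VorticityPDF

/-- Three-dimensional Euclidean space. -/
abbrev E3 := EuclideanSpace ℝ (Fin 3)

/-- The partial derivative `∂g/∂x^k` of a scalar function of a space variable. -/
noncomputable def pd (k : Fin 3) (g : E3 → ℝ) (x : E3) : ℝ :=
  fderiv ℝ g x (EuclideanSpace.single k 1)

/-- The Laplacian `∑ k, ∂²g/∂x^k∂x^k`. -/
noncomputable def lap (g : E3 → ℝ) (x : E3) : ℝ := ∑ k, pd k (pd k g) x

/-- The Levi-Civita symbol `ε^{ijk}`, written as `(j - i)(k - i)(k - j) / 2`. -/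
noncomputable def leviCivita (i j k : Fin 3) : ℝ :=
  (((j : ℕ) : ℝ) - ((i : ℕ) : ℝ)) * (((k : ℕ) : ℝ) - ((i : ℕ) : ℝ)) *
    (((k : ℕ) : ℝ) - ((j : ℕ) : ℝ)) / 2

/-- The curl of a vector field: `(∇ ∧ V)^i = ε^{ijk} ∂V^k/∂x^j`. -/
noncomputable def curl (V : E3 → E3) (x : E3) : E3 :=
  WithLp.toLp 2 fun i => ∑ j, ∑ k, leviCivita i j k * pd j (fun z => V z k) x

section Fields

variable {Ω : Type*}

/-- The vorticity `W(x,t) = ∇ ∧ U(x,t)` of a (random) velocity field. -/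
noncomputable def vorticity (U : E3 → ℝ → Ω → E3) (x : E3) (t : ℝ) (σ : Ω) : E3 :=
  curl (fun z => U z t σ) x

/-- Every realization of `(U, P)` is a classical solution, at positive times, of the unforced
incompressible Navier–Stokes equations in the whole space, with viscosity `ν`. -/
def SolvesNavierStokes (ν : ℝ) (U : E3 → ℝ → Ω → E3) (P : E3 → ℝ → Ω → ℝ) : Prop :=
  ∀ σ t, 0 < t →
    Differentiable ℝ (fun z => P z t σ) ∧
    ∀ x,
      (∀ i, deriv (fun s => U x s σ i) t + ∑ j, U x t σ j * pd j (fun z => U z t σ i) x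
          = ν * lap (fun z => U z t σ i) x - pd i (fun z => P z t σ) x) ∧
      ∑ j, pd j (fun z => U z t σ j) x = 0

/-- Every realization is smooth in `(x,t)`, `t > 0`, and all space-time derivatives (those of order
zero included) are `O(|x|⁻³)` at spatial infinity, locally uniformly in `t > 0`, with a random
constant that is square integrable. As the vorticity is made of first derivatives of `U`,
it has the same property. -/
def SmoothFastDecay [MeasurableSpace Ω] (ℙ : Measure Ω) (U : E3 → ℝ → Ω → E3) : Prop :=
  (∀ σ, ContDiffOn ℝ ∞ (fun p : E3 × ℝ => U p.1 p.2 σ) {p | 0 < p.2}) ∧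
  ∀ (n : ℕ) (K : Set ℝ), IsCompact K → K ⊆ Set.Ioi 0 →
    ∃ M : Ω → ℝ, MemLp M 2 ℙ ∧ ∀ σ, ∀ t ∈ K, ∀ x : E3,
      ‖iteratedFDeriv ℝ n (fun p : E3 × ℝ => U p.1 p.2 σ) (x, t)‖ ≤ M σ / (1 + ‖x‖) ^ 3

end Fields

/-- `g` is a probability density function of the random variable `X` with values in `E`
(with respect to the Lebesgue measure). -/
def IsPDFOf {Ω E : Type*} [MeasurableSpace Ω] [MeasureSpace E] (ℙ : Measure Ω) (X : Ω → E)
    (g : E → ℝ) : Prop :=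
  Measurable g ∧ (∀ w, 0 ≤ g w) ∧
    ∀ A : Set E, MeasurableSet A → ℙ (X ⁻¹' A) = ∫⁻ w in A, ENNReal.ofReal (g w)

/-- The conditional mean of the increment
`μ^i(x,y,w,t) = E[W^i(y,t) - W^i(x,t) | W(x,t) = w] = ∫ (w₁^i - w^i) f₂(w,w₁;x,y,t) / f(w;x,t) dw₁`,
as a function of the one-point density `f w x t` and the two-point density `f₂ w w₁ x y t`, the
latter being meaningful for `x ≠ y`; on the diagonal `x = y` the increment, hence `μ`, is zero. -/
noncomputable def condMean (f : E3 → E3 → ℝ → ℝ) (f₂ : E3 → E3 → E3 → E3 → ℝ → ℝ)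
    (i : Fin 3) (x y w : E3) (t : ℝ) : ℝ :=
  open Classical in
  if x = y then 0 else ∫ w₁ : E3, (w₁ i - w i) * (f₂ w w₁ x y t / f w x t)

/-- `m(x,y,w,t)` is smooth for `t > 0`, and its gradient in `y`, together with all derivatives
of that gradient in `(x,y,w,t)`, is `O(|y|⁻³)` as `|y| → ∞`, locally uniformly in `(x,w,t)`. -/
def SmoothDecayingIncrement (m : E3 → E3 → E3 → ℝ → ℝ) : Prop :=
  ContDiffOn ℝ ∞ (fun p : E3 × E3 × E3 × ℝ => m p.1 p.2.1 p.2.2.1 p.2.2.2)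
    {p | 0 < p.2.2.2} ∧
  ∀ (n : ℕ) (K : Set (E3 × E3 × ℝ)), IsCompact K → (∀ q ∈ K, 0 < q.2.2) →
    ∃ C : ℝ, ∀ q ∈ K, ∀ y : E3,
      ‖iteratedFDeriv ℝ n
        (fun p : E3 × E3 × E3 × ℝ => fderiv ℝ (fun z => m p.1 z p.2.2.1 p.2.2.2) p.2.1)
        (q.1, y, q.2.1, q.2.2)‖ ≤ C / (1 + ‖y‖) ^ 3

/-- The curl in `y` of the vector `(μ^k)`: `ε^{ijk} ∂μ^k/∂y^j (x,y,w,t)`. -/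
noncomputable def curlMean (μ : Fin 3 → E3 → E3 → E3 → ℝ → ℝ) (i : Fin 3) (x y w : E3) (t : ℝ) :
    ℝ :=
  ∑ j, ∑ k, leviCivita i j k * pd j (fun z => μ k x z w t) y

/-- The integrand `ε^{ijk} ∂_{y^j} μ^k / (4π|y-x|)` of `B^i`. -/
noncomputable def kernelB (μ : Fin 3 → E3 → E3 → E3 → ℝ → ℝ) (i : Fin 3) (x w : E3) (t : ℝ)
    (y : E3) : ℝ :=
  1 / (4 * Real.pi * ‖y - x‖) * curlMean μ i x y w t

/-- `B^i(x,w,t) = ∫ ε^{ijk} ∂_{y^j} μ^k / (4π|y-x|) dy`. -/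
noncomputable def fieldB (μ : Fin 3 → E3 → E3 → E3 → ℝ → ℝ) (i : Fin 3) (x w : E3) (t : ℝ) : ℝ :=
  ∫ y : E3, kernelB μ i x w t y

/-- The integrand `(y^l - x^l) ε^{ijk} ∂_{y^j} μ^k / (4π|y-x|³)` of `D^i`. -/
noncomputable def kernelD (μ : Fin 3 → E3 → E3 → E3 → ℝ → ℝ) (i l : Fin 3) (x w : E3) (t : ℝ)
    (y : E3) : ℝ :=
  (y l - x l) / (4 * Real.pi * ‖y - x‖ ^ 3) * curlMean μ i x y w t

/-- `D^i(x,w,t) = w^l ∫ (y^l - x^l) ε^{ijk} ∂_{y^j} μ^k / (4π|y-x|³) dy`. -/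
noncomputable def fieldD (μ : Fin 3 → E3 → E3 → E3 → ℝ → ℝ) (i : Fin 3) (x w : E3) (t : ℝ) : ℝ :=
  ∑ l, w l * ∫ y : E3, kernelD μ i l x w t y

end VorticityPDF

namespace VorticityPDF

/-! The equation is proved weakly in `w`. For a test function `φ`, differentiate `E[φ(W(x,t))] = ∫ φ
f dw` in time and insert the vorticity equation `∂ₜW + U·∇W = W·∇U + νΔW`. Every resulting term is a
correlation `E[ψ(W(x,t)) X(x,t)]` with `ψ` compactly supported. The closure consists in writing
these as integrals `∫ ψ f (…) dw` with coefficients built from `μ`.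

The two-point density gives `E[ψ(W(x)) (W(y) - W(x))] = ∫ ψ f μ dw` (`expField_comp_vecField`).
Derivatives in `y` pass to `μ`. At `y = x` its gradient is `a` and its pure second derivatives are
`2 b_kk` (`pd_eq_of_expansion`), so the viscous term has coefficient `2b`. The velocity is recovered
from `-ΔU = curl W`, a consequence of incompressibility: the correlation of `U` with `ψ(W(x))` is a
Newtonian potential (`integral_inv_norm_mul_laplacian`), and Fubini turns this into `∫ ψ f B dw`.
For `∂ₗU`, one integration by parts puts the derivative on the kernel and yields `D`; the factor
`W^l` of the stretching term is absorbed into `ψ`.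

For convection, differentiate `E[φ(W) U^j] = ∫ φ f B^j dw` in `x^j` and sum: the divergence of `U`
drops out and what remains is `∂_j(f B^j)`.

Finally `∂_k f`, tested against `φ`, equals `∑ᵢ ∫ ∂ᵢφ f a^i_k dw`; a further `x`-derivative gives
`Δf = -∂_{w^i} ∂_k (f a^i_k)` weakly. Thus the Laplacian and the `a` term of the equation cancel
each other, and the rest is the weak evolution (`weak_evolution`). All functions of `w` involved are
continuous, so the weak identity holds pointwise (`strong_evolution`). -/

/-- The coordinate direction `e_k`. -/
noncomputable abbrev unitVec (k : Fin 3) : E3 := EuclideanSpace.single k 1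

/-! ### Weakly singular kernels against cubically decaying functions -/

/-- A kernel on `ℝ³` with a singularity of order at most two at the origin. -/
def WeaklySingular (k : E3 → ℝ) : Prop :=
  Measurable k ∧ ∃ A, ∀ z, z ≠ 0 → |k z| ≤ A * (1 / ‖z‖ + 1 / ‖z‖ ^ 2)

/-- A continuous function on `ℝ³` which is `O(|y|⁻³)`. -/
def CubicDecay (V : E3 → ℝ) : Prop :=
  Continuous V ∧ ∃ C, ∀ y, |V y| ≤ C / (1 + ‖y‖) ^ 3

/-- In polar coordinates the Jacobian `r²` turns the integrand into exactly `(1 + r)⁻²`, so cubic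
decay suffices for both kernels `1/|z|` and `z/|z|³`. -/
lemma integrable_singular_mul_decay :
    Integrable fun z : E3 => (1 / ‖z‖ + 1 / ‖z‖ ^ 2) * (1 / (1 + ‖z‖) ^ 3) := by
  refine (integrable_fun_norm_addHaar volume
    (f := fun y : ℝ => (1 / y + 1 / y ^ 2) * (1 / (1 + y) ^ 3))).2 ?_
  have h : IntegrableOn (fun y : ℝ => (y + 1) ^ (-2 : ℝ)) (Set.Ioi 0) :=
    integrableOn_add_rpow_Ioi_of_lt (by norm_num) (by norm_num)
  refine h.congr_fun (fun y hy => ?_) measurableSet_Ioi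
  have hy : (0 : ℝ) < y := hy
  have : (y + 1) ^ (-2 : ℝ) = ((y + 1) ^ 2)⁻¹ := by
    rw [Real.rpow_neg (by linarith)]; norm_cast
  simp only [this, finrank_euclideanSpace, Fintype.card_fin, smul_eq_mul]
  field_simp
  ring

lemma WeaklySingular.integrable_mul {k V : E3 → ℝ} (hk : WeaklySingular k)
    (hV : AEStronglyMeasurable V volume) {C : ℝ} (hC : ∀ y, |V y| ≤ C / (1 + ‖y‖) ^ 3) :
    Integrable fun y => k y * V y := by
  obtain ⟨hm, A, hA⟩ := hk
  refine (integrable_singular_mul_decay.const_mul (A * C)).mono'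
    (hm.aestronglyMeasurable.mul hV) ?_
  filter_upwards [Measure.ae_ne volume (0 : E3)] with y hy
  rw [norm_mul, Real.norm_eq_abs, Real.norm_eq_abs]
  calc |k y| * |V y| ≤ (A * (1 / ‖y‖ + 1 / ‖y‖ ^ 2)) * (C / (1 + ‖y‖) ^ 3) :=
        mul_le_mul (hA y hy) (hC y) (abs_nonneg _) ((abs_nonneg _).trans (hA y hy))
    _ = _ := by ring

lemma WeaklySingular.integrable_mul_decay {k V : E3 → ℝ} (hk : WeaklySingular k)
    (hV : CubicDecay V) : Integrable fun y => k y * V y :=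
  let ⟨_, hC⟩ := hV.2
  hk.integrable_mul hV.1.aestronglyMeasurable hC

/-! ### The regularized Newtonian kernel and its derivatives -/

/-- The regularized distance to the origin. -/
noncomputable def regNorm (ε : ℝ) (z : E3) : ℝ := √(‖z‖ ^ 2 + ε ^ 2)

lemma regNorm_sq (ε : ℝ) (z : E3) : regNorm ε z ^ 2 = ‖z‖ ^ 2 + ε ^ 2 :=
  Real.sq_sqrt (by positivity)

lemma regNorm_pos {ε : ℝ} (hε : 0 < ε) (z : E3) : 0 < regNorm ε z :=
  Real.sqrt_pos.2 (by positivity)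

lemma le_regNorm (ε : ℝ) (z : E3) : ε ≤ regNorm ε z :=
  Real.le_sqrt_of_sq_le (by nlinarith [sq_nonneg ‖z‖])

lemma norm_le_regNorm (ε : ℝ) (z : E3) : ‖z‖ ≤ regNorm ε z :=
  Real.le_sqrt_of_sq_le (by nlinarith [sq_nonneg ε])

lemma continuous_regNorm (ε : ℝ) : Continuous (regNorm ε) := by
  unfold regNorm; fun_prop

lemma abs_coord_le (z : E3) (l : Fin 3) : |z l| ≤ ‖z‖ := PiLp.norm_apply_le z l

lemma norm_sq_eq_sum (z : E3) : ‖z‖ ^ 2 = ∑ l, z l ^ 2 := by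
  simp [EuclideanSpace.norm_sq_eq]

lemma hasLineDerivAt_regNorm {ε : ℝ} (hε : 0 < ε) (z : E3) (l : Fin 3) :
    HasLineDerivAt ℝ (regNorm ε) (z l / regNorm ε z) z (unitVec l) := by
  have h1 : HasFDerivAt (fun z : E3 => ‖z‖ ^ 2 + ε ^ 2) (2 • innerSL ℝ z) z :=
    ((hasStrictFDerivAt_norm_sq z).hasFDerivAt).add_const _
  have h2 : HasDerivAt _ _ _ := (h1.sqrt (by positivity)).hasLineDerivAt (unitVec l)
  have hp : 0 < √(‖z‖ ^ 2 + ε ^ 2) := regNorm_pos hε z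
  refine h2.congr_deriv ?_
  simp [regNorm, EuclideanSpace.inner_single_right]
  field_simp

lemma hasLineDerivAt_coord (z : E3) (l : Fin 3) :
    HasLineDerivAt ℝ (fun z : E3 => z l) 1 z (unitVec l) := by
  have := (EuclideanSpace.proj (𝕜 := ℝ) l).hasFDerivAt (x := z)
  simpa using this.hasLineDerivAt (unitVec l)

lemma hasLineDerivAt_inv_regNorm {ε : ℝ} (hε : 0 < ε) (z : E3) (l : Fin 3) :
    HasLineDerivAt ℝ (fun z => 1 / regNorm ε z) (-(z l / regNorm ε z ^ 3)) z (unitVec l) := by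
  have h : HasDerivAt _ _ _ := hasLineDerivAt_regNorm hε z l
  have hp := regNorm_pos hε z
  have h2 := (h.fun_inv (by simpa using hp.ne')).congr_deriv
    (g' := -(z l / regNorm ε z ^ 3)) (by simp; field_simp)
  simp only [one_div]
  exact h2

lemma hasLineDerivAt_coord_div_regNorm {ε : ℝ} (hε : 0 < ε) (z : E3) (l : Fin 3) :
    HasLineDerivAt ℝ (fun z => -(z l / regNorm ε z ^ 3))
      (-(1 / regNorm ε z ^ 3 - 3 * z l ^ 2 / regNorm ε z ^ 5)) z (unitVec l) := by
  have h : HasDerivAt _ _ _ := hasLineDerivAt_regNorm hε z l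
  have hc : HasDerivAt _ _ _ := hasLineDerivAt_coord z l
  have hp := regNorm_pos hε z
  exact ((hc.fun_div (h.fun_pow 3) (by simpa using hp.ne')).fun_neg).congr_deriv
    (by simp; field_simp; ring)

lemma WeaklySingular.of_abs_le {k : E3 → ℝ} (hm : Measurable k) (A : ℝ) (hA : 0 ≤ A)
    (h : ∀ z, z ≠ 0 → |k z| ≤ A / ‖z‖ ∨ |k z| ≤ A / ‖z‖ ^ 2) : WeaklySingular k := by
  refine ⟨hm, A, fun z hz => ?_⟩
  have h1 : 0 ≤ A / ‖z‖ := by positivity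
  have h2 : 0 ≤ A / ‖z‖ ^ 2 := by positivity
  have : A * (1 / ‖z‖ + 1 / ‖z‖ ^ 2) = A / ‖z‖ + A / ‖z‖ ^ 2 := by ring
  rcases h z hz with h | h <;> linarith

lemma one_div_regNorm_le {ε : ℝ} {z : E3} (hz : z ≠ 0) : 1 / regNorm ε z ≤ 1 / ‖z‖ :=
  one_div_le_one_div_of_le (norm_pos_iff.2 hz) (norm_le_regNorm ε z)

lemma weaklySingular_inv_regNorm {ε : ℝ} (hε : 0 < ε) :
    WeaklySingular fun z => 1 / regNorm ε z := by
  refine .of_abs_le (by have := (continuous_regNorm ε).measurable; fun_prop) 1 zero_le_one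
    fun z hz => .inl ?_
  have hp := regNorm_pos hε z
  rw [abs_of_pos (by positivity)]
  exact one_div_regNorm_le hz

lemma abs_coord_div_regNorm_le {ε : ℝ} (hε : 0 < ε) {z : E3} (hz : z ≠ 0) (l : Fin 3) :
    |z l / regNorm ε z ^ 3| ≤ 1 / ‖z‖ ^ 2 := by
  have hp := regNorm_pos hε z
  have hz := norm_pos_iff.2 hz
  rw [abs_div, abs_of_pos (pow_pos hp 3), div_le_div_iff₀ (by positivity) (by positivity), one_mul]
  have := norm_le_regNorm ε z
  calc |z l| * ‖z‖ ^ 2 ≤ regNorm ε z * regNorm ε z ^ 2 := by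
        gcongr; exact (abs_coord_le z l).trans this
    _ = _ := by ring

lemma weaklySingular_coord_div_regNorm {ε : ℝ} (hε : 0 < ε) (l : Fin 3) :
    WeaklySingular fun z => -(z l / regNorm ε z ^ 3) := by
  refine .of_abs_le (by have := (continuous_regNorm ε).measurable; fun_prop) 1 zero_le_one
    fun z hz => .inr ?_
  rw [abs_neg]
  exact abs_coord_div_regNorm_le hε hz l

/-- The second derivatives are of size `4 / r³` with `r = regNorm ε z`, where `4 = 1 + 3`. One
factor `1/r` is traded for `1/ε`, which makes the bound depend on `ε`; this is harmless because it
only justifies an integration by parts at fixed `ε`. -/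
lemma weaklySingular_second {ε : ℝ} (hε : 0 < ε) (l : Fin 3) :
    WeaklySingular fun z => -(1 / regNorm ε z ^ 3 - 3 * z l ^ 2 / regNorm ε z ^ 5) := by
  refine .of_abs_le (by have := (continuous_regNorm ε).measurable; fun_prop) (4 / ε) (by positivity)
    fun z hz => .inr ?_
  have hp := regNorm_pos hε z
  have hz := norm_pos_iff.2 hz
  have h1 : |z l| ≤ regNorm ε z := (abs_coord_le z l).trans (norm_le_regNorm ε z)
  have h2 : z l ^ 2 ≤ regNorm ε z ^ 2 := sq_le_sq' (neg_le_of_abs_le h1) (le_of_abs_le h1)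
  have h3 : 3 * z l ^ 2 / regNorm ε z ^ 5 ≤ 3 / regNorm ε z ^ 3 := by
    rw [div_le_div_iff₀ (by positivity) (by positivity)]
    calc 3 * z l ^ 2 * regNorm ε z ^ 3 ≤ 3 * regNorm ε z ^ 2 * regNorm ε z ^ 3 := by gcongr
      _ = _ := by ring
  have h4 : 0 ≤ 3 * z l ^ 2 / regNorm ε z ^ 5 := by positivity
  have h5 : 1 / regNorm ε z ^ 3 ≤ 1 / ε / ‖z‖ ^ 2 := by
    rw [div_div]
    refine one_div_le_one_div_of_le (by positivity) ?_
    calc ε * ‖z‖ ^ 2 ≤ regNorm ε z * regNorm ε z ^ 2 := by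
          gcongr
          · exact le_regNorm ε z
          · exact norm_le_regNorm ε z
      _ = _ := by ring
  have h6 : 0 < 1 / regNorm ε z ^ 3 := by positivity
  have h7 : 3 / regNorm ε z ^ 3 = 3 * (1 / regNorm ε z ^ 3) := by ring
  have h8 : 4 / ε / ‖z‖ ^ 2 = 4 * (1 / ε / ‖z‖ ^ 2) := by ring
  rw [abs_le]; constructor <;> linarith

/-- Off the origin `1/|z|` is harmonic; after regularization `|z|² = r² - ε²` leaves only the `ε²`
remainder, a multiple of an approximate identity. -/
lemma sum_second_regNorm {ε : ℝ} (hε : 0 < ε) (z : E3) :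
    ∑ l, -(1 / regNorm ε z ^ 3 - 3 * z l ^ 2 / regNorm ε z ^ 5) =
      -(3 * ε ^ 2 / regNorm ε z ^ 5) := by
  have hp := regNorm_pos hε z
  have h1 := regNorm_sq ε z
  rw [norm_sq_eq_sum, Fin.sum_univ_three] at h1
  rw [Fin.sum_univ_three]
  field_simp
  linear_combination (-3) * h1

lemma integral_mul_hasLineDerivAt {k k' V V' : E3 → ℝ} {v : E3}
    (hk : WeaklySingular k) (hk' : WeaklySingular k') (hV : CubicDecay V) (hV' : CubicDecay V')
    (h : ∀ z, HasLineDerivAt ℝ k (k' z) z v) (h' : ∀ z, HasLineDerivAt ℝ V (V' z) z v) :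
    ∫ z, k z * V' z = -∫ z, k' z * V z :=
  integral_bilinear_hasLineDerivAt_right_eq_neg_left_of_integrable (B := ContinuousLinearMap.mul ℝ ℝ)
    (hk'.integrable_mul_decay hV) (hk.integrable_mul_decay hV') (hk.integrable_mul_decay hV)
    (fun z _ => h z) (fun z _ => h' z)

/-- A positive null sequence. -/
noncomputable def epsSeq (n : ℕ) : ℝ := 1 / ((n : ℝ) + 1)

lemma epsSeq_pos (n : ℕ) : 0 < epsSeq n := Nat.one_div_pos_of_nat

lemma tendsto_epsSeq : Tendsto epsSeq atTop (𝓝 0) := tendsto_one_div_add_atTop_nhds_zero_nat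

lemma tendsto_regNorm (z : E3) : Tendsto (fun n => regNorm (epsSeq n) z) atTop (𝓝 ‖z‖) := by
  have : Continuous fun ε => regNorm ε z := by unfold regNorm; fun_prop
  have h := (this.tendsto 0).comp tendsto_epsSeq
  rwa [show regNorm 0 z = ‖z‖ by simp [regNorm]] at h

lemma tendsto_integral_inv_regNorm {V : E3 → ℝ} (hV : CubicDecay V) :
    Tendsto (fun n => ∫ z, 1 / regNorm (epsSeq n) z * V z) atTop (𝓝 (∫ z, 1 / ‖z‖ * V z)) := by
  have hk : WeaklySingular fun z => 1 / ‖z‖ :=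
    .of_abs_le (by fun_prop) 1 zero_le_one fun z hz => .inl (by rw [abs_of_nonneg (by positivity)])
  -- The unregularized integrand dominates all the regularized ones.
  refine tendsto_integral_of_dominated_convergence (fun z => ‖1 / ‖z‖ * V z‖)
    (fun n => ((weaklySingular_inv_regNorm (epsSeq_pos n)).integrable_mul_decay hV).1)
    (hk.integrable_mul_decay hV).norm (fun n => ?_) ?_
  · filter_upwards [Measure.ae_ne volume (0 : E3)] with z hz
    rw [norm_mul, norm_mul]
    gcongr
    have := regNorm_pos (epsSeq_pos n) z
    rw [Real.norm_of_nonneg (by positivity), Real.norm_of_nonneg (by positivity)]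
    exact one_div_regNorm_le hz
  · filter_upwards [Measure.ae_ne volume (0 : E3)] with z hz
    exact (tendsto_const_nhds.div (tendsto_regNorm z) (norm_ne_zero_iff.2 hz)).mul_const _

lemma weaklySingular_coord_div (l : Fin 3) : WeaklySingular fun z => z l / ‖z‖ ^ 3 := by
  refine .of_abs_le (by fun_prop) 1 zero_le_one fun z hz => .inr ?_
  have hz := norm_pos_iff.2 hz
  rw [abs_div, abs_of_pos (pow_pos hz 3), div_le_div_iff₀ (by positivity) (by positivity), one_mul]
  calc |z l| * ‖z‖ ^ 2 ≤ ‖z‖ * ‖z‖ ^ 2 := by gcongr; exact abs_coord_le z l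
    _ = _ := by ring

lemma tendsto_integral_coord_div_regNorm {V : E3 → ℝ} (hV : CubicDecay V) (l : Fin 3) :
    Tendsto (fun n => ∫ z, -(z l / regNorm (epsSeq n) z ^ 3) * V z) atTop
      (𝓝 (∫ z, -(z l / ‖z‖ ^ 3) * V z)) := by
  have hk : WeaklySingular fun z => 1 / ‖z‖ ^ 2 :=
    .of_abs_le (by fun_prop) 1 zero_le_one fun z hz => .inr (by rw [abs_of_nonneg (by positivity)])
  refine tendsto_integral_of_dominated_convergence (fun z => ‖1 / ‖z‖ ^ 2 * V z‖)
    (fun n => ((weaklySingular_coord_div_regNorm (epsSeq_pos n) l).integrable_mul_decay hV).1)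
    (hk.integrable_mul_decay hV).norm (fun n => ?_) ?_
  · filter_upwards [Measure.ae_ne volume (0 : E3)] with z hz
    rw [norm_mul, norm_mul]
    gcongr
    rw [Real.norm_of_nonneg (by positivity : 0 ≤ 1 / ‖z‖ ^ 2), norm_neg]
    exact abs_coord_div_regNorm_le (epsSeq_pos n) hz l
  · filter_upwards [Measure.ae_ne volume (0 : E3)] with z hz
    exact (tendsto_const_nhds.div ((tendsto_regNorm z).pow 3)
      (pow_ne_zero 3 (norm_ne_zero_iff.2 hz))).neg.mul_const _

/-- Integration by parts against the Newtonian potential. -/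
lemma integral_inv_norm_mul_lineDeriv {V V' : E3 → ℝ} (hV : CubicDecay V) (hV' : CubicDecay V')
    (l : Fin 3) (h : ∀ z, HasLineDerivAt ℝ V (V' z) z (unitVec l)) :
    ∫ z, 1 / ‖z‖ * V' z = ∫ z, z l / ‖z‖ ^ 3 * V z := by
  -- Integrate by parts at fixed `ε` and let `ε → 0`. Both limiting kernels are locally integrable,
  -- so the singularity leaves no residue.
  have h1 := tendsto_integral_inv_regNorm hV'
  have h2 := (tendsto_integral_coord_div_regNorm hV l).neg
  have h3 : ∀ n, ∫ z, 1 / regNorm (epsSeq n) z * V' z =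
      -∫ z, -(z l / regNorm (epsSeq n) z ^ 3) * V z := fun n =>
    integral_mul_hasLineDerivAt (weaklySingular_inv_regNorm (epsSeq_pos n))
      (weaklySingular_coord_div_regNorm (epsSeq_pos n) l) hV hV'
      (fun z => hasLineDerivAt_inv_regNorm (epsSeq_pos n) z l) h
  simp_rw [h3] at h1
  rw [tendsto_nhds_unique h1 h2, ← integral_neg]
  simp

/-! ### The approximate identity and the Newtonian representation -/

/-- The Poisson-type kernel `3 (1 + |u|²)^(-5/2)`. -/
noncomputable def bump (u : E3) : ℝ := 3 / regNorm 1 u ^ 5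

/-- An explicit primitive is `(y / √(y² + 1))³`, which grows from 0 to 1. The unevaluated `1 ^ 2`
matches `regNorm 1`. -/
lemma integral_radial_bump :
    IntegrableOn (fun y : ℝ => y ^ 2 * (3 / √(y ^ 2 + 1 ^ 2) ^ 5)) (Set.Ioi 0) ∧
    ∫ y in Set.Ioi (0 : ℝ), y ^ 2 * (3 / √(y ^ 2 + 1 ^ 2) ^ 5) = 1 := by
  have hs : ∀ y : ℝ, 0 < √(y ^ 2 + 1 ^ 2) := fun y => Real.sqrt_pos.2 (by positivity)
  have hd : ∀ y ∈ Set.Ici (0 : ℝ), HasDerivAt (fun y => (y / √(y ^ 2 + 1 ^ 2)) ^ 3)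
      (y ^ 2 * (3 / √(y ^ 2 + 1 ^ 2) ^ 5)) y := by
    intro y _
    have h0 : HasDerivAt (fun y : ℝ => y ^ 2 + 1 ^ 2) (2 * y) y := by
      simpa using (hasDerivAt_pow 2 y).add_const (1 ^ 2 : ℝ)
    have h1 := h0.sqrt (by positivity)
    refine (((hasDerivAt_id' y).fun_div h1 (hs y).ne').fun_pow 3).congr_deriv ?_
    have h2 : √(y ^ 2 + 1 ^ 2) ^ 2 = y ^ 2 + 1 ^ 2 := Real.sq_sqrt (by positivity)
    have := hs y
    simp only [Nat.cast_ofNat, one_mul]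
    set s := √(y ^ 2 + 1 ^ 2)
    have hy : y ^ 2 = s ^ 2 - 1 := by linarith
    rw [show 3 - 1 = 2 from rfl, div_pow]
    field_simp
    rw [hy]
    ring
  have hlim : Tendsto (fun y : ℝ => (y / √(y ^ 2 + 1 ^ 2)) ^ 3) atTop (𝓝 1) := by
    have h1 : Tendsto (fun y : ℝ => √(1 - (y ^ 2 + 1 ^ 2)⁻¹)) atTop (𝓝 √(1 - 0)) := by
      refine ((Real.continuous_sqrt.tendsto _).comp ?_)
      refine tendsto_const_nhds.sub (tendsto_inv_atTop_zero.comp ?_)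
      exact tendsto_atTop_add_const_right _ _ (tendsto_pow_atTop two_ne_zero)
    have h2 : (fun y : ℝ => √(1 - (y ^ 2 + 1 ^ 2)⁻¹)) =ᶠ[atTop] fun y => y / √(y ^ 2 + 1 ^ 2) := by
      filter_upwards [eventually_ge_atTop 0] with y hy
      rw [show 1 - (y ^ 2 + 1 ^ 2)⁻¹ = y ^ 2 / (y ^ 2 + 1 ^ 2) by field_simp; ring,
        Real.sqrt_div (by positivity), Real.sqrt_sq hy]
    simpa using (h1.congr' h2).pow 3
  have hn : ∀ y ∈ Set.Ioi (0 : ℝ), 0 ≤ y ^ 2 * (3 / √(y ^ 2 + 1 ^ 2) ^ 5) := fun y _ => by positivity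
  refine ⟨integrableOn_Ioi_deriv_of_nonneg' hd hn hlim, ?_⟩
  rw [integral_Ioi_of_hasDerivAt_of_nonneg' hd hn hlim]
  simp

lemma integrable_bump : Integrable bump := by
  refine (integrable_fun_norm_addHaar volume
    (f := fun y : ℝ => 3 / √(y ^ 2 + 1 ^ 2) ^ 5)).2 ?_
  simpa [finrank_euclideanSpace] using integral_radial_bump.1

lemma integral_bump : ∫ u, bump u = 4 * Real.pi := by
  have h := integral_fun_norm_addHaar (volume : Measure E3)
    (fun y : ℝ => 3 / √(y ^ 2 + 1 ^ 2) ^ 5)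
  have h2 := integral_radial_bump.2
  simp only [finrank_euclideanSpace, Fintype.card_fin, smul_eq_mul, Nat.add_one_sub_one] at h
  rw [h2] at h
  -- The polar formula carries the factor dimension times volume of the unit ball, that is `3 · 4π/3
  -- = 4π`.
  have h3 : (volume : Measure E3).real (Metric.ball 0 1) = Real.pi * 4 / 3 := by
    rw [measureReal_def, EuclideanSpace.volume_ball_fin_three]
    simp [ENNReal.toReal_ofReal (by positivity : (0 : ℝ) ≤ Real.pi * 4 / 3)]
  rw [h3] at h
  unfold bump regNorm
  rw [h]
  simp; ring

lemma regNorm_smul {ε : ℝ} (hε : 0 < ε) (u : E3) : regNorm ε (ε • u) = ε * regNorm 1 u := by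
  unfold regNorm
  rw [norm_smul, Real.norm_of_nonneg hε.le,
    show (ε * ‖u‖) ^ 2 + ε ^ 2 = ε ^ 2 * (‖u‖ ^ 2 + 1 ^ 2) by ring, Real.sqrt_mul (by positivity),
    Real.sqrt_sq hε.le]

lemma CubicDecay.bounded {V : E3 → ℝ} (hV : CubicDecay V) : ∃ C, ∀ y, |V y| ≤ C := by
  obtain ⟨-, C, hC⟩ := hV
  refine ⟨C, fun y => (hC y).trans ?_⟩
  have hC0 : 0 ≤ C := by simpa using (abs_nonneg _).trans (hC 0)
  exact div_le_self hC0 (one_le_pow₀ (by linarith [norm_nonneg y]))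

/-- Under `z = ε u` the Jacobian `ε³` and the factor `ε²` cancel the `ε⁵` from the denominator. The
kernel becomes the fixed `bump`, of mass `4π`, and `V (ε u) → V 0` boundedly. -/
lemma tendsto_integral_bump {V : E3 → ℝ} (hV : CubicDecay V) :
    Tendsto (fun n => ∫ z, 3 * epsSeq n ^ 2 / regNorm (epsSeq n) z ^ 5 * V z) atTop
      (𝓝 (4 * Real.pi * V 0)) := by
  have h1 : ∀ n, ∫ z, 3 * epsSeq n ^ 2 / regNorm (epsSeq n) z ^ 5 * V z =
      ∫ u, bump u * V (epsSeq n • u) := fun n => by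
    have he := epsSeq_pos n
    have := Measure.integral_comp_smul (volume : Measure E3)
      (fun z => 3 * epsSeq n ^ 2 / regNorm (epsSeq n) z ^ 5 * V z) (epsSeq n)
    simp only [finrank_euclideanSpace, Fintype.card_fin, smul_eq_mul, regNorm_smul he] at this
    rw [abs_of_pos (by positivity), inv_mul_eq_div, eq_div_iff (by positivity)] at this
    rw [← this, ← integral_mul_const]
    refine integral_congr_ae (.of_forall fun u => ?_)
    have := regNorm_pos one_pos u
    simp only [bump]
    field_simp
  simp_rw [h1]
  obtain ⟨C, hC⟩ := hV.bounded
  rw [← integral_bump, ← integral_mul_const]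
  refine tendsto_integral_of_dominated_convergence (fun u => ‖bump u‖ * C) (fun n => ?_)
    (integrable_bump.norm.mul_const C) (fun n => .of_forall fun u => ?_) (.of_forall fun u => ?_)
  · exact integrable_bump.1.mul (hV.1.comp (by fun_prop)).aestronglyMeasurable
  · rw [norm_mul]; gcongr; exact hC _
  · have := (hV.1.tendsto (0 : E3)).comp
      (f := fun n => epsSeq n • u) (x := atTop) (by simpa using tendsto_epsSeq.smul_const u)
    exact this.const_mul _

/-- The representation of a decaying function by the Newtonian potential of its Laplacian. -/
lemma integral_inv_norm_mul_laplacian {V : E3 → ℝ} {V₁ V₂ : Fin 3 → E3 → ℝ} (hV : CubicDecay V)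
    (hV₁ : ∀ l, CubicDecay (V₁ l)) (hV₂ : ∀ l, CubicDecay (V₂ l))
    (h₁ : ∀ l z, HasLineDerivAt ℝ V (V₁ l z) z (unitVec l))
    (h₂ : ∀ l z, HasLineDerivAt ℝ (V₁ l) (V₂ l z) z (unitVec l)) :
    ∑ l, ∫ z, 1 / ‖z‖ * V₂ l z = -(4 * Real.pi * V 0) := by
  have h3 : ∀ n, ∑ l, ∫ z, 1 / regNorm (epsSeq n) z * V₂ l z =
      -∫ z, 3 * epsSeq n ^ 2 / regNorm (epsSeq n) z ^ 5 * V z := fun n => by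
    have he := epsSeq_pos n
    -- Two integrations by parts move both derivatives onto the regularized kernel; the two signs
    -- cancel.
    have h4 : ∀ l, ∫ z, 1 / regNorm (epsSeq n) z * V₂ l z =
        ∫ z, -(1 / regNorm (epsSeq n) z ^ 3 - 3 * z l ^ 2 / regNorm (epsSeq n) z ^ 5) * V z :=
      fun l => by
      rw [integral_mul_hasLineDerivAt (weaklySingular_inv_regNorm he)
        (weaklySingular_coord_div_regNorm he l) (hV₁ l) (hV₂ l)
        (fun z => hasLineDerivAt_inv_regNorm he z l) (h₂ l),
        integral_mul_hasLineDerivAt (weaklySingular_coord_div_regNorm he l)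
        (weaklySingular_second he l) hV (hV₁ l)
        (fun z => hasLineDerivAt_coord_div_regNorm he z l) (h₁ l), neg_neg]
    simp_rw [h4]
    rw [← integral_finsetSum _ fun l _ => (weaklySingular_second he l).integrable_mul_decay hV,
      ← integral_neg]
    refine integral_congr_ae (.of_forall fun z => ?_)
    simp only
    rw [← Finset.sum_mul, sum_second_regNorm he, neg_mul]
  have h4 : Tendsto (fun n => ∑ l, ∫ z, 1 / regNorm (epsSeq n) z * V₂ l z) atTop
      (𝓝 (∑ l, ∫ z, 1 / ‖z‖ * V₂ l z)) :=
    tendsto_finsetSum _ fun l _ => tendsto_integral_inv_regNorm (hV₂ l)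
  simp_rw [h3] at h4
  exact tendsto_nhds_unique h4 (tendsto_integral_bump hV).neg

/-! ### Random fields and differentiation under the expectation -/

section Random

variable {Ω : Type*} [MeasurableSpace Ω]

/-- The derivative is a pointwise limit of measurable difference quotients. Measurability is known
only for `s` near `s₀`, so `G` replaces the other functions by 0 without changing the germ at `s₀`.
-/
lemma measurable_of_hasDerivAt {H : ℝ → Ω → ℝ} {H' : Ω → ℝ} {s₀ : ℝ}
    (hm : ∀ᶠ s in 𝓝 s₀, Measurable (H s)) (hd : ∀ σ, HasDerivAt (fun s => H s σ) (H' σ) s₀) :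
    Measurable H' := by
  classical
  set G : ℝ → Ω → ℝ := fun s => if Measurable (H s) then H s else 0 with hG
  have hGm : ∀ s, Measurable (G s) := fun s => by
    simp only [hG]; split_ifs with h
    · exact h
    · exact measurable_zero
  have hGd : ∀ σ, HasDerivAt (fun s => G s σ) (H' σ) s₀ := fun σ => by
    refine (hd σ).congr_of_eventuallyEq ?_
    filter_upwards [hm] with s hs
    simp [hG, hs]
  refine measurable_of_tendsto_metrizable' (𝓝[≠] s₀)
    (f := fun s σ => (s - s₀)⁻¹ * (G s σ - G s₀ σ)) (fun s => ?_) ?_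
  · exact ((hGm s).sub (hGm s₀)).const_mul _
  · rw [tendsto_pi_nhds]
    intro σ
    exact hasDerivAt_iff_tendsto_slope.1 (hGd σ)

/-- Differentiation under the expectation. -/
lemma hasDerivAt_expectation {ℙ : Measure Ω} {H H' : ℝ → Ω → ℝ} {s₀ : ℝ} {S : Set ℝ}
    (hS : S ∈ 𝓝 s₀) {M : Ω → ℝ} (hM : Integrable M ℙ)
    (hm : ∀ s ∈ S, Measurable (H s)) (hi : Integrable (H s₀) ℙ)
    (hd : ∀ σ, ∀ s ∈ S, HasDerivAt (fun s => H s σ) (H' s σ) s)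
    (hb : ∀ σ, ∀ s ∈ S, |H' s σ| ≤ M σ) :
    HasDerivAt (fun s => ∫ σ, H s σ ∂ℙ) (∫ σ, H' s₀ σ ∂ℙ) s₀ := by
  have hm' := eventually_of_mem hS hm
  refine (hasDerivAt_integral_of_dominated_loc_of_deriv_le hS
    (hm'.mono fun s hs => hs.aestronglyMeasurable) hi
    (measurable_of_hasDerivAt hm' fun σ => hd σ s₀ (mem_of_mem_nhds hS)).aestronglyMeasurable
    (.of_forall fun σ => hb σ) hM (.of_forall fun σ => hd σ)).2

/-- The half space of positive times. -/
def posTime : Set (E3 × ℝ) := {p | 0 < p.2}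

lemma isOpen_posTime : IsOpen posTime := isOpen_lt continuous_const continuous_snd

lemma posTime_mem_nhds {p : E3 × ℝ} (hp : p ∈ posTime) : posTime ∈ 𝓝 p :=
  isOpen_posTime.mem_nhds hp

/-- A random scalar field whose realizations are smooth for positive times, all derivatives being
`O(|x|⁻³)` with a square integrable random constant. -/
structure RandField (ℙ : Measure Ω) (X : E3 × ℝ → Ω → ℝ) : Prop where
  measurable : ∀ p ∈ posTime, Measurable (X p)
  smooth : ∀ σ, ContDiffOn ℝ ∞ (fun p => X p σ) posTime
  decay : ∀ (n : ℕ) (K : Set ℝ), IsCompact K → K ⊆ Set.Ioi 0 →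
    ∃ M : Ω → ℝ, MemLp M 2 ℙ ∧ ∀ σ, ∀ t ∈ K, ∀ x : E3,
      ‖iteratedFDeriv ℝ n (fun p => X p σ) (x, t)‖ ≤ M σ / (1 + ‖x‖) ^ 3

/-- The derivative of a random field in a space-time direction. -/
noncomputable def dirField (v : E3 × ℝ) (X : E3 × ℝ → Ω → ℝ) (p : E3 × ℝ) (σ : Ω) : ℝ :=
  fderiv ℝ (fun q => X q σ) p v

/-- The space-time direction `∂/∂x^k`. -/
noncomputable abbrev spaceDir (k : Fin 3) : E3 × ℝ := (unitVec k, 0)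

/-- The space-time direction `∂/∂t`. -/
noncomputable abbrev timeDir : E3 × ℝ := (0, 1)

namespace RandField

variable {ℙ : Measure Ω} {X Y : E3 × ℝ → Ω → ℝ}

lemma contDiffAt (hX : RandField ℙ X) (σ : Ω) {p : E3 × ℝ} (hp : p ∈ posTime) :
    ContDiffAt ℝ ∞ (fun p => X p σ) p :=
  (hX.smooth σ).contDiffAt (posTime_mem_nhds hp)

lemma hasFDerivAt (hX : RandField ℙ X) (σ : Ω) {p : E3 × ℝ} (hp : p ∈ posTime) :
    HasFDerivAt (fun p => X p σ) (fderiv ℝ (fun p => X p σ) p) p :=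
  ((hX.contDiffAt σ hp).differentiableAt (by simp)).hasFDerivAt

lemma hasDerivAt_line (hX : RandField ℙ X) (σ : Ω) {p v : E3 × ℝ} {s : ℝ}
    (hp : p + s • v ∈ posTime) :
    HasDerivAt (fun s : ℝ => X (p + s • v) σ) (dirField v X (p + s • v) σ) s := by
  have h1 : HasDerivAt (fun s : ℝ => p + s • v) v s := by
    simpa using ((hasDerivAt_id s).smul_const v).const_add p
  exact (hX.hasFDerivAt σ hp).comp_hasDerivAt s h1

lemma eventually_line {p : E3 × ℝ} (hp : p ∈ posTime) (v : E3 × ℝ) :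
    ∀ᶠ s : ℝ in 𝓝 0, p + s • v ∈ posTime := by
  have : Continuous fun s : ℝ => p + s • v := by fun_prop
  exact (this.tendsto 0).eventually (posTime_mem_nhds (by simpa using hp))

/-- Derivatives stay in the class: order `n` of the derivative is controlled by order `n + 1` of the
field, and measurability follows from difference quotients in the direction `v`. -/
lemma dir (hX : RandField ℙ X) (v : E3 × ℝ) : RandField ℙ (dirField v X) where
  measurable p hp := by
    refine measurable_of_hasDerivAt (H := fun s => X (p + s • v)) (s₀ := 0)
      ((eventually_line hp v).mono fun s hs => hX.measurable _ hs) fun σ => ?_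
    have := hX.hasDerivAt_line σ (p := p) (v := v) (s := 0) (by simpa using hp)
    simpa using this
  smooth σ := by
    have := (hX.smooth σ).fderiv_of_isOpen (m := ∞) isOpen_posTime (by simp)
    exact this.clm_apply contDiffOn_const
  decay n K hK hK0 := by
    obtain ⟨M, hM, h⟩ := hX.decay (n + 1) K hK hK0
    set L : ((E3 × ℝ) →L[ℝ] ℝ) →L[ℝ] ℝ := ContinuousLinearMap.apply ℝ ℝ v
    refine ⟨fun σ => ‖L‖ * M σ, hM.const_mul _, fun σ t ht x => ?_⟩
    have h1 : ContDiffAt ℝ ∞ (fderiv ℝ fun p => X p σ) (x, t) :=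
      (hX.contDiffAt σ (hK0 ht)).fderiv_right (by simp)
    have h2 := L.iteratedFDeriv_comp_left h1 (i := n) (by exact_mod_cast le_top)
    calc ‖iteratedFDeriv ℝ n (fun p => dirField v X p σ) (x, t)‖
        = ‖iteratedFDeriv ℝ n (L ∘ fderiv ℝ fun p => X p σ) (x, t)‖ := rfl
      _ ≤ ‖L‖ * ‖iteratedFDeriv ℝ n (fderiv ℝ fun p => X p σ) (x, t)‖ := by
          rw [h2]; exact L.norm_compContinuousMultilinearMap_le _
      _ ≤ ‖L‖ * (M σ / (1 + ‖x‖) ^ 3) := by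
          rw [norm_iteratedFDeriv_fderiv]; gcongr; exact h σ t ht x
      _ = _ := by ring

lemma add (hX : RandField ℙ X) (hY : RandField ℙ Y) : RandField ℙ fun p σ => X p σ + Y p σ where
  measurable p hp := (hX.measurable p hp).add (hY.measurable p hp)
  smooth σ := (hX.smooth σ).add (hY.smooth σ)
  decay n K hK hK0 := by
    obtain ⟨M, hM, h⟩ := hX.decay n K hK hK0
    obtain ⟨N, hN, h'⟩ := hY.decay n K hK hK0
    refine ⟨fun σ => M σ + N σ, hM.add hN, fun σ t ht x => ?_⟩
    have hn : ((n : ℕ∞) : WithTop ℕ∞) ≤ ∞ := by exact_mod_cast le_top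
    have := iteratedFDeriv_add_apply ((hX.contDiffAt σ (hK0 ht : (x, t) ∈ posTime)).of_le hn)
      ((hY.contDiffAt σ (hK0 ht : (x, t) ∈ posTime)).of_le hn)
    calc _ = ‖iteratedFDeriv ℝ n (fun p => X p σ) (x, t) +
          iteratedFDeriv ℝ n (fun p => Y p σ) (x, t)‖ := by rw [← this]; rfl
      _ ≤ _ := (norm_add_le _ _).trans (add_le_add (h σ t ht x) (h' σ t ht x))
      _ = _ := by ring

lemma const_mul (hX : RandField ℙ X) (c : ℝ) : RandField ℙ fun p σ => c * X p σ where
  measurable p hp := (hX.measurable p hp).const_mul c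
  smooth σ := contDiffOn_const.mul (hX.smooth σ)
  decay n K hK hK0 := by
    obtain ⟨M, hM, h⟩ := hX.decay n K hK hK0
    refine ⟨fun σ => |c| * M σ, hM.const_mul _, fun σ t ht x => ?_⟩
    have hn : ((n : ℕ∞) : WithTop ℕ∞) ≤ ∞ := by exact_mod_cast le_top
    have := iteratedFDeriv_const_smul_apply (a := c)
      ((hX.contDiffAt σ (hK0 ht : (x, t) ∈ posTime)).of_le hn)
    calc _ = ‖c • iteratedFDeriv ℝ n (fun p => X p σ) (x, t)‖ := by rw [← this]; rfl
      _ ≤ |c| * (M σ / (1 + ‖x‖) ^ 3) := by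
          rw [norm_smul, Real.norm_eq_abs]; gcongr; exact h σ t ht x
      _ = _ := by ring

lemma zero : RandField ℙ fun _ (_ : Ω) => (0 : ℝ) where
  measurable p hp := measurable_const
  smooth σ := contDiffOn_const
  decay n K hK hK0 := ⟨0, MemLp.zero, fun σ t ht x => by simp⟩

lemma sum {ι : Type*} (s : Finset ι) {X : ι → E3 × ℝ → Ω → ℝ} (h : ∀ i, RandField ℙ (X i)) :
    RandField ℙ fun p σ => ∑ i ∈ s, X i p σ := by
  classical
  induction s using Finset.induction_on with
  | empty => simpa using zero
  | insert a s ha ih => simpa [Finset.sum_insert ha] using (h a).add ih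

lemma bound (hX : RandField ℙ X) {K : Set ℝ} (hK : IsCompact K) (hK0 : K ⊆ Set.Ioi 0) :
    ∃ M : Ω → ℝ, MemLp M 2 ℙ ∧ (∀ σ, ∀ t ∈ K, ∀ x : E3, |X (x, t) σ| ≤ M σ / (1 + ‖x‖) ^ 3) ∧
      ∀ σ, ∀ t ∈ K, ∀ x : E3, |X (x, t) σ| ≤ M σ := by
  obtain ⟨M, hM, h⟩ := hX.decay 0 K hK hK0
  have h1 : ∀ σ, ∀ t ∈ K, ∀ x : E3, |X (x, t) σ| ≤ M σ / (1 + ‖x‖) ^ 3 := fun σ t ht x => by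
    simpa using h σ t ht x
  refine ⟨M, hM, h1, fun σ t ht x => (h1 σ t ht x).trans (div_le_self ?_ ?_)⟩
  · simpa using (abs_nonneg _).trans (h1 σ t ht 0)
  · exact one_le_pow₀ (by linarith [norm_nonneg x])

/-- Square integrability is what makes products of two fields, as in the convection and stretching
terms, integrable. -/
lemma memLp (hX : RandField ℙ X) {p : E3 × ℝ} (hp : p ∈ posTime) : MemLp (X p) 2 ℙ := by
  obtain ⟨M, hM, -, h⟩ := hX.bound (isCompact_singleton (x := p.2))
    (Set.singleton_subset_iff.2 hp)
  exact hM.mono (hX.measurable p hp).aestronglyMeasurable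
    (.of_forall fun σ => (h σ p.2 rfl p.1).trans (le_abs_self _))

variable [IsProbabilityMeasure ℙ]

lemma integrable (hX : RandField ℙ X) {p : E3 × ℝ} (hp : p ∈ posTime) : Integrable (X p) ℙ :=
  (hX.memLp hp).integrable (by norm_num)

lemma integrable_mul (hX : RandField ℙ X) {p : E3 × ℝ} (hp : p ∈ posTime) {ξ : Ω → ℝ}
    (hξ : Measurable ξ) {C : ℝ} (hC : ∀ σ, |ξ σ| ≤ C) : Integrable (fun σ => ξ σ * X p σ) ℙ :=
  (hX.integrable hp).bdd_mul hξ.aestronglyMeasurable (.of_forall hC)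

end RandField

/-! ### Correlations as deterministic functions of the point -/

/-- The correlation of a random field with a random variable. -/
noncomputable def expField (ℙ : Measure Ω) (ξ : Ω → ℝ) (X : E3 × ℝ → Ω → ℝ) (t : ℝ) (y : E3) : ℝ :=
  ∫ σ, ξ σ * X (y, t) σ ∂ℙ

lemma expField_congr {ℙ : Measure Ω} {X Y : E3 × ℝ → Ω → ℝ} {ξ : Ω → ℝ} {t : ℝ}
    (h : ∀ y σ, X (y, t) σ = Y (y, t) σ) : expField ℙ ξ X t = expField ℙ ξ Y t := by
  funext y; simp only [expField, h]

namespace RandField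

variable {ℙ : Measure Ω} [IsProbabilityMeasure ℙ] {X Y : E3 × ℝ → Ω → ℝ}
  {ξ : Ω → ℝ} {C t : ℝ}

/-- Pairing with a bounded `ξ` replaces the random decay constant `M` by the number `E[C M]`, so the
Newtonian representation applies to correlations. -/
lemma cubicDecay_expField (hX : RandField ℙ X) (hξ : Measurable ξ) (hC : ∀ σ, |ξ σ| ≤ C)
    (ht : 0 < t) : CubicDecay (expField ℙ ξ X t) := by
  obtain ⟨M, hM, hb, hb'⟩ := hX.bound (isCompact_singleton (x := t))
    (Set.singleton_subset_iff.2 ht)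
  have hM1 : Integrable M ℙ := hM.integrable (by norm_num)
  have hC0 : ∀ σ, 0 ≤ C := fun σ => (abs_nonneg _).trans (hC σ)
  constructor
  · refine continuous_of_dominated (bound := fun σ => C * M σ) (fun y => ?_)
      (fun y => .of_forall fun σ => ?_) (hM1.const_mul C) (.of_forall fun σ => ?_)
    · exact (hξ.mul (hX.measurable (y, t) ht)).aestronglyMeasurable
    · rw [norm_mul]
      exact mul_le_mul (hC σ) (hb' σ t rfl y) (norm_nonneg _) (hC0 σ)
    · refine continuous_const.mul (continuous_iff_continuousAt.2 fun y => ?_)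
      exact (hX.contDiffAt σ (p := (y, t)) ht).continuousAt.comp
        (f := fun y : E3 => (y, t)) (by fun_prop)
  · refine ⟨∫ σ, C * M σ ∂ℙ, fun y => ?_⟩
    rw [div_eq_mul_inv, ← integral_mul_const]
    refine norm_integral_le_of_norm_le (f := fun σ => ξ σ * X (y, t) σ)
      ((hM1.const_mul C).mul_const _) (.of_forall fun σ => ?_)
    rw [norm_mul, mul_assoc, ← div_eq_mul_inv]
    exact mul_le_mul (hC σ) (hb σ t rfl y) (norm_nonneg _) (hC0 σ)

lemma hasLineDerivAt_expField (hX : RandField ℙ X) (hξ : Measurable ξ) (hC : ∀ σ, |ξ σ| ≤ C)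
    (ht : 0 < t) (y v : E3) :
    HasLineDerivAt ℝ (expField ℙ ξ X t) (expField ℙ ξ (dirField (v, 0) X) t y) y v := by
  obtain ⟨M, hM, -, hb⟩ := (hX.dir (v, 0)).bound (isCompact_singleton (x := t))
    (Set.singleton_subset_iff.2 ht)
  have hM1 : Integrable M ℙ := hM.integrable (by norm_num)
  have h0 : ∀ s : ℝ, (y, t) + s • ((v, 0) : E3 × ℝ) = (y + s • v, t) := fun s => by simp
  -- The direction is purely spatial, so time stays at `t` and the bound holds for every `s`.
  have := hasDerivAt_expectation (ℙ := ℙ) (S := Set.univ) (s₀ := 0) univ_mem (hM1.const_mul C)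
    (H := fun s σ => ξ σ * X (y + s • v, t) σ)
    (H' := fun s σ => ξ σ * dirField (v, 0) X (y + s • v, t) σ)
    (fun s _ => hξ.mul (hX.measurable _ ht)) (hX.integrable_mul ht hξ hC) (fun σ s _ => ?_)
    (fun σ s _ => ?_)
  · simp only [zero_smul, add_zero] at this
    exact this
  · have := hX.hasDerivAt_line σ (p := (y, t)) (v := (v, 0)) (s := s) (by rw [h0]; exact ht)
    simp only [h0] at this
    exact this.const_mul _
  · rw [abs_mul]
    exact mul_le_mul (hC σ) (hb σ t rfl _) (abs_nonneg _) ((abs_nonneg _).trans (hC σ))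

lemma expField_sum {ι : Type*} (s : Finset ι) {X : ι → E3 × ℝ → Ω → ℝ} {c : ι → ℝ}
    (h : ∀ i, RandField ℙ (X i)) (hξ : Measurable ξ) (hC : ∀ σ, |ξ σ| ≤ C) (ht : 0 < t) (y : E3) :
    expField ℙ ξ (fun p σ => ∑ i ∈ s, c i * X i p σ) t y =
      ∑ i ∈ s, c i * expField ℙ ξ (X i) t y := by
  simp only [expField, Finset.mul_sum, ← integral_const_mul]
  rw [← integral_finsetSum _ fun i _ => ?_]
  · refine integral_congr_ae (.of_forall fun σ => ?_)
    exact Finset.sum_congr rfl fun i _ => by ring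
  · exact ((h i).integrable_mul (p := (y, t)) ht hξ hC).const_mul _

end RandField

end Random

/-! ### Vector calculus for smooth fields and the vorticity equation -/

/-- The derivative of a function of space and time in a space-time direction. -/
noncomputable def dd (v : E3 × ℝ) (g : E3 × ℝ → ℝ) (p : E3 × ℝ) : ℝ := fderiv ℝ g p v

/-- Smoothness for positive times. -/
def SmoothPos (g : E3 × ℝ → ℝ) : Prop := ContDiffOn ℝ ∞ g posTime

namespace SmoothPos

variable {g h : E3 × ℝ → ℝ} {p : E3 × ℝ}

lemma contDiffAt (hg : SmoothPos g) (hp : p ∈ posTime) : ContDiffAt ℝ ∞ g p :=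
  ContDiffOn.contDiffAt hg (posTime_mem_nhds hp)

lemma hasFDerivAt (hg : SmoothPos g) (hp : p ∈ posTime) : HasFDerivAt g (fderiv ℝ g p) p :=
  ((hg.contDiffAt hp).differentiableAt (by simp)).hasFDerivAt

lemma dd (hg : SmoothPos g) (v : E3 × ℝ) : SmoothPos (dd v g) :=
  (ContDiffOn.fderiv_of_isOpen (m := ∞) hg isOpen_posTime (by simp)).clm_apply contDiffOn_const

lemma dd_comm (hg : SmoothPos g) (hp : p ∈ posTime) (v w : E3 × ℝ) :
    VorticityPDF.dd v (VorticityPDF.dd w g) p = VorticityPDF.dd w (VorticityPDF.dd v g) p := by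
  have hs : IsSymmSndFDerivAt ℝ g p := (hg.contDiffAt hp).isSymmSndFDerivAt
    (by rw [minSmoothness_of_isRCLikeNormedField]; exact WithTop.coe_le_coe.2 le_top)
  have hd : HasFDerivAt (fderiv ℝ g) (fderiv ℝ (fderiv ℝ g) p) p :=
    (((hg.contDiffAt hp).fderiv_right (m := ∞) (by simp)).differentiableAt (by simp)).hasFDerivAt
  have h : ∀ v w, VorticityPDF.dd v (VorticityPDF.dd w g) p = fderiv ℝ (fderiv ℝ g) p v w :=
    fun v w => by
    have := (hd.clm_apply (hasFDerivAt_const w p)).fderiv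
    unfold VorticityPDF.dd
    rw [this]
    simp
  rw [h, h, hs v w]

lemma dd_sum {ι : Type*} (s : Finset ι) {g : ι → E3 × ℝ → ℝ} {c : ι → ℝ}
    (hg : ∀ i, SmoothPos (g i)) (hp : p ∈ posTime) (v : E3 × ℝ) :
    VorticityPDF.dd v (fun p => ∑ i ∈ s, c i * g i p) p =
      ∑ i ∈ s, c i * VorticityPDF.dd v (g i) p := by
  have : HasFDerivAt (fun p => ∑ i ∈ s, c i * g i p) (∑ i ∈ s, c i • fderiv ℝ (g i) p) p :=
    HasFDerivAt.fun_sum fun i _ => ((hg i).hasFDerivAt hp).const_mul (c i)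
  simp only [VorticityPDF.dd]
  rw [this.fderiv]
  simp

end SmoothPos

lemma dd_congr {g h : E3 × ℝ → ℝ} {p : E3 × ℝ} (hgh : ∀ q ∈ posTime, g q = h q)
    (hp : p ∈ posTime) (v : E3 × ℝ) : dd v g p = dd v h p := by
  have : g =ᶠ[𝓝 p] h := eventually_of_mem (posTime_mem_nhds hp) hgh
  simp only [dd]
  rw [this.fderiv_eq]

section Slices

variable {g : E3 × ℝ → ℝ}

lemma hasFDerivAt_slice (hg : SmoothPos g) (x : E3) {t : ℝ} (ht : 0 < t) :
    HasFDerivAt (fun z : E3 => g (z, t))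
      ((fderiv ℝ g (x, t)).comp (ContinuousLinearMap.inl ℝ E3 ℝ)) x :=
  (hg.hasFDerivAt (p := (x, t)) ht).comp x
    (f := fun z : E3 => (z, t)) (hasFDerivAt_prodMk_left x t)

lemma pd_slice (hg : SmoothPos g) (x : E3) {t : ℝ} (ht : 0 < t) (k : Fin 3) :
    pd k (fun z => g (z, t)) x = dd (spaceDir k) g (x, t) := by
  simp only [pd]
  rw [(hasFDerivAt_slice hg x ht).fderiv]
  simp [dd]

lemma lap_slice (hg : SmoothPos g) (x : E3) {t : ℝ} (ht : 0 < t) :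
    lap (fun z => g (z, t)) x = ∑ k, dd (spaceDir k) (dd (spaceDir k) g) (x, t) := by
  refine Finset.sum_congr rfl fun k _ => ?_
  have : pd k (fun z => g (z, t)) = fun z => dd (spaceDir k) g (z, t) := by
    funext z; exact pd_slice hg z ht k
  rw [this, pd_slice (hg.dd _) x ht]

lemma deriv_slice (hg : SmoothPos g) (x : E3) {t : ℝ} (ht : 0 < t) :
    deriv (fun s => g (x, s)) t = dd timeDir g (x, t) := by
  have := (hg.hasFDerivAt (p := (x, t)) ht).comp_hasDerivAt t
    (f := fun s : ℝ => (x, s)) ((hasDerivAt_const t x).prodMk (hasDerivAt_id t))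
  exact this.deriv

end Slices

lemma fderiv_eq_sum_pd (P : E3 → ℝ) (x : E3) :
    fderiv ℝ P x = ∑ k, pd k P x • EuclideanSpace.proj (𝕜 := ℝ) k := by
  ext v
  have hv : v = ∑ k, v k • unitVec k := by
    ext j; simp [Finset.sum_apply, Pi.single_apply]
  conv_lhs => rw [hv]
  simp [pd, mul_comm]

/-- The mixed partial derivatives of a differentiable function commute as soon as its first partial
derivatives are differentiable. -/
lemma pd_comm_of_pd_eq {P : E3 → ℝ} (hP : Differentiable ℝ P) {G : Fin 3 → E3 → ℝ}
    (hG : ∀ k, Differentiable ℝ (G k)) (h : ∀ k x, pd k P x = G k x) (k l : Fin 3) (x : E3) :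
    pd k (G l) x = pd l (G k) x := by
  have h1 : fderiv ℝ P = fun x => ∑ k, G k x • EuclideanSpace.proj (𝕜 := ℝ) k := by
    funext x; rw [fderiv_eq_sum_pd]; simp only [h]
  have h2 : HasFDerivAt (fderiv ℝ P)
      (∑ k, (fderiv ℝ (G k) x).smulRight (EuclideanSpace.proj (𝕜 := ℝ) k : E3 →L[ℝ] ℝ)) x := by
    rw [h1]
    exact HasFDerivAt.fun_sum fun k _ =>
      (hG k x).hasFDerivAt.smul_const (EuclideanSpace.proj (𝕜 := ℝ) k : E3 →L[ℝ] ℝ)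
  have := second_derivative_symmetric (fun y => (hP y).hasFDerivAt) h2 (unitVec k) (unitVec l)
  simpa [pd, Pi.single_apply] using this

/-- The curl of a time-dependent vector field. -/
noncomputable def vort (u : Fin 3 → E3 × ℝ → ℝ) (i : Fin 3) (p : E3 × ℝ) : ℝ :=
  ∑ j, ∑ k, leviCivita i j k * dd (spaceDir j) (u k) p

section Vort

lemma vort_eq_sum (u : Fin 3 → E3 × ℝ → ℝ) (i : Fin 3) :
    vort u i = fun p => ∑ q : Fin 3 × Fin 3, leviCivita i q.1 q.2 * dd (spaceDir q.1) (u q.2) p := by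
  funext p; rw [Fintype.sum_prod_type]; rfl

variable {u : Fin 3 → E3 × ℝ → ℝ} (hu : ∀ i, SmoothPos (u i)) {p : E3 × ℝ} (hp : p ∈ posTime)
include hu

include hp

lemma dd_vort (v : E3 × ℝ) (i : Fin 3) :
    dd v (vort u i) p = ∑ j, ∑ k, leviCivita i j k * dd (spaceDir j) (dd v (u k)) p := by
  rw [vort_eq_sum, SmoothPos.dd_sum _ (g := fun q : Fin 3 × Fin 3 => dd (spaceDir q.1) (u q.2))
    (fun q => (hu q.2).dd _) hp, Fintype.sum_prod_type]
  refine Finset.sum_congr rfl fun j _ => Finset.sum_congr rfl fun k _ => ?_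
  rw [(hu k).dd_comm hp]

lemma dd_dd_vort (v w : E3 × ℝ) (i : Fin 3) :
    dd v (dd w (vort u i)) p = ∑ j, ∑ k, leviCivita i j k * dd (spaceDir j) (dd v (dd w (u k))) p := by
  rw [← dd_vort (fun i => (hu i).dd w) hp v i]
  exact dd_congr (fun q hq => dd_vort hu hq w i) hp v

/-- `curl curl u = - Δ u` for divergence free fields. -/
lemma vort_vort (hdiv : ∀ p ∈ posTime, ∑ j, dd (spaceDir j) (u j) p = 0) (i : Fin 3) :
    vort (vort u) i p = -∑ k, dd (spaceDir k) (dd (spaceDir k) (u i)) p := by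
  -- This is `∂ᵢ(div u) = 0`: the divergence vanishes on an open set, so it may be differentiated
  -- there.
  have h1 : ∑ j, dd (spaceDir j) (dd (spaceDir i) (u j)) p = 0 := by
    have h2 := SmoothPos.dd_sum Finset.univ (c := fun _ => 1) (fun j => (hu j).dd (spaceDir j)) hp
      (spaceDir i)
    rw [dd_congr (h := fun _ => 0) (fun q hq => by simpa using hdiv q hq) hp] at h2
    simp only [one_mul] at h2
    refine Eq.trans (Finset.sum_congr rfl fun j _ => (hu j).dd_comm hp _ _) ?_
    rw [← h2]; simp [dd]
  have hc : ∀ j k l, dd (spaceDir j) (dd (spaceDir k) (u l)) p = dd (spaceDir k) (dd (spaceDir j) (u l)) p := fun j k l => (hu l).dd_comm hp _ _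
  have h3 : ∀ j k, dd (spaceDir j) (vort u k) p = ∑ l, ∑ m, leviCivita k l m * dd (spaceDir l) (dd (spaceDir j) (u m)) p :=
    fun j k => dd_vort hu hp _ _
  change ∑ j, ∑ k, leviCivita i j k * dd (spaceDir j) (vort u k) p = _
  simp only [h3]
  fin_cases i <;> simp [Fin.sum_univ_three, leviCivita] at h1 ⊢ <;>
    linarith [hc 0 1 0, hc 0 1 1, hc 0 1 2, hc 0 2 0, hc 0 2 1, hc 0 2 2, hc 1 2 0, hc 1 2 1,
      hc 1 2 2]

/-- The vorticity equation. -/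
lemma vorticity_equation {ν : ℝ} {P : E3 → ℝ} (hP : Differentiable ℝ P)
    (hNS : ∀ x i, dd timeDir (u i) (x, p.2) + ∑ j, u j (x, p.2) * dd (spaceDir j) (u i) (x, p.2) =
      ν * ∑ k, dd (spaceDir k) (dd (spaceDir k) (u i)) (x, p.2) - pd i P x)
    (hdiv : ∑ j, dd (spaceDir j) (u j) p = 0) (i : Fin 3) :
    dd timeDir (vort u i) p + ∑ j, u j p * dd (spaceDir j) (vort u i) p =
      ∑ j, vort u j p * dd (spaceDir j) (u i) p + ν * ∑ k, dd (spaceDir k) (dd (spaceDir k) (vort u i)) p := by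
  -- By the momentum equation `F` is `∇P` at time `p.2`. The pressure is only assumed
  -- differentiable, but its gradient is thereby smooth, which is enough for its mixed derivatives
  -- to commute.
  set F : Fin 3 → E3 × ℝ → ℝ := fun i q =>
    ν * ∑ k, dd (spaceDir k) (dd (spaceDir k) (u i)) q - dd timeDir (u i) q - ∑ j, u j q * dd (spaceDir j) (u i) q with hF
  have hFs : ∀ i, SmoothPos (F i) := fun i =>
    ((contDiffOn_const.mul (ContDiffOn.sum fun k _ => ((hu i).dd _).dd _)).sub
      ((hu i).dd _)).sub (ContDiffOn.sum fun j _ => ContDiffOn.mul (hu j) ((hu i).dd _))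
  have hsym : ∀ m l, dd (spaceDir m) (F l) p = dd (spaceDir l) (F m) p := by
    intro m l
    have h1 := pd_comm_of_pd_eq hP (G := fun i x => F i (x, p.2))
      (fun k x => (hasFDerivAt_slice (hFs k) x hp).differentiableAt)
      (fun k x => by simp only [hF]; linarith [hNS x k]) m l p.1
    rwa [pd_slice (hFs l) _ hp, pd_slice (hFs m) _ hp] at h1
  have hdF : ∀ m l, dd (spaceDir m) (F l) p = ν * ∑ k, dd (spaceDir m) (dd (spaceDir k) (dd (spaceDir k) (u l))) p - dd (spaceDir m) (dd timeDir (u l)) p -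
      ∑ j, (dd (spaceDir m) (u j) p * dd (spaceDir j) (u l) p + u j p * dd (spaceDir j) (dd (spaceDir m) (u l)) p) := by
    intro m l
    have h1 : HasFDerivAt (F l) _ p :=
      (((HasFDerivAt.fun_sum (u := Finset.univ) fun k _ =>
        (((hu l).dd (spaceDir k)).dd (spaceDir k)).hasFDerivAt hp).const_mul ν).sub
        (((hu l).dd timeDir).hasFDerivAt hp)).sub (HasFDerivAt.fun_sum (u := Finset.univ) fun j _ =>
          ((hu j).hasFDerivAt hp).mul (((hu l).dd (spaceDir j)).hasFDerivAt hp))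
    have h2 : ∀ j, dd (spaceDir j) (dd (spaceDir m) (u l)) p = dd (spaceDir m) (dd (spaceDir j) (u l)) p := fun j => (hu l).dd_comm hp _ _
    simp only [h2]
    conv_lhs => unfold dd
    rw [h1.fderiv]
    simp only [sub_apply, smul_apply, sum_apply, add_apply, smul_eq_mul]
    congr 1
    exact Finset.sum_congr rfl fun j _ => by simp only [dd]; ring
  have h3 : ∀ m k l, dd (spaceDir m) (dd (spaceDir k) (dd (spaceDir k) (u l))) p = dd (spaceDir k) (dd (spaceDir k) (dd (spaceDir m) (u l))) p := fun m k l => by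
    rw [((hu l).dd _).dd_comm hp]
    exact dd_congr (fun q hq => (hu l).dd_comm hq _ _) hp _
  -- Taking the curl eliminates the pressure.
  have hE : ∑ j, ∑ k, leviCivita i j k * dd (spaceDir j) (F k) p = 0 := by
    have h01 := hsym 0 1
    have h02 := hsym 0 2
    have h12 := hsym 1 2
    fin_cases i <;> simp [Fin.sum_univ_three, leviCivita] <;> linarith
  simp only [hdF] at hE
  have hW : ∀ j, u j p * dd (spaceDir j) (vort u i) p =
      u j p * ∑ m, ∑ k, leviCivita i m k * dd (spaceDir j) (dd (spaceDir m) (u k)) p := fun j => by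
    rw [dd_vort hu hp]
    simp only [(hu _).dd_comm hp (spaceDir j)]
  simp only [hW, dd_vort hu hp timeDir, dd_dd_vort hu hp]
  simp only [vort]
  -- The remaining identity is `curl((u·∇)u) = (u·∇)W - (W·∇)u + W div u`; the multiple of `hdiv`
  -- subtracted in each case is the corresponding component of `W`.
  fin_cases i <;> simp [Fin.sum_univ_three, leviCivita] at hE hdiv ⊢
  · linear_combination -hE - (dd (spaceDir 1) (u 2) p - dd (spaceDir 2) (u 1) p) * hdiv
  · linear_combination -hE - (dd (spaceDir 2) (u 0) p - dd (spaceDir 0) (u 2) p) * hdiv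
  · linear_combination -hE - (dd (spaceDir 0) (u 1) p - dd (spaceDir 1) (u 0) p) * hdiv

end Vort

/-! ### Differentiation and integration by parts against test functions -/

lemma pd_comp {Y : Type*} [NormedAddCommGroup Y] [NormedSpace ℝ Y] {g : Y → ℝ} {φ : E3 → Y}
    {A : E3 →L[ℝ] Y} {x : E3} (hg : DifferentiableAt ℝ g (φ x)) (hφ : HasFDerivAt φ A x)
    (k : Fin 3) : pd k (fun z => g (φ z)) x = fderiv ℝ g (φ x) (A (unitVec k)) := by
  have := (hg.hasFDerivAt.comp x hφ).fderiv
  unfold pd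
  change fderiv ℝ (g ∘ φ) x _ = _
  rw [this]; rfl

/-- Differentiation under the integral against a compactly supported weight. -/
lemma hasDerivAt_integral_of_hasCompactSupport {φ : E3 → ℝ} (hφ : Continuous φ)
    (hc : HasCompactSupport φ) {F F' : E3 → ℝ → ℝ} {s₀ : ℝ} {S : Set ℝ} (hS : S ∈ 𝓝 s₀)
    (hF : ∀ s ∈ S, Continuous fun w => F w s)
    (hd : ∀ w, ∀ s ∈ S, HasDerivAt (F w) (F' w s) s)
    (hF' : ContinuousOn (fun q : E3 × ℝ => F' q.1 q.2) (Set.univ ×ˢ S)) :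
    HasDerivAt (fun s => ∫ w, φ w * F w s) (∫ w, φ w * F' w s₀) s₀ := by
  obtain ⟨r, hr, hrS⟩ := Metric.nhds_basis_closedBall.mem_iff.1 hS
  have hcomp : IsCompact (tsupport φ ×ˢ Metric.closedBall s₀ r) :=
    hc.isCompact.prod (isCompact_closedBall _ _)
  obtain ⟨C, hC⟩ := hcomp.exists_bound_of_continuousOn
    (hF'.mono (Set.prod_mono (Set.subset_univ _) hrS))
  have hF0 : Continuous fun w => F' w s₀ := by
    have : ContinuousOn (fun w : E3 => F' w s₀) Set.univ :=
      hF'.comp (f := fun w : E3 => (w, s₀)) (by fun_prop)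
        fun w _ => ⟨trivial, mem_of_mem_nhds hS⟩
    rwa [continuousOn_univ] at this
  refine (hasDerivAt_integral_of_dominated_loc_of_deriv_le (F := fun s w => φ w * F w s)
    (F' := fun s w => φ w * F' w s) (bound := fun w => ‖φ w‖ * C) (Metric.closedBall_mem_nhds s₀ hr)
    (eventually_of_mem hS fun s hs => (hφ.mul (hF s hs)).aestronglyMeasurable)
    ((hφ.mul (hF s₀ (mem_of_mem_nhds hS))).integrable_of_hasCompactSupport hc.mul_right)
    (hφ.mul hF0).aestronglyMeasurable (.of_forall fun w s hs => ?_)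
    ((hφ.integrable_of_hasCompactSupport hc).norm.mul_const C)
    (.of_forall fun w s hs => (hd w s (hrS hs)).const_mul _)).2
  rw [norm_mul]
  by_cases hw : w ∈ tsupport φ
  · gcongr
    exact hC (w, s) ⟨hw, hs⟩
  · simp [image_eq_zero_of_notMem_tsupport hw]

lemma hasLineDerivAt_integral_of_hasCompactSupport {φ : E3 → ℝ} (hφ : Continuous φ)
    (hc : HasCompactSupport φ) {g : E3 × E3 → ℝ} (hg : ContDiff ℝ 1 g) (x : E3) (k : Fin 3) :
    HasLineDerivAt ℝ (fun x => ∫ w, φ w * g (w, x))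
      (∫ w, φ w * pd k (fun z => g (w, z)) x) x (unitVec k) := by
  have hd := hg.differentiable (by simp)
  have h0 : ∀ w x, pd k (fun z => g (w, z)) x = fderiv ℝ g (w, x) (0, unitVec k) := fun w x =>
    pd_comp (φ := fun z => (w, z)) (hd _) (hasFDerivAt_prodMk_right w x) k
  have := hasDerivAt_integral_of_hasCompactSupport hφ hc (s₀ := 0) (S := Set.univ) univ_mem
    (F := fun w s => g (w, x + s • unitVec k))
    (F' := fun w s => fderiv ℝ g (w, x + s • unitVec k) (0, unitVec k))
    (fun s _ => hg.continuous.comp (by fun_prop)) (fun w s _ => ?_) ?_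
  · simp only [zero_smul, add_zero] at this
    simp only [h0]
    exact this
  · have h1 : HasDerivAt (fun s : ℝ => (w, x + s • unitVec k)) (0, unitVec k) s := by
      refine (hasDerivAt_const s w).prodMk ?_
      simpa using ((hasDerivAt_id s).smul_const (unitVec k)).const_add x
    exact (hd _).hasFDerivAt.comp_hasDerivAt s h1
  · refine Continuous.continuousOn ?_
    refine Continuous.clm_apply ?_ continuous_const
    exact (hg.continuous_fderiv (by simp)).comp (by fun_prop)

/-- Integration by parts against a test function. -/
lemma integral_pd_mul {φ g : E3 → ℝ} (hφ : ContDiff ℝ 1 φ) (hc : HasCompactSupport φ)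
    (hg : ContDiff ℝ 1 g) (i : Fin 3) : ∫ w, pd i φ w * g w = -∫ w, φ w * pd i g w := by
  have hφ' : Continuous (pd i φ) := (hφ.continuous_fderiv (by simp)).clm_apply continuous_const
  have hg' : Continuous (pd i g) := (hg.continuous_fderiv (by simp)).clm_apply continuous_const
  have hc' : HasCompactSupport (pd i φ) :=
    (hc.fderiv (𝕜 := ℝ)).comp_left (g := fun L : E3 →L[ℝ] ℝ => L (unitVec i)) (by simp)
  have := integral_mul_fderiv_eq_neg_fderiv_mul_of_integrable (μ := (volume : Measure E3))
    (v := unitVec i) (f := g) (g := φ)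
    ((hg'.mul hφ.continuous).integrable_of_hasCompactSupport hc.mul_left)
    ((hg.continuous.mul hφ').integrable_of_hasCompactSupport hc'.mul_left)
    ((hg.continuous.mul hφ.continuous).integrable_of_hasCompactSupport hc.mul_left)
    (fun x _ => hg.differentiable (by simp) x) (fun x _ => hφ.differentiable (by simp) x)
  simp only [mul_comm] at this ⊢
  exact this

lemma hasCompactSupport_pd {φ : E3 → ℝ} (hc : HasCompactSupport φ) (i : Fin 3) :
    HasCompactSupport (pd i φ) :=
  (hc.fderiv (𝕜 := ℝ)).comp_left (g := fun L : E3 →L[ℝ] ℝ => L (unitVec i)) (by simp)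

lemma contDiff_pd {φ : E3 → ℝ} (hφ : ContDiff ℝ ∞ φ) (i : Fin 3) : ContDiff ℝ ∞ (pd i φ) :=
  (hφ.fderiv_right (m := ∞) (by simp)).clm_apply contDiff_const

lemma eq_zero_of_integral_test_mul {g : E3 → ℝ} (hg : Continuous g)
    (h : ∀ φ : E3 → ℝ, ContDiff ℝ ∞ φ → HasCompactSupport φ → ∫ w, φ w * g w = 0) (w : E3) :
    g w = 0 := by
  have := ae_eq_zero_of_integral_contDiff_smul_eq_zero (μ := volume) hg.locallyIntegrable h
  exact congrFun ((hg.ae_eq_iff_eq volume continuous_const).1 this) w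

/-! ### Potentials of decaying densities depending on parameters -/

lemma div_one_add_norm_add_le {C R : ℝ} (hC : 0 ≤ C) {x : E3} (hx : ‖x‖ ≤ R) (z : E3) :
    C / (1 + ‖z + x‖) ^ 3 ≤ (1 + R) ^ 3 * C / (1 + ‖z‖) ^ 3 := by
  rw [div_le_div_iff₀ (by positivity) (by positivity)]
  -- A translation by at most `R` costs a factor `1 + R` in the weight, hence its cube in the bound.
  have h2 : 1 + ‖z‖ ≤ (1 + R) * (1 + ‖z + x‖) := by
    have h3 : ‖z‖ ≤ ‖z + x‖ + ‖x‖ := by simpa using norm_sub_le (z + x) x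
    have h4 : 0 ≤ R * ‖z + x‖ := mul_nonneg ((norm_nonneg x).trans hx) (norm_nonneg _)
    nlinarith
  calc C * (1 + ‖z‖) ^ 3 ≤ C * ((1 + R) * (1 + ‖z + x‖)) ^ 3 := by gcongr
    _ = _ := by ring

lemma CubicDecay.comp_add_right {V : E3 → ℝ} (hV : CubicDecay V) (x : E3) :
    CubicDecay fun z => V (z + x) := by
  obtain ⟨hVc, C, hC⟩ := hV
  have hC0 : 0 ≤ C := by simpa using (abs_nonneg _).trans (hC 0)
  exact ⟨hVc.comp (by fun_prop), (1 + ‖x‖) ^ 3 * C, fun z =>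
    (hC _).trans (div_one_add_norm_add_le hC0 le_rfl z)⟩

lemma WeaklySingular.integrable_comp_sub_mul {k V : E3 → ℝ} (hk : WeaklySingular k)
    (hV : CubicDecay V) (x : E3) : Integrable fun y => k (y - x) * V y := by
  simpa using (hk.integrable_mul_decay (hV.comp_add_right x)).comp_sub_right x

/-- A function which, along with its first derivatives, is `O(|y|⁻³)` in its second variable,
locally uniformly in the other ones. -/
structure DecayKernel (c : E3 × E3 × E3 → ℝ) : Prop where
  contDiff : ContDiff ℝ 1 c
  decay : ∀ K : Set (E3 × E3), IsCompact K → ∃ C, ∀ q ∈ K, ∀ y : E3,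
    |c (q.1, y, q.2)| ≤ C / (1 + ‖y‖) ^ 3 ∧ ‖fderiv ℝ c (q.1, y, q.2)‖ ≤ C / (1 + ‖y‖) ^ 3

namespace DecayKernel

variable {c : E3 × E3 × E3 → ℝ} {k : E3 → ℝ}

lemma cubicDecay (hc : DecayKernel c) (x w : E3) : CubicDecay fun y => c (x, y, w) := by
  obtain ⟨C, hC⟩ := hc.decay {(x, w)} isCompact_singleton
  exact ⟨hc.contDiff.continuous.comp (by fun_prop), C, fun y => (hC (x, w) rfl y).1⟩

lemma shifted_decay (hc : DecayKernel c) (q₀ : E3 × E3) : ∃ C, ∀ q ∈ Metric.closedBall q₀ 1,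
    ∀ z : E3, |c (q.1, z + q.1, q.2)| ≤ C / (1 + ‖z‖) ^ 3 ∧
      ‖fderiv ℝ c (q.1, z + q.1, q.2)‖ ≤ C / (1 + ‖z‖) ^ 3 := by
  obtain ⟨C, hC⟩ := hc.decay _ (isCompact_closedBall q₀ 1)
  have hC0 : 0 ≤ C := by
    simpa using (abs_nonneg _).trans (hC q₀ (Metric.mem_closedBall_self zero_le_one) 0).1
  -- The translation by `q.1` has length at most `‖q₀‖ + 1` on the unit ball around `q₀`.
  refine ⟨(1 + (‖q₀‖ + 1)) ^ 3 * C, fun q hq z => ?_⟩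
  have hq1 : ‖q.1‖ ≤ ‖q₀‖ + 1 := by
    have h1 : ‖q - q₀‖ ≤ 1 := by simpa [dist_eq_norm] using hq
    calc ‖q.1‖ ≤ ‖q‖ := norm_fst_le q
      _ = ‖q₀ + (q - q₀)‖ := by simp
      _ ≤ _ := (norm_add_le _ _).trans (by gcongr)
  have h := div_one_add_norm_add_le hC0 hq1 z
  exact ⟨(hC q hq _).1.trans h, (hC q hq _).2.trans h⟩

lemma integrable (hc : DecayKernel c) (hk : WeaklySingular k) (x w : E3) :
    Integrable fun y => k (y - x) * c (x, y, w) :=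
  hk.integrable_comp_sub_mul (hc.cubicDecay x w) x

lemma integral_shift (k : E3 → ℝ) (c : E3 × E3 × E3 → ℝ) (q : E3 × E3) :
    ∫ y, k (y - q.1) * c (q.1, y, q.2) = ∫ z, k z * c (q.1, z + q.1, q.2) := by
  rw [← integral_sub_right_eq_self (fun z => k z * c (q.1, z + q.1, q.2)) q.1]
  simp

/-- The potential of a decaying smooth density with a weakly singular kernel is continuously
differentiable in its parameters. -/
lemma contDiff_potential (hc : DecayKernel c) (hk : WeaklySingular k) :
    ContDiff ℝ 1 fun q : E3 × E3 => ∫ y, k (y - q.1) * c (q.1, y, q.2) := by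
  -- The shift `y = z + x` fixes the singularity at the origin. The parameters then enter only
  -- through the smooth density, in which `x` occupies two slots, and no derivative falls on the
  -- kernel.
  simp only [integral_shift]
  set Λ : E3 × E3 →L[ℝ] E3 × E3 × E3 :=
    (ContinuousLinearMap.fst ℝ E3 E3).prod
      ((ContinuousLinearMap.fst ℝ E3 E3).prod (ContinuousLinearMap.snd ℝ E3 E3))
  set F' : E3 × E3 → E3 → (E3 × E3 →L[ℝ] ℝ) := fun q z =>
    k z • (fderiv ℝ c (q.1, z + q.1, q.2)).comp Λ with hF'
  have hdc := hc.contDiff.continuous_fderiv (by simp)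
  have hcont : ∀ q : E3 × E3, Continuous fun z : E3 => (fderiv ℝ c (q.1, z + q.1, q.2)).comp Λ := fun q =>
    (hdc.comp (by fun_prop)).clm_comp continuous_const
  have hmF' : ∀ q, AEStronglyMeasurable (F' q) := fun q =>
    hk.1.aestronglyMeasurable.smul (hcont q).aestronglyMeasurable
  have hb : ∀ q₀ : E3 × E3, ∃ b : E3 → ℝ, Integrable b ∧
      ∀ q ∈ Metric.closedBall q₀ 1, ∀ z, ‖F' q z‖ ≤ b z := fun q₀ => by
    obtain ⟨C, hC⟩ := hc.shifted_decay q₀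
    have hm : Continuous fun z : E3 => C / (1 + ‖z‖) ^ 3 :=
      continuous_const.div (by fun_prop) fun z => by positivity
    have hi := hk.integrable_mul (V := fun z => C / (1 + ‖z‖) ^ 3) (C := |C|)
      hm.aestronglyMeasurable fun z => by
        rw [abs_div, abs_of_pos (by positivity : 0 < (1 + ‖z‖) ^ 3)]
    refine ⟨fun z => |k z * (C / (1 + ‖z‖) ^ 3)| * ‖Λ‖, hi.abs.mul_const _, fun q hq z => ?_⟩
    simp only [hF']
    rw [norm_smul, abs_mul, mul_assoc, Real.norm_eq_abs]
    gcongr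
    refine (ContinuousLinearMap.opNorm_comp_le _ _).trans ?_
    gcongr
    exact ((hC q hq z).2).trans (le_abs_self _)
  have hderiv : ∀ q z, HasFDerivAt (fun q : E3 × E3 => k z * c (q.1, z + q.1, q.2)) (F' q z) q :=
    fun q z => by
    have h1 : HasFDerivAt (fun q : E3 × E3 => (q.1, z + q.1, q.2)) Λ q :=
      (hasFDerivAt_fst (p := q)).prodMk (((hasFDerivAt_fst (p := q)).const_add z).prodMk
        (hasFDerivAt_snd (p := q)))
    exact (((hc.contDiff.differentiable (by simp)) _).hasFDerivAt.comp q h1).const_mul (k z)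
  have hmain : ∀ q₀, HasFDerivAt (fun q : E3 × E3 => ∫ z, k z * c (q.1, z + q.1, q.2))
      (∫ z, F' q₀ z) q₀ := fun q₀ => by
    obtain ⟨b, hbi, hb⟩ := hb q₀
    refine hasFDerivAt_integral_of_dominated_of_fderiv_le (Metric.closedBall_mem_nhds q₀ one_pos)
      (.of_forall fun q => ?_) ?_ (hmF' q₀) (.of_forall fun z q hq => hb q hq z) hbi
      (.of_forall fun z q _ => hderiv q z)
    · have : Continuous fun z => c (q.1, z + q.1, q.2) := hc.contDiff.continuous.comp (by fun_prop)
      exact hk.1.aestronglyMeasurable.mul this.aestronglyMeasurable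
    · simpa using (hc.integrable hk q₀.1 q₀.2).comp_add_right q₀.1
  refine contDiff_one_iff_fderiv.2 ⟨fun q => (hmain q).differentiableAt, ?_⟩
  rw [show fderiv ℝ (fun q : E3 × E3 => ∫ z, k z * c (q.1, z + q.1, q.2)) = fun q => ∫ z, F' q z from
    funext fun q => (hmain q).fderiv]
  refine continuous_iff_continuousAt.2 fun q₀ => ?_
  obtain ⟨b, hbi, hb⟩ := hb q₀
  refine continuousAt_of_dominated (.of_forall hmF')
    (eventually_of_mem (Metric.closedBall_mem_nhds q₀ one_pos) fun q hq =>
      .of_forall fun z => hb q hq z) hbi (.of_forall fun z => ?_)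
  have : Continuous fun q : E3 × E3 => (fderiv ℝ c (q.1, z + q.1, q.2)).comp Λ :=
    (hdc.comp (by fun_prop)).clm_comp continuous_const
  exact (this.const_smul (k z)).continuousAt

/-- Fubini, with a product majorant: the compact support of `η` makes the decay in `y` uniform in
`w`. It converts the potential of a correlation into a `w`-integral of the potential of the curl of
`μ`. -/
lemma integral_swap (hc : DecayKernel c) (hk : WeaklySingular k) {η : E3 → ℝ} (hη : Continuous η)
    (hηc : HasCompactSupport η) (x : E3) :
    ∫ y, k (y - x) * ∫ w, η w * c (x, y, w) = ∫ w, η w * ∫ y, k (y - x) * c (x, y, w) := by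
  simp only [← integral_const_mul]
  rw [integral_integral_swap]
  · refine integral_congr_ae (.of_forall fun w => integral_congr_ae (.of_forall fun y => ?_))
    simp only; ring
  obtain ⟨C, hC⟩ := hc.decay ({x} ×ˢ tsupport η) (isCompact_singleton.prod hηc.isCompact)
  have hkm : Measurable fun p : E3 × E3 => k (p.1 - x) := hk.1.comp (by fun_prop)
  have hcc : Continuous fun p : E3 × E3 => η p.2 * c (x, p.1, p.2) :=
    (hη.comp continuous_snd).mul (hc.contDiff.continuous.comp (by fun_prop))
  have hi : Integrable fun y : E3 => k (y - x) * (|C| / (1 + ‖y‖) ^ 3) := by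
    refine hk.integrable_comp_sub_mul (V := fun y => |C| / (1 + ‖y‖) ^ 3) ⟨?_, |C|, fun y => ?_⟩ x
    · exact continuous_const.div (by fun_prop) fun z => by positivity
    · rw [abs_of_nonneg (by positivity)]
  refine (hi.mul_prod (hη.integrable_of_hasCompactSupport hηc)).mono
    (hkm.mul hcc.measurable).aestronglyMeasurable (.of_forall fun p => ?_)
  simp only [Function.uncurry, norm_mul]
  by_cases hw : p.2 ∈ tsupport η
  · have := (hC (x, p.2) ⟨rfl, hw⟩ p.1).1
    rw [mul_assoc, mul_comm ‖η p.2‖]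
    gcongr
    refine this.trans ((le_abs_self _).trans ?_)
    rw [Real.norm_eq_abs, abs_div, abs_div, abs_abs]
  · simp [image_eq_zero_of_notMem_tsupport hw]

end DecayKernel

/-! ### Second-order expansions -/

lemma eq_zero_of_quadratic_isLittleO {p q : ℝ}
    (h : (fun s : ℝ => p * s + q * s ^ 2) =o[𝓝 0] fun s => s ^ 2) : p = 0 ∧ q = 0 := by
  have h1 : Tendsto (fun s : ℝ => (p * s + q * s ^ 2) / s ^ 2) (𝓝[≠] 0) (𝓝 0) :=
    h.tendsto_div_nhds_zero.mono_left nhdsWithin_le_nhds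
  have hs : Tendsto (fun s : ℝ => s) (𝓝[≠] 0) (𝓝 0) := tendsto_id.mono_left nhdsWithin_le_nhds
  -- Multiplying the vanishing quotient by `s` and subtracting `q s` isolates `p`.
  have hp : p = 0 := by
    have h2 : Tendsto (fun s : ℝ => s * ((p * s + q * s ^ 2) / s ^ 2) - q * s) (𝓝[≠] 0)
        (𝓝 (0 * 0 - q * 0)) := (hs.mul h1).sub (hs.const_mul q)
    have h3 : (fun s : ℝ => s * ((p * s + q * s ^ 2) / s ^ 2) - q * s) =ᶠ[𝓝[≠] 0] fun _ => p := by
      filter_upwards [self_mem_nhdsWithin] with s hs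
      have : s ≠ 0 := hs
      field_simp; ring
    simpa using tendsto_nhds_unique (tendsto_const_nhds (x := p)) (h2.congr' h3)
  subst hp
  refine ⟨rfl, ?_⟩
  have h3 : (fun s : ℝ => (0 * s + q * s ^ 2) / s ^ 2) =ᶠ[𝓝[≠] 0] fun _ => q := by
    filter_upwards [self_mem_nhdsWithin] with s hs
    have : s ≠ 0 := hs
    field_simp; ring
  exact tendsto_nhds_unique (tendsto_const_nhds (x := q)) (h1.congr' h3)

/-- The coefficients of a second order expansion are derivatives. -/
lemma pd_eq_of_expansion {m : E3 → ℝ} (hm : ContDiff ℝ ∞ m) {x : E3} (hx : m x = 0)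
    {a : Fin 3 → ℝ} {b : Fin 3 → Fin 3 → ℝ}
    (h : (fun y : E3 => m y - (∑ k, a k * (y k - x k) +
      ∑ j, ∑ k, b j k * (y k - x k) * (y j - x j))) =o[𝓝 x] fun y => ‖y - x‖ ^ 2) (k : Fin 3) :
    a k = pd k m x ∧ 2 * b k k = pd k (pd k m) x := by
  -- Restriction to the line in direction `e_k` sees only `a k` and the diagonal coefficient `b k
  -- k`. Comparison with the one-variable Taylor polynomial gives the factor 2.
  set l : ℝ → E3 := fun s => x + s • unitVec k with hl
  have hlc : ContDiff ℝ ∞ l := by fun_prop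
  have hld : ∀ s, HasDerivAt l (unitVec k) s := fun s =>
    (((hasDerivAt_id s).smul_const (unitVec k)).const_add x).congr_deriv (one_smul ℝ _)
  have hder : ∀ g : E3 → ℝ, ContDiff ℝ ∞ g → deriv (g ∘ l) = pd k g ∘ l := fun g hg => by
    funext s
    exact (((hg.differentiable (by simp)) _).hasFDerivAt.comp_hasDerivAt s (hld s)).deriv
  have hl0 : l 0 = x := by simp [hl]
  have h1 : (fun s : ℝ => m (l s) - (a k * s + b k k * s ^ 2)) =o[𝓝 0] fun s => s ^ 2 := by
    have hlt : Tendsto l (𝓝 0) (𝓝 x) := by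
      have := hlc.continuous.tendsto 0
      rwa [hl0] at this
    have := h.comp_tendsto hlt
    refine (this.congr (fun s => ?_) (fun s => ?_))
    · simp [hl, Fin.sum_univ_three]
      fin_cases k <;> simp <;> ring
    · simp [hl, norm_smul]
  have h2 := taylor_isLittleO_univ (x₀ := 0) (n := 2) (f := m ∘ l)
    ((hm.comp hlc).of_le (WithTop.coe_le_coe.2 le_top))
  have h3 : ∀ s : ℝ, taylorWithinEval (m ∘ l) 2 Set.univ 0 s =
      pd k m x * s + pd k (pd k m) x / 2 * s ^ 2 := fun s => by
    rw [taylorWithinEval_succ, taylorWithinEval_succ, taylor_within_zero_eval]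
    simp only [iteratedDerivWithin_univ, iteratedDeriv_succ, iteratedDeriv_zero, hder m hm,
      hder _ (contDiff_pd hm k)]
    simp [hl0, hx]
    ring
  simp only [h3, sub_zero] at h2
  have h4 : (fun s : ℝ => (pd k m x - a k) * s + (pd k (pd k m) x / 2 - b k k) * s ^ 2) =o[𝓝 0]
      fun s => s ^ 2 := (h1.sub h2).congr_left fun s => by simp only [Function.comp]; ring
  obtain ⟨h5, h6⟩ := eq_zero_of_quadratic_isLittleO h4
  exact ⟨by linarith, by linarith⟩

/-! ### Expectations expressed through densities -/

section Density

variable {Ω E : Type*} [MeasurableSpace Ω] [MeasureSpace E] {ℙ : Measure Ω} {X : Ω → E}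
  {g G : E → ℝ}

lemma IsPDFOf.map_eq (h : IsPDFOf ℙ X g) (hX : Measurable X) :
    ℙ.map X = volume.withDensity fun w => ENNReal.ofReal (g w) := by
  ext A hA
  rw [Measure.map_apply hX hA, withDensity_apply _ hA, h.2.2 A hA]

lemma IsPDFOf.integral_comp (h : IsPDFOf ℙ X g) (hX : Measurable X) (hG : Measurable G) :
    ∫ σ, G (X σ) ∂ℙ = ∫ w, G w * g w := by
  rw [← integral_map hX.aemeasurable (f := G) hG.aestronglyMeasurable, h.map_eq hX,
    integral_withDensity_eq_integral_toReal_smul h.1.ennreal_ofReal (by simp)]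
  refine integral_congr_ae (.of_forall fun w => ?_)
  simp [ENNReal.toReal_ofReal (h.2.1 w), mul_comm]

lemma IsPDFOf.integrable_comp (h : IsPDFOf ℙ X g) (hX : Measurable X) (hG : Measurable G)
    (hi : Integrable (fun σ => G (X σ)) ℙ) : Integrable fun w => G w * g w := by
  have h1 : Integrable G (ℙ.map X) :=
    (integrable_map_measure hG.aestronglyMeasurable hX.aemeasurable).2 hi
  rw [h.map_eq hX, integrable_withDensity_iff h.1.ennreal_ofReal (by simp)] at h1
  refine h1.congr (.of_forall fun w => ?_)
  simp [ENNReal.toReal_ofReal (h.2.1 w)]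

end Density

/-! ### Velocity and vorticity as random fields -/

section Fields

variable {Ω : Type*} [MeasurableSpace Ω] {ℙ : Measure Ω}

lemma randField_of_smoothFastDecay {U : E3 → ℝ → Ω → E3}
    (hm : ∀ x t, 0 < t → Measurable (U x t)) (hU : SmoothFastDecay ℙ U) (i : Fin 3) :
    RandField ℙ fun p σ => U p.1 p.2 σ i where
  measurable p hp := (EuclideanSpace.proj (𝕜 := ℝ) i).continuous.measurable.comp (hm p.1 p.2 hp)
  smooth σ := (EuclideanSpace.proj (𝕜 := ℝ) i).contDiff.comp_contDiffOn (hU.1 σ)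
  decay n K hK hK0 := by
    obtain ⟨M, hM, h⟩ := hU.2 n K hK hK0
    set L : E3 →L[ℝ] ℝ := EuclideanSpace.proj (𝕜 := ℝ) i
    refine ⟨fun σ => ‖L‖ * M σ, hM.const_mul _, fun σ t ht x => ?_⟩
    have h1 : ContDiffAt ℝ ∞ (fun p : E3 × ℝ => U p.1 p.2 σ) (x, t) :=
      (hU.1 σ).contDiffAt (posTime_mem_nhds (hK0 ht))
    have h2 := L.iteratedFDeriv_comp_left h1 (i := n) (by exact_mod_cast le_top)
    calc ‖iteratedFDeriv ℝ n (fun p => U p.1 p.2 σ i) (x, t)‖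
        = ‖iteratedFDeriv ℝ n (L ∘ fun p : E3 × ℝ => U p.1 p.2 σ) (x, t)‖ := rfl
      _ ≤ ‖L‖ * ‖iteratedFDeriv ℝ n (fun p : E3 × ℝ => U p.1 p.2 σ) (x, t)‖ := by
          rw [h2]; exact L.norm_compContinuousMultilinearMap_le _
      _ ≤ ‖L‖ * (M σ / (1 + ‖x‖) ^ 3) := by gcongr; exact h σ t ht x
      _ = _ := by ring

/-- The curl of a random field. -/
noncomputable def vortField (u : Fin 3 → E3 × ℝ → Ω → ℝ) (i : Fin 3) (p : E3 × ℝ) (σ : Ω) : ℝ :=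
  vort (fun k q => u k q σ) i p

omit [MeasurableSpace Ω] in
lemma vortField_eq_sum (u : Fin 3 → E3 × ℝ → Ω → ℝ) (i : Fin 3) :
    vortField u i = fun p σ => ∑ q : Fin 3 × Fin 3,
      leviCivita i q.1 q.2 * dirField (spaceDir q.1) (u q.2) p σ := by
  funext p σ
  rw [Fintype.sum_prod_type]; rfl

lemma randField_vortField {u : Fin 3 → E3 × ℝ → Ω → ℝ} (hu : ∀ i, RandField ℙ (u i))
    (i : Fin 3) : RandField ℙ (vortField u i) := by
  rw [vortField_eq_sum]
  exact RandField.sum _ (X := fun (q : Fin 3 × Fin 3) p σ =>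
    leviCivita i q.1 q.2 * dirField (spaceDir q.1) (u q.2) p σ)
    fun q => ((hu q.2).dir _).const_mul _

lemma vorticity_apply {U : E3 → ℝ → Ω → E3}
    (hU : ∀ i, RandField ℙ fun p σ => U p.1 p.2 σ i) (x : E3) {t : ℝ} (ht : 0 < t) (σ : Ω)
    (i : Fin 3) : vorticity U x t σ i = vortField (fun i p σ => U p.1 p.2 σ i) i (x, t) σ := by
  simp only [vorticity, curl, vortField, vort]
  refine Finset.sum_congr rfl fun j _ => Finset.sum_congr rfl fun k _ => ?_
  exact congrArg _ (pd_slice (g := fun q : E3 × ℝ => U q.1 q.2 σ k) ((hU k).smooth σ) x ht j)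

end Fields

/-! ### The curl of the conditional mean as a decaying kernel -/

section Kernel

lemma DecayKernel.add {c d : E3 × E3 × E3 → ℝ} (hc : DecayKernel c) (hd : DecayKernel d) :
    DecayKernel fun p => c p + d p := by
  refine ⟨hc.contDiff.add hd.contDiff, fun K hK => ?_⟩
  obtain ⟨C, hC⟩ := hc.decay K hK
  obtain ⟨D, hD⟩ := hd.decay K hK
  refine ⟨C + D, fun q hq y => ⟨?_, ?_⟩⟩
  · rw [add_div]
    exact (abs_add_le _ _).trans (add_le_add (hC q hq y).1 (hD q hq y).1)
  · rw [fderiv_fun_add (hc.contDiff.differentiable (by simp) _)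
      (hd.contDiff.differentiable (by simp) _), add_div]
    exact (norm_add_le _ _).trans (add_le_add (hC q hq y).2 (hD q hq y).2)

lemma DecayKernel.const_mul {c : E3 × E3 × E3 → ℝ} (hc : DecayKernel c) (a : ℝ) :
    DecayKernel fun p => a * c p := by
  refine ⟨contDiff_const.mul hc.contDiff, fun K hK => ?_⟩
  obtain ⟨C, hC⟩ := hc.decay K hK
  refine ⟨|a| * C, fun q hq y => ⟨?_, ?_⟩⟩
  · rw [abs_mul, mul_div_assoc]
    gcongr; exact (hC q hq y).1
  · rw [fderiv_const_mul (hc.contDiff.differentiable (by simp) _), norm_smul, mul_div_assoc,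
      Real.norm_eq_abs]
    gcongr; exact (hC q hq y).2

lemma DecayKernel.sum {ι : Type*} (s : Finset ι) {c : ι → E3 × E3 × E3 → ℝ}
    (h : ∀ i, DecayKernel (c i)) : DecayKernel fun p => ∑ i ∈ s, c i p := by
  classical
  induction s using Finset.induction_on with
  | empty => exact ⟨by simpa using contDiff_const, fun K _ => ⟨0, fun q _ y => by simp⟩⟩
  | insert a s ha ih => simpa [Finset.sum_insert ha] using (h a).add ih

variable {m : E3 → E3 → E3 → ℝ → ℝ}

lemma SmoothDecayingIncrement.contDiff (hm : SmoothDecayingIncrement m) {t : ℝ} (ht : 0 < t) :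
    ContDiff ℝ ∞ fun p : E3 × E3 × E3 => m p.1 p.2.1 p.2.2 t := by
  rw [← contDiffOn_univ]
  exact hm.1.comp (f := fun p : E3 × E3 × E3 => (p.1, p.2.1, p.2.2, t))
    (by fun_prop) fun p _ => ht

/-- The assumed decay concerns the full `y`-gradient as a function of `(x,y,w,t)`. Freezing `t` is
an affine map and evaluating on `e_j` a linear one, so the bounds of orders 0 and 1 transfer. -/
lemma SmoothDecayingIncrement.decayKernel (hm : SmoothDecayingIncrement m) {t : ℝ} (ht : 0 < t)
    (j : Fin 3) : DecayKernel fun p => pd j (fun y => m p.1 y p.2.2 t) p.2.1 := by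
  set Q : E3 × E3 × E3 × ℝ → (E3 →L[ℝ] ℝ) :=
    fun p => fderiv ℝ (fun z => m p.1 z p.2.2.1 p.2.2.2) p.2.1 with hQ
  have hopen : IsOpen {p : E3 × E3 × E3 × ℝ | 0 < p.2.2.2} :=
    isOpen_lt continuous_const (by fun_prop)
  have hQs : ContDiffOn ℝ ∞ Q {p | 0 < p.2.2.2} := by
    have h1 := (hm.1.fderiv_of_isOpen (m := ∞) hopen (by simp)).clm_comp
      (contDiffOn_const (c := (ContinuousLinearMap.inr ℝ E3 (E3 × E3 × ℝ)).comp
        (ContinuousLinearMap.inl ℝ E3 (E3 × ℝ))))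
    refine h1.congr fun p hp => ?_
    have h2 : HasFDerivAt (fun z : E3 => (p.1, z, p.2.2.1, p.2.2.2))
        ((ContinuousLinearMap.inr ℝ E3 (E3 × E3 × ℝ)).comp
        (ContinuousLinearMap.inl ℝ E3 (E3 × ℝ))) p.2.1 := by
      have h3 := hasFDerivAt_prodMk_left (𝕜 := ℝ) p.2.1 p.2.2
      exact (hasFDerivAt_prodMk_right p.1 (p.2.1, p.2.2)).comp p.2.1 h3
    have h4 := (hm.1.contDiffAt (hopen.mem_nhds hp)).differentiableAt (by simp)
    exact (h4.hasFDerivAt.comp p.2.1 h2).fderiv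
  have hQd : ∀ p : E3 × E3 × E3 × ℝ, 0 < p.2.2.2 → ContDiffAt ℝ ∞ Q p := fun p hp =>
    hQs.contDiffAt (hopen.mem_nhds hp)
  set A : E3 × E3 × E3 →L[ℝ] E3 × E3 × E3 × ℝ :=
    (ContinuousLinearMap.fst ℝ _ _).prod (((ContinuousLinearMap.fst ℝ E3 E3).comp
      (ContinuousLinearMap.snd ℝ _ _)).prod (((ContinuousLinearMap.snd ℝ E3 E3).comp
      (ContinuousLinearMap.snd ℝ _ _)).prod 0)) with hA
  set ι : E3 × E3 × E3 → E3 × E3 × E3 × ℝ := fun p => (p.1, p.2.1, p.2.2, t) with hι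
  have hιd : ∀ p, HasFDerivAt ι A p := fun p => by
    have : ι = fun p => A p + (0, 0, 0, t) := by funext p; simp [hι, hA]
    rw [this]
    exact A.hasFDerivAt.add_const _
  set L : (E3 →L[ℝ] ℝ) →L[ℝ] ℝ := ContinuousLinearMap.apply ℝ ℝ (unitVec j) with hL
  have hc : (fun p : E3 × E3 × E3 => pd j (fun y => m p.1 y p.2.2 t) p.2.1) =
      fun p => L (Q (ι p)) := rfl
  rw [hc]
  have hder : ∀ p, HasFDerivAt (fun p => L (Q (ι p))) (L.comp ((fderiv ℝ Q (ι p)).comp A)) p :=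
    fun p => L.hasFDerivAt.comp p
      ((((hQd (ι p) ht).differentiableAt (by simp)).hasFDerivAt).comp p (hιd p))
  refine ⟨?_, fun K hK => ?_⟩
  · rw [contDiff_iff_contDiffAt]
    intro p
    have h1 : ContDiffAt ℝ 1 (Q ∘ ι) p :=
      ((hQd (ι p) ht).of_le (by simp)).comp p (by fun_prop)
    exact L.contDiff.contDiffAt.comp p h1
  · have hK' : IsCompact ((fun q : E3 × E3 => (q.1, q.2, t)) '' K) := hK.image (by fun_prop)
    have hpos : ∀ q ∈ (fun q : E3 × E3 => (q.1, q.2, t)) '' K, 0 < q.2.2 := by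
      rintro _ ⟨q, -, rfl⟩; exact ht
    obtain ⟨C, hC⟩ := hm.2 0 _ hK' hpos
    obtain ⟨D, hD⟩ := hm.2 1 _ hK' hpos
    -- One constant must serve both estimates: the first summand bounds the value, the second its
    -- derivative.
    refine ⟨‖L‖ * |C| + ‖L‖ * (|D| * ‖A‖), fun q hq y => ⟨?_, ?_⟩⟩
    · have h1 : ‖Q (ι (q.1, y, q.2))‖ ≤ C / (1 + ‖y‖) ^ 3 := by
        simpa using hC _ ⟨q, hq, rfl⟩ y
      calc ‖L (Q (ι (q.1, y, q.2)))‖ ≤ ‖L‖ * (|C| / (1 + ‖y‖) ^ 3) := by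
            refine (L.le_opNorm _).trans ?_
            gcongr
            exact h1.trans (by gcongr; exact le_abs_self C)
        _ ≤ _ := by
            rw [← mul_div_assoc]; gcongr
            have : 0 ≤ ‖L‖ * (|D| * ‖A‖) := by positivity
            linarith
    · have h1 : ‖fderiv ℝ Q (ι (q.1, y, q.2))‖ ≤ D / (1 + ‖y‖) ^ 3 := by
        have := hD _ ⟨q, hq, rfl⟩ y
        rwa [← norm_iteratedFDeriv_fderiv, norm_iteratedFDeriv_zero] at this
      rw [(hder _).fderiv]
      calc _ ≤ ‖L‖ * ((|D| / (1 + ‖y‖) ^ 3) * ‖A‖) := by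
            refine (ContinuousLinearMap.opNorm_comp_le _ _).trans ?_
            gcongr
            refine (ContinuousLinearMap.opNorm_comp_le _ _).trans ?_
            gcongr
            exact h1.trans (by gcongr; exact le_abs_self D)
        _ = (‖L‖ * (|D| * ‖A‖)) / (1 + ‖y‖) ^ 3 := by ring
        _ ≤ _ := by
            gcongr
            have : 0 ≤ ‖L‖ * |C| := by positivity
            linarith

lemma decayKernel_curlMean {μ : Fin 3 → E3 → E3 → E3 → ℝ → ℝ}
    (hμ : ∀ i, SmoothDecayingIncrement (μ i)) {t : ℝ} (ht : 0 < t) (i : Fin 3) :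
    DecayKernel fun p => curlMean μ i p.1 p.2.1 p.2.2 t :=
  DecayKernel.sum _ fun j => DecayKernel.sum _ fun k => ((hμ k).decayKernel ht j).const_mul _

end Kernel

/-! ### Correlations as Newtonian potentials -/

section BiotSavart

variable {Ω : Type*} [MeasurableSpace Ω] {ℙ : Measure Ω} [IsProbabilityMeasure ℙ]
  {ξ : Ω → ℝ} {C t : ℝ}

lemma HasLineDerivAt.comp_add_const {V : E3 → ℝ} {V' : ℝ} {z x v : E3}
    (h : HasLineDerivAt ℝ V V' (z + x) v) : HasLineDerivAt ℝ (fun z => V (z + x)) V' z v := by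
  have h' : HasDerivAt (fun s : ℝ => V (z + x + s • v)) V' 0 := h
  change HasDerivAt (fun s : ℝ => V (z + s • v + x)) V' 0
  simpa only [add_right_comm] using h'

/-- A correlation function is the Newtonian potential of minus its Laplacian. -/
lemma expField_eq_potential {X : E3 × ℝ → Ω → ℝ} (hX : RandField ℙ X) (hξ : Measurable ξ)
    (hC : ∀ σ, |ξ σ| ≤ C) (ht : 0 < t) (x : E3) {Y : E3 × ℝ → Ω → ℝ}
    (hY : ∀ y σ, Y (y, t) σ = -∑ l, dirField (spaceDir l) (dirField (spaceDir l) X) (y, t) σ) :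
    4 * Real.pi * expField ℙ ξ X t x = ∫ z, 1 / ‖z‖ * expField ℙ ξ Y t (z + x) := by
  -- The representation formula evaluates at the origin, so it is applied to the translate by `x`.
  have h := integral_inv_norm_mul_laplacian (V := fun z => expField ℙ ξ X t (z + x))
    (V₁ := fun l z => expField ℙ ξ (dirField (spaceDir l) X) t (z + x))
    (V₂ := fun l z => expField ℙ ξ (dirField (spaceDir l) (dirField (spaceDir l) X)) t (z + x))
    ((hX.cubicDecay_expField hξ hC ht).comp_add_right x)
    (fun l => ((hX.dir _).cubicDecay_expField hξ hC ht).comp_add_right x)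
    (fun l => (((hX.dir _).dir _).cubicDecay_expField hξ hC ht).comp_add_right x)
    (fun l z => HasLineDerivAt.comp_add_const (hX.hasLineDerivAt_expField hξ hC ht _ _))
    (fun l z => HasLineDerivAt.comp_add_const ((hX.dir _).hasLineDerivAt_expField hξ hC ht _ _))
  have hk : WeaklySingular fun z => 1 / ‖z‖ :=
    .of_abs_le (by fun_prop) 1 zero_le_one fun z hz => .inl (by rw [abs_of_nonneg (by positivity)])
  rw [← integral_finsetSum _ fun l _ => hk.integrable_mul_decay
    ((((hX.dir _).dir _).cubicDecay_expField hξ hC ht).comp_add_right x)] at h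
  simp only [zero_add] at h
  rw [← neg_eq_iff_eq_neg.2 h, ← integral_neg]
  refine integral_congr_ae (.of_forall fun z => ?_)
  simp only
  rw [expField_congr (Y := fun p σ => ∑ l, (-1) * dirField (spaceDir l)
    (dirField (spaceDir l) X) p σ) (X := Y) fun y σ => by rw [hY]; simp,
    RandField.expField_sum _ (fun l => (hX.dir _).dir _) hξ hC ht]
  simp [Finset.mul_sum]

end BiotSavart

/-! ### Composing test functions with the random vector -/

section

variable {Ω : Type*} [MeasurableSpace Ω] {ℙ : Measure Ω}

/-- The vector field with given components. -/
noncomputable def vecField (ζ : Fin 3 → E3 × ℝ → Ω → ℝ) (p : E3 × ℝ) (σ : Ω) : E3 :=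
  WithLp.toLp 2 fun i => ζ i p σ

variable {ζ : Fin 3 → E3 × ℝ → Ω → ℝ} {φ : E3 → ℝ}

lemma measurable_vecField (hζ : ∀ i, RandField ℙ (ζ i)) {p : E3 × ℝ} (hp : p ∈ posTime) :
    Measurable (vecField ζ p) :=
  (WithLp.measurable_toLp 2 _).comp (measurable_pi_iff.2 fun i => (hζ i).measurable p hp)

lemma hasDerivAt_comp_vecField (hζ : ∀ i, RandField ℙ (ζ i)) (hφ : ContDiff ℝ 1 φ) (σ : Ω)
    {p v : E3 × ℝ} {s : ℝ} (hp : p + s • v ∈ posTime) :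
    HasDerivAt (fun s : ℝ => φ (vecField ζ (p + s • v) σ))
      (∑ i, pd i φ (vecField ζ (p + s • v) σ) * dirField v (ζ i) (p + s • v) σ) s := by
  have h1 : HasDerivAt (fun s : ℝ => vecField ζ (p + s • v) σ)
      (vecField (fun i => dirField v (ζ i)) (p + s • v) σ) s := by
    have h2 : HasDerivAt (fun (s : ℝ) i => ζ i (p + s • v) σ)
        (fun i => dirField v (ζ i) (p + s • v) σ) s :=
      hasDerivAt_pi.2 fun i => (hζ i).hasDerivAt_line σ hp
    exact ((EuclideanSpace.equiv (Fin 3) ℝ).symm.toContinuousLinearMap.hasFDerivAt).comp_hasDerivAt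
      s h2
  refine (((hφ.differentiable (by simp) _).hasFDerivAt.comp_hasDerivAt s h1)).congr_deriv ?_
  rw [fderiv_eq_sum_pd]
  simp [vecField]

lemma exists_bound_of_hasCompactSupport {φ : E3 → ℝ} (hφ : Continuous φ)
    (hc : HasCompactSupport φ) : ∃ C, ∀ w, |φ w| ≤ C :=
  hφ.bounded_above_of_compact_support hc

/-- A compact time slab around a positive time. -/
lemma slab_mem_nhds {p : E3 × ℝ} (hp : p ∈ posTime) (v : E3 × ℝ) :
    {s : ℝ | p.2 + s * v.2 ∈ Set.Icc (p.2 / 2) (2 * p.2)} ∈ 𝓝 (0 : ℝ) := by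
  have hp : 0 < p.2 := hp
  have h : Continuous fun s : ℝ => p.2 + s * v.2 := by fun_prop
  exact h.continuousAt.preimage_mem_nhds (by
    rw [zero_mul, add_zero]; exact Icc_mem_nhds (by linarith) (by linarith))

lemma slab_subset {p : E3 × ℝ} (hp : p ∈ posTime) :
    Set.Icc (p.2 / 2) (2 * p.2) ⊆ Set.Ioi 0 := fun s hs => by
  have hp : 0 < p.2 := hp
  have := hs.1
  simp only [Set.mem_Ioi]; linarith

/-- Differentiation of `E[φ(ζ(p + s v)) X(s)]` with respect to `s`. -/
lemma hasDerivAt_expectation_comp_vecField [IsProbabilityMeasure ℙ] (hζ : ∀ i, RandField ℙ (ζ i))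
    (hφ : ContDiff ℝ ∞ φ) (hc : HasCompactSupport φ) {p : E3 × ℝ} (hp : p ∈ posTime)
    (v : E3 × ℝ) {X X' : ℝ → Ω → ℝ} {A A' : Ω → ℝ} (hA : MemLp A 2 ℙ) (hA' : MemLp A' 2 ℙ)
    (hXm : ∀ s : ℝ, p + s • v ∈ posTime → Measurable (X s))
    (hXd : ∀ σ, ∀ s : ℝ, p + s • v ∈ posTime → HasDerivAt (fun s => X s σ) (X' s σ) s)
    (hXb : ∀ σ, ∀ s : ℝ, p.2 + s * v.2 ∈ Set.Icc (p.2 / 2) (2 * p.2) → |X s σ| ≤ A σ)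
    (hXb' : ∀ σ, ∀ s : ℝ, p.2 + s * v.2 ∈ Set.Icc (p.2 / 2) (2 * p.2) → |X' s σ| ≤ A' σ) :
    HasDerivAt (fun s : ℝ => ∫ σ, φ (vecField ζ (p + s • v) σ) * X s σ ∂ℙ)
      (∫ σ, ((∑ i, pd i φ (vecField ζ p σ) * dirField v (ζ i) p σ) * X 0 σ +
        φ (vecField ζ p σ) * X' 0 σ) ∂ℙ) 0 := by
  obtain ⟨C, hC⟩ := exists_bound_of_hasCompactSupport hφ.continuous hc
  have hC0 : 0 ≤ C := (abs_nonneg _).trans (hC 0)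
  choose D hD using fun i => exists_bound_of_hasCompactSupport (contDiff_pd hφ i).continuous
    (hasCompactSupport_pd hc i)
  have hD0 : ∀ i, 0 ≤ D i := fun i => (abs_nonneg _).trans (hD i 0)
  choose M hM _ hMb using fun i => ((hζ i).dir v).bound isCompact_Icc (slab_subset hp)
  have hpos : ∀ s : ℝ, p.2 + s * v.2 ∈ Set.Icc (p.2 / 2) (2 * p.2) → p + s • v ∈ posTime :=
    fun s hs => slab_subset hp hs
  have hmem0 : p.2 + 0 * v.2 ∈ Set.Icc (p.2 / 2) (2 * p.2) :=
    (mem_of_mem_nhds (slab_mem_nhds hp v) :)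
  have hsum : MemLp (fun σ => ∑ i, D i * M i σ) 2 ℙ :=
    memLp_finsetSum _ fun i _ => (hM i).const_mul (D i)
  -- The first term is a product of two square-integrable majorants, integrable by Cauchy–Schwarz.
  have hbound : Integrable (fun σ => (∑ i, D i * M i σ) * A σ + C * A' σ) ℙ :=
    (hsum.integrable_mul hA).add ((hA'.integrable (by norm_num)).const_mul C)
  have key := hasDerivAt_expectation (ℙ := ℙ) (slab_mem_nhds hp v) hbound
    (H := fun s σ => φ (vecField ζ (p + s • v) σ) * X s σ)
    (H' := fun s σ => (∑ i, pd i φ (vecField ζ (p + s • v) σ) *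
      dirField v (ζ i) (p + s • v) σ) * X s σ + φ (vecField ζ (p + s • v) σ) * X' s σ)
    (fun s hs => (hφ.continuous.measurable.comp (measurable_vecField hζ (hpos s hs))).mul
      (hXm s (hpos s hs))) ?_ (fun σ s hs => ?_) (fun σ s hs => ?_)
  · simpa using key
  · refine Integrable.bdd_mul (c := C) ?_ ?_ (.of_forall fun σ => hC _)
    · refine (hA.integrable (by norm_num)).mono (hXm 0 (hpos 0 hmem0)).aestronglyMeasurable
        (.of_forall fun σ => (hXb σ 0 hmem0).trans (le_abs_self _))
    · exact (hφ.continuous.measurable.comp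
        (measurable_vecField hζ (hpos 0 hmem0))).aestronglyMeasurable
  · exact (hasDerivAt_comp_vecField hζ (hφ.of_le (by simp)) σ (hpos s hs)).mul
      (hXd σ s (hpos s hs))
  · have h1 : |∑ i, pd i φ (vecField ζ (p + s • v) σ) * dirField v (ζ i) (p + s • v) σ| ≤
        ∑ i, D i * M i σ := by
      refine (Finset.abs_sum_le_sum_abs _ _).trans (Finset.sum_le_sum fun i _ => ?_)
      rw [abs_mul]
      exact mul_le_mul (hD i _) (hMb i σ _ hs _) (abs_nonneg _) (hD0 i)
    refine (abs_add_le _ _).trans (add_le_add ?_ ?_)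
    · rw [abs_mul]
      exact mul_le_mul h1 (hXb σ s hs) (abs_nonneg _) ((abs_nonneg _).trans h1)
    · rw [abs_mul]
      exact mul_le_mul (hC _) (hXb' σ s hs) (abs_nonneg _) hC0

end

/-! ### Conditional means in weak form -/

section WeakIdentities

variable {Ω : Type*} [MeasurableSpace Ω] {ℙ : Measure Ω} [IsProbabilityMeasure ℙ]
  {u ζ : Fin 3 → E3 × ℝ → Ω → ℝ} {f : E3 → E3 → ℝ → ℝ} {f₂ : E3 → E3 → E3 → E3 → ℝ → ℝ} {t : ℝ}

/-- If a correlation function is an integral over the vorticity space, so is its derivative. -/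
lemma expField_dir_eq {X : E3 × ℝ → Ω → ℝ} (hX : RandField ℙ X) {ξ : Ω → ℝ} (hξ : Measurable ξ)
    {C : ℝ} (hC : ∀ σ, |ξ σ| ≤ C) (ht : 0 < t) {η : E3 → ℝ} (hη : Continuous η)
    (hηc : HasCompactSupport η) {g : E3 × E3 → ℝ} (hg : ContDiff ℝ 1 g) {K : ℝ}
    (h : ∀ y, expField ℙ ξ X t y = K + ∫ w, η w * g (w, y)) (j : Fin 3) (y : E3) :
    expField ℙ ξ (dirField (spaceDir j) X) t y = ∫ w, η w * pd j (fun z => g (w, z)) y := by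
  have h1 : HasDerivAt _ _ _ := hX.hasLineDerivAt_expField hξ hC ht y (unitVec j)
  have h2 : HasDerivAt _ _ _ := hasLineDerivAt_integral_of_hasCompactSupport hη hηc hg y j
  have h3 := h2.const_add K
  simp only [h] at h1
  exact h1.unique h3

variable (hζ : ∀ i, RandField ℙ (ζ i)) (ht : 0 < t)
  (hf_pos : ∀ w x t, 0 < t → 0 < f w x t)
  (hf₂ : ∀ x y t, 0 < t → x ≠ y → IsPDFOf ℙ (fun σ => (vecField ζ (x, t) σ, vecField ζ (y, t) σ))
    (fun p : E3 × E3 => f₂ p.1 p.2 x y t))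

include hζ ht hf_pos hf₂ in
/-- The conditional mean of the increment, in weak form. -/
lemma expField_comp_vecField {ψ : E3 → ℝ} (hψ : Continuous ψ) (hψc : HasCompactSupport ψ)
    (k : Fin 3) (x y : E3) :
    expField ℙ (fun σ => ψ (vecField ζ (x, t) σ)) (ζ k) t y =
      expField ℙ (fun σ => ψ (vecField ζ (x, t) σ)) (ζ k) t x +
        ∫ w, ψ w * f w x t * condMean f f₂ k x y w t := by
  -- On the diagonal there is no two-point density; the convention `μ = 0` makes the identity
  -- trivial.
  by_cases hxy : x = y
  · subst hxy; simp [condMean]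
  obtain ⟨C, hC⟩ := exists_bound_of_hasCompactSupport hψ hψc
  have hξ : Measurable fun σ => ψ (vecField ζ (x, t) σ) :=
    hψ.measurable.comp (measurable_vecField hζ (p := (x, t)) ht)
  have hi : ∀ y, Integrable (fun σ => ψ (vecField ζ (x, t) σ) * ζ k (y, t) σ) ℙ := fun y =>
    (hζ k).integrable_mul (p := (y, t)) ht hξ fun σ => hC _
  have hpair := (measurable_vecField hζ (p := (x, t)) ht).prodMk
    (measurable_vecField hζ (p := (y, t)) ht)
  -- `G` is unbounded; its integrability against `f₂` is read off from that of the random variable.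
  -- Integrating out the second variable produces `ψ f μ`, positivity of `f` allowing the division
  -- in `condMean`.
  set G : E3 × E3 → ℝ := fun p => ψ p.1 * (p.2 k - p.1 k) with hG
  have hGm : Measurable G := by
    have : Continuous G := by simp only [hG]; fun_prop
    exact this.measurable
  have hGi : Integrable (fun σ => G (vecField ζ (x, t) σ, vecField ζ (y, t) σ)) ℙ := by
    refine ((hi y).sub (hi x)).congr (.of_forall fun σ => ?_)
    simp [hG, vecField]; ring
  have h1 := (hf₂ x y t ht hxy).integral_comp hpair hGm
  have h2 := (hf₂ x y t ht hxy).integrable_comp hpair hGm hGi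
  rw [Measure.volume_eq_prod] at h1 h2
  rw [integral_prod _ h2] at h1
  have h3 : ∫ σ, G (vecField ζ (x, t) σ, vecField ζ (y, t) σ) ∂ℙ =
      expField ℙ (fun σ => ψ (vecField ζ (x, t) σ)) (ζ k) t y -
      expField ℙ (fun σ => ψ (vecField ζ (x, t) σ)) (ζ k) t x := by
    unfold expField
    rw [← integral_sub (hi y) (hi x)]
    refine integral_congr_ae (.of_forall fun σ => ?_)
    simp [hG, vecField]; ring
  rw [eq_add_of_sub_eq' (h3.symm.trans h1)]
  congr 1
  refine integral_congr_ae (.of_forall fun w => ?_)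
  simp only [condMean, if_neg hxy, hG]
  rw [← integral_const_mul]
  refine integral_congr_ae (.of_forall fun w₁ => ?_)
  have := hf_pos w x t ht
  simp only
  field_simp

end WeakIdentities

section WeakIdentities

variable {Ω : Type*} [MeasurableSpace Ω] {ℙ : Measure Ω} [IsProbabilityMeasure ℙ]
  {u : Fin 3 → E3 × ℝ → Ω → ℝ} {f : E3 → E3 → ℝ → ℝ} {f₂ : E3 → E3 → E3 → E3 → ℝ → ℝ} {t : ℝ}

variable (hu : ∀ i, RandField ℙ (u i)) (ht : 0 < t)
  (hf_pos : ∀ w x t, 0 < t → 0 < f w x t)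
  (hf_smooth : ContDiffOn ℝ ∞ (fun p : E3 × E3 × ℝ => f p.1 p.2.1 p.2.2) {p | 0 < p.2.2})
  (hf₂ : ∀ x y t, 0 < t → x ≠ y →
    IsPDFOf ℙ (fun σ => (vecField (vortField u) (x, t) σ, vecField (vortField u) (y, t) σ))
    (fun p : E3 × E3 => f₂ p.1 p.2 x y t))
  (hμ : ∀ i, SmoothDecayingIncrement (condMean f f₂ i))
  {ψ : E3 → ℝ} (hψ : Continuous ψ) (hψc : HasCompactSupport ψ)

include ht hf_smooth in
lemma contDiff_density : ContDiff ℝ ∞ fun q : E3 × E3 => f q.1 q.2 t := by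
  rw [← contDiffOn_univ]
  exact hf_smooth.comp (f := fun q : E3 × E3 => (q.1, q.2, t)) (by fun_prop) fun q _ => ht

include ht hf_smooth hψ in
lemma continuous_mul_density (x : E3) : Continuous fun w => ψ w * f w x t :=
  hψ.mul ((contDiff_density ht hf_smooth).continuous.comp (by fun_prop : Continuous fun w => (w, x)))

/-- The partial derivative in `y` of a smooth function of `(x, y, w)` is smooth. -/
lemma contDiff_pd_second {m : E3 × E3 × E3 → ℝ} (hm : ContDiff ℝ ∞ m) (j : Fin 3) :
    ContDiff ℝ ∞ fun p : E3 × E3 × E3 => pd j (fun z => m (p.1, z, p.2.2)) p.2.1 := by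
  have h : ∀ p : E3 × E3 × E3, pd j (fun z => m (p.1, z, p.2.2)) p.2.1 =
      fderiv ℝ m p (0, unitVec j, 0) := fun p => by
    have h1 : HasFDerivAt (fun z : E3 => (p.1, z, p.2.2))
        ((ContinuousLinearMap.inr ℝ E3 (E3 × E3)).comp (ContinuousLinearMap.inl ℝ E3 E3)) p.2.1 :=
      (hasFDerivAt_prodMk_right p.1 (p.2.1, p.2.2)).comp p.2.1 (hasFDerivAt_prodMk_left p.2.1 p.2.2)
    rw [pd_comp (hm.differentiable (by simp) _) h1]
    simp
  simp only [h]
  exact (hm.fderiv_right (m := ∞) (by simp)).clm_apply contDiff_const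

include hu ht hf_pos hf_smooth hf₂ hμ hψ hψc in
-- In the weak form of `μ` the diagonal term `E[ψ(W(x)) W^k(x)]` does not depend on `y`, so it
-- disappears on differentiating in `y`.
lemma expField_dir_vorticity (j k : Fin 3) (x y : E3) :
    expField ℙ (fun σ => ψ (vecField (vortField u) (x, t) σ)) (dirField (spaceDir j)
      (vortField u k)) t y =
      ∫ w, ψ w * f w x t * pd j (fun z => condMean f f₂ k x z w t) y := by
  have hζ := randField_vortField hu
  obtain ⟨C, hC⟩ := exists_bound_of_hasCompactSupport hψ hψc
  have hm := (hμ k).contDiff ht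
  refine expField_dir_eq (hζ k)
    (hψ.measurable.comp (measurable_vecField hζ (p := (x, t)) ht)) (fun σ => hC _) ht
    (continuous_mul_density ht hf_smooth hψ x) hψc.mul_right
    (g := fun q : E3 × E3 => condMean f f₂ k x q.2 q.1 t) ?_
    (expField_comp_vecField hζ ht hf_pos hf₂ hψ hψc k x) j y
  exact (hm.comp (by fun_prop : ContDiff ℝ ∞ fun q : E3 × E3 => (x, q.2, q.1))).of_le (by simp)

include hu ht hf_pos hf_smooth hf₂ hμ hψ hψc in
lemma expField_dir_dir_vorticity (j k : Fin 3) (x y : E3) :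
    expField ℙ (fun σ => ψ (vecField (vortField u) (x, t) σ)) (dirField (spaceDir j)
      (dirField (spaceDir j) (vortField u k))) t y =
      ∫ w, ψ w * f w x t * pd j (pd j fun z => condMean f f₂ k x z w t) y := by
  have hζ := randField_vortField hu
  obtain ⟨C, hC⟩ := exists_bound_of_hasCompactSupport hψ hψc
  have hm := contDiff_pd_second ((hμ k).contDiff ht) j
  refine expField_dir_eq ((hζ k).dir _)
    (hψ.measurable.comp (measurable_vecField hζ (p := (x, t)) ht)) (fun σ => hC _) ht
    (continuous_mul_density ht hf_smooth hψ x) hψc.mul_right (K := 0)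
    (g := fun q : E3 × E3 => pd j (fun z => condMean f f₂ k x z q.1 t) q.2) ?_
    (fun y => ?_) j y
  · exact (hm.comp (by fun_prop : ContDiff ℝ ∞ fun q : E3 × E3 => (x, q.2, q.1))).of_le (by simp)
  · rw [zero_add]
    exact expField_dir_vorticity hu ht hf_pos hf_smooth hf₂ hμ hψ hψc j k x y

include hu ht hf_pos hf_smooth hf₂ hμ hψ hψc in
lemma expField_curl_vorticity (i : Fin 3) (x y : E3) :
    expField ℙ (fun σ => ψ (vecField (vortField u) (x, t) σ)) (vortField (vortField u) i) t y =
      ∫ w, ψ w * f w x t * curlMean (condMean f f₂) i x y w t := by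
  have hζ := randField_vortField hu
  obtain ⟨C, hC⟩ := exists_bound_of_hasCompactSupport hψ hψc
  rw [vortField_eq_sum, RandField.expField_sum (ξ := fun σ => ψ (vecField (vortField u) (x, t) σ)) _
    (X := fun q : Fin 3 × Fin 3 => dirField (spaceDir q.1) (vortField u q.2))
    (fun q => (hζ q.2).dir _)
    (hψ.measurable.comp (measurable_vecField hζ (p := (x, t)) ht)) (fun σ => hC _) ht]
  simp only [expField_dir_vorticity hu ht hf_pos hf_smooth hf₂ hμ hψ hψc, ← integral_const_mul]
  rw [← integral_finsetSum _ fun q _ => ?_]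
  · refine integral_congr_ae (.of_forall fun w => ?_)
    simp only [curlMean]
    rw [Fintype.sum_prod_type, Finset.mul_sum]
    refine Finset.sum_congr rfl fun j _ => ?_
    rw [Finset.mul_sum]
    exact Finset.sum_congr rfl fun k _ => by ring
  · have h1 := (contDiff_pd_second ((hμ q.2).contDiff ht) q.1).continuous.comp
      (by fun_prop : Continuous fun w : E3 => (x, y, w))
    exact (((continuous_mul_density ht hf_smooth hψ x).mul h1).integrable_of_hasCompactSupport
      hψc.mul_right.mul_right).const_mul _

lemma weaklySingular_newton : WeaklySingular fun z => 1 / (4 * Real.pi * ‖z‖) := by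
  refine .of_abs_le (by fun_prop) (1 / (4 * Real.pi)) (by positivity) fun z hz => .inl ?_
  rw [abs_of_nonneg (by positivity), div_div]

lemma weaklySingular_newton_grad (l : Fin 3) :
    WeaklySingular fun z => z l / (4 * Real.pi * ‖z‖ ^ 3) := by
  obtain ⟨hm, A, hA⟩ := weaklySingular_coord_div l
  refine ⟨by fun_prop, 1 / (4 * Real.pi) * A, fun z hz => ?_⟩
  have : z l / (4 * Real.pi * ‖z‖ ^ 3) = 1 / (4 * Real.pi) * (z l / ‖z‖ ^ 3) := by field_simp
  simp only [this]
  rw [abs_mul, abs_of_pos (by positivity : 0 < 1 / (4 * Real.pi)), mul_assoc]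
  gcongr
  exact hA z hz

variable (hdiv : ∀ σ, ∀ p ∈ posTime, ∑ j, dirField (spaceDir j) (u j) p σ = 0)

include hu ht hf_pos hf_smooth hf₂ hμ hψ hψc hdiv in
/-- The conditional mean of the velocity, in weak form. -/
lemma expField_velocity (i : Fin 3) (x : E3) :
    expField ℙ (fun σ => ψ (vecField (vortField u) (x, t) σ)) (u i) t x =
      ∫ w, ψ w * f w x t * fieldB (condMean f f₂) i x w t := by
  have hζ := randField_vortField hu
  obtain ⟨C, hC⟩ := exists_bound_of_hasCompactSupport hψ hψc
  have hξ := hψ.measurable.comp (measurable_vecField hζ (p := (x, t)) ht)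
  -- For divergence-free `U`, `-ΔU = curl W`; the density of the potential is therefore the
  -- correlation with `curl W`, known in terms of `μ`.
  have h1 := expField_eq_potential (hu i) hξ (C := C) (fun σ => hC _) ht x
    (Y := vortField (vortField u) i) fun y σ =>
      vort_vort (u := fun k q => u k q σ) (fun k => (hu k).smooth σ) (p := (y, t)) ht (hdiv σ) i
  have h2 : ∀ y, expField ℙ (ψ ∘ vecField (vortField u) (x, t)) (vortField (vortField u) i) t y = _ :=
    expField_curl_vorticity hu ht hf_pos hf_smooth hf₂ hμ hψ hψc i x
  have h3 := DecayKernel.integral_swap (decayKernel_curlMean hμ ht i) weaklySingular_newton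
    (continuous_mul_density ht hf_smooth hψ x) hψc.mul_right x
  change _ = ∫ w, ψ w * f w x t * ∫ y, 1 / (4 * Real.pi * ‖y - x‖) * _
  refine Eq.trans ?_ h3
  simp only [h2] at h1
  rw [← integral_add_right_eq_self _ x]
  simp only [add_sub_cancel_right]
  have h4 : ∀ z : E3, 1 / (4 * Real.pi * ‖z‖) = 1 / (4 * Real.pi) * (1 / ‖z‖) := fun z => by
    rw [div_mul_div_comm, one_mul]
  simp only [h4, mul_assoc (1 / (4 * Real.pi))]
  rw [integral_const_mul, ← h1]
  field_simp
  rfl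

include hu ht hf_pos hf_smooth hf₂ hμ hψ hψc hdiv in
/-- The conditional mean of the velocity gradient, in weak form. -/
lemma expField_dir_velocity (i l : Fin 3) (x : E3) :
    expField ℙ (fun σ => ψ (vecField (vortField u) (x, t) σ)) (dirField (spaceDir l) (u i)) t x =
      ∫ w, ψ w * f w x t * ∫ y, kernelD (condMean f f₂) i l x w t y := by
  have hζ := randField_vortField hu
  have hcc := randField_vortField hζ
  obtain ⟨C, hC⟩ := exists_bound_of_hasCompactSupport hψ hψc
  have hξ := hψ.measurable.comp (measurable_vecField hζ (p := (x, t)) ht)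
  -- The Newtonian representation is applied to `∂ₗU`, with `-Δ∂ₗU = ∂ₗ curl W`, rather than
  -- differentiated in `x`.
  have h1 := expField_eq_potential ((hu i).dir (spaceDir l)) hξ (C := C) (fun σ => hC _) ht x
    (Y := dirField (spaceDir l) (vortField (vortField u) i)) fun y σ => by
      have hus : ∀ k, SmoothPos fun q => u k q σ := fun k => (hu k).smooth σ
      have hp : (y, t) ∈ posTime := ht
      have h1 : dd (spaceDir l) (vort (vort fun k q => u k q σ) i) (y, t) = _ :=
        dd_congr (h := fun p => ∑ k, (-1) * dd (spaceDir k) (dd (spaceDir k) fun q => u i q σ) p)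
          (fun q hq => by rw [vort_vort hus hq (hdiv σ)]; simp) hp (spaceDir l)
      rw [SmoothPos.dd_sum _ (fun k => ((hus i).dd _).dd _) hp] at h1
      change dd (spaceDir l) (vort (vort fun k q => u k q σ) i) (y, t) = _
      rw [h1, ← Finset.sum_neg_distrib]
      refine Finset.sum_congr rfl fun k _ => ?_
      rw [((hus i).dd _).dd_comm hp, neg_one_mul]
      exact congrArg Neg.neg (dd_congr (fun q hq => (hus i).dd_comm hq _ _) hp _)
  have h2 : ∀ y, expField ℙ (ψ ∘ vecField (vortField u) (x, t)) (vortField (vortField u) i) t y = _ :=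
    expField_curl_vorticity hu ht hf_pos hf_smooth hf₂ hμ hψ hψc i x
  -- Moving `∂ₗ` onto `1/|z|` yields the kernel `z_l/|z|³` of `D`, acting on the undifferentiated
  -- `curl W`.
  rw [integral_inv_norm_mul_lineDeriv
    (((hcc i).cubicDecay_expField hξ (C := C) (fun σ => hC _) ht).comp_add_right x)
    ((((hcc i).dir _).cubicDecay_expField hξ (C := C) (fun σ => hC _) ht).comp_add_right x) l
    (fun z => HasLineDerivAt.comp_add_const
      ((hcc i).hasLineDerivAt_expField hξ (C := C) (fun σ => hC _) ht _ _))] at h1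
  have h3 := DecayKernel.integral_swap (decayKernel_curlMean hμ ht i) (weaklySingular_newton_grad l)
    (continuous_mul_density ht hf_smooth hψ x) hψc.mul_right x
  refine Eq.trans ?_ h3
  simp only [h2] at h1
  rw [← integral_add_right_eq_self _ x]
  simp only [add_sub_cancel_right]
  have h4 : ∀ z : E3, z l / (4 * Real.pi * ‖z‖ ^ 3) = 1 / (4 * Real.pi) * (z l / ‖z‖ ^ 3) :=
    fun z => by rw [div_mul_div_comm, one_mul]
  simp only [h4, mul_assoc (1 / (4 * Real.pi))]
  rw [integral_const_mul, ← h1]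
  field_simp
  rfl

end WeakIdentities

section Slices

variable {g : E3 × E3 → ℝ}

lemma pd_snd_eq (hg : Differentiable ℝ g) (w x : E3) (k : Fin 3) :
    pd k (fun z => g (w, z)) x = fderiv ℝ g (w, x) (0, unitVec k) :=
  pd_comp (φ := fun z => (w, z)) (hg _) (hasFDerivAt_prodMk_right w x) k

lemma contDiff_pd_snd (hg : ContDiff ℝ ∞ g) (k : Fin 3) :
    ContDiff ℝ ∞ fun q : E3 × E3 => pd k (fun z => g (q.1, z)) q.2 := by
  simp only [pd_snd_eq (hg.differentiable (by simp))]
  exact (hg.fderiv_right (m := ∞) (by simp)).clm_apply contDiff_const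

lemma continuous_pd_snd (hg : ContDiff ℝ 1 g) (k : Fin 3) :
    Continuous fun q : E3 × E3 => pd k (fun z => g (q.1, z)) q.2 := by
  simp only [pd_snd_eq (hg.differentiable (by simp))]
  exact (hg.continuous_fderiv (by simp)).clm_apply continuous_const

lemma pd_sub {g h : E3 → ℝ} {x : E3} (hg : DifferentiableAt ℝ g x) (hh : DifferentiableAt ℝ h x)
    (k : Fin 3) : pd k (fun z => g z - h z) x = pd k g x - pd k h x := by
  unfold pd; rw [fderiv_fun_sub hg hh]; rfl

lemma pd_const_mul {g : E3 → ℝ} {x : E3} (hg : DifferentiableAt ℝ g x) (c : ℝ)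
    (k : Fin 3) : pd k (fun z => c * g z) x = c * pd k g x := by
  unfold pd; rw [fderiv_const_mul hg]; rfl

lemma pd_mul {g h : E3 → ℝ} {x : E3} (hg : DifferentiableAt ℝ g x) (hh : DifferentiableAt ℝ h x)
    (k : Fin 3) : pd k (fun z => g z * h z) x = g x * pd k h x + h x * pd k g x := by
  unfold pd; rw [fderiv_fun_mul hg hh]; rfl

end Slices

/-! ### Regularity of the coefficients -/

section Coefficients

variable {f : E3 → E3 → ℝ → ℝ} {f₂ : E3 → E3 → E3 → E3 → ℝ → ℝ} {t : ℝ} (ht : 0 < t)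
  (hμ : ∀ i, SmoothDecayingIncrement (condMean f f₂ i))
  {a : Fin 3 → Fin 3 → E3 → E3 → ℝ → ℝ} {b : Fin 3 → Fin 3 → Fin 3 → E3 → E3 → ℝ → ℝ}
  (hab : ∀ i x w t, 0 < t →
      (fun y : E3 => condMean f f₂ i x y w t
          - (∑ k, a i k x w t * (y k - x k)
            + ∑ j, ∑ k, b i j k x w t * (y k - x k) * (y j - x j)))
        =o[𝓝 x] fun y : E3 => ‖y - x‖ ^ 2)

include ht hμ hab

lemma expansion_coefficients (i k : Fin 3) (x w : E3) :
    a i k x w t = pd k (fun y => condMean f f₂ i x y w t) x ∧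
      2 * b i k k x w t = pd k (pd k fun y => condMean f f₂ i x y w t) x :=
  pd_eq_of_expansion (((hμ i).contDiff ht).comp
      (by fun_prop : ContDiff ℝ ∞ fun y : E3 => (x, y, w))) (by simp [condMean])
    (a := fun k => a i k x w t) (b := fun j k => b i j k x w t) (hab i x w t ht) k

/-- Smoothness is inherited from `μ`: the coefficients are `y`-derivatives of `μ` restricted to the
diagonal `y = x`. -/
lemma contDiff_linear_coefficient (i k : Fin 3) :
    ContDiff ℝ ∞ fun q : E3 × E3 => a i k q.2 q.1 t := by
  simp only [fun x w => (expansion_coefficients ht hμ hab i k x w).1]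
  exact (contDiff_pd_second ((hμ i).contDiff ht) k).comp
    (by fun_prop : ContDiff ℝ ∞ fun q : E3 × E3 => (q.2, q.2, q.1))

lemma contDiff_quadratic_coefficient (i : Fin 3) (x : E3) :
    ContDiff ℝ ∞ fun w : E3 => ∑ k, b i k k x w t := by
  have h : ∀ k w, b i k k x w t = 1 / 2 * pd k (pd k fun y => condMean f f₂ i x y w t) x :=
    fun k w => by linarith [(expansion_coefficients ht hμ hab i k x w).2]
  simp only [h]
  refine ContDiff.sum fun k _ => contDiff_const.mul ?_
  exact (contDiff_pd_second (contDiff_pd_second ((hμ i).contDiff ht) k) k).comp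
    (by fun_prop : ContDiff ℝ ∞ fun w : E3 => (x, x, w))

omit hab

lemma contDiff_fieldB (i : Fin 3) :
    ContDiff ℝ 1 fun q : E3 × E3 => fieldB (condMean f f₂) i q.2 q.1 t := by
  have h := (decayKernel_curlMean hμ ht i).contDiff_potential weaklySingular_newton
  have h' : ContDiff ℝ 1 fun q : E3 × E3 => (q.2, q.1) := contDiff_snd.prodMk contDiff_fst
  have h'' := h.comp h'
  simp only [Function.comp_def] at h''
  simp only [fieldB, kernelB]
  exact h''

lemma contDiff_integral_kernelD (i l : Fin 3) (x : E3) :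
    ContDiff ℝ 1 fun w : E3 => ∫ y, kernelD (condMean f f₂) i l x w t y := by
  have h := (decayKernel_curlMean hμ ht i).contDiff_potential (weaklySingular_newton_grad l)
  have h' : ContDiff ℝ 1 fun w : E3 => (x, w) := by fun_prop
  exact h.comp h'

lemma contDiff_fieldD (i : Fin 3) (x : E3) :
    ContDiff ℝ 1 fun w : E3 => fieldD (condMean f f₂) i x w t :=
  ContDiff.sum fun l _ => (by fun_prop : ContDiff ℝ 1 fun w : E3 => w l).mul
    (contDiff_integral_kernelD ht hμ i l x)

lemma integrable_kernelB (i : Fin 3) (x w : E3) : Integrable (kernelB (condMean f f₂) i x w t) :=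
  (decayKernel_curlMean hμ ht i).integrable weaklySingular_newton x w

lemma integrable_kernelD (i l : Fin 3) (x w : E3) :
    Integrable (kernelD (condMean f f₂) i l x w t) :=
  (decayKernel_curlMean hμ ht i).integrable (weaklySingular_newton_grad l) x w

end Coefficients

/-! ### Derivatives of the one-point density in weak form -/

section Evolution

variable {Ω : Type*} [MeasurableSpace Ω] {ℙ : Measure Ω} [IsProbabilityMeasure ℙ]
  {ζ : Fin 3 → E3 × ℝ → Ω → ℝ} {f : E3 → E3 → ℝ → ℝ} {t : ℝ}
  (hζ : ∀ i, RandField ℙ (ζ i)) (ht : 0 < t)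
  (hf : ∀ x t, 0 < t → IsPDFOf ℙ (vecField ζ (x, t)) (fun w => f w x t))
  (hf_smooth : ContDiffOn ℝ ∞ (fun p : E3 × E3 × ℝ => f p.1 p.2.1 p.2.2) {p | 0 < p.2.2})
  {φ : E3 → ℝ} (hφ : ContDiff ℝ ∞ φ) (hφc : HasCompactSupport φ)

include hζ hφ hφc in
lemma hasDerivAt_expectation_test {p : E3 × ℝ} (hp : p ∈ posTime) (v : E3 × ℝ) :
    HasDerivAt (fun s : ℝ => ∫ σ, φ (vecField ζ (p + s • v) σ) ∂ℙ)
      (∑ i, expField ℙ (fun σ => pd i φ (vecField ζ p σ)) (dirField v (ζ i)) p.2 p.1) 0 := by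
  -- The general formula with the constant factor 1, whose derivative term vanishes.
  have h := hasDerivAt_expectation_comp_vecField hζ hφ hφc hp v (X := fun _ _ => 1)
    (X' := fun _ _ => 0) (A := fun _ => 1) (A' := fun _ => 0) (memLp_const 1) (memLp_const 0)
    (fun s _ => measurable_const) (fun σ s _ => hasDerivAt_const s 1) (fun σ s _ => by simp)
    (fun σ s _ => by simp)
  simp only [mul_one, mul_zero, add_zero] at h
  convert h using 1
  unfold expField
  rw [integral_finsetSum _ fun i _ => ?_]
  obtain ⟨C, hC⟩ := exists_bound_of_hasCompactSupport (contDiff_pd hφ i).continuous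
    (hasCompactSupport_pd hφc i)
  exact ((hζ i).dir v).integrable_mul hp
    ((contDiff_pd hφ i).continuous.measurable.comp (measurable_vecField hζ hp)) fun σ => hC _

omit [IsProbabilityMeasure ℙ] in
include hζ hf hφ in
lemma integral_test_eq (x : E3) {t : ℝ} (ht : 0 < t) :
    ∫ σ, φ (vecField ζ (x, t) σ) ∂ℙ = ∫ w, φ w * f w x t :=
  (hf x t ht).integral_comp (measurable_vecField hζ (p := (x, t)) ht) hφ.continuous.measurable

include hf_smooth in
lemma continuous_deriv_density : ContinuousOn (fun p : E3 × E3 × ℝ => deriv (f p.1 p.2.1) p.2.2)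
    {p | 0 < p.2.2} ∧ ∀ w x t, 0 < t → DifferentiableAt ℝ (f w x) t := by
  have hopen : IsOpen {p : E3 × E3 × ℝ | 0 < p.2.2} := isOpen_lt continuous_const (by fun_prop)
  have h : ∀ p : E3 × E3 × ℝ, 0 < p.2.2 → HasDerivAt (f p.1 p.2.1)
      (fderiv ℝ (fun p : E3 × E3 × ℝ => f p.1 p.2.1 p.2.2) p (0, 0, 1)) p.2.2 := fun p hp => by
    have h1 := ((hf_smooth.contDiffAt (hopen.mem_nhds hp)).differentiableAt
      (by simp)).hasFDerivAt
    exact h1.comp_hasDerivAt p.2.2 (f := fun s : ℝ => (p.1, p.2.1, s))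
      ((hasDerivAt_const _ _).prodMk ((hasDerivAt_const _ _).prodMk (hasDerivAt_id _)))
  refine ⟨?_, fun w x t ht => (h (w, x, t) ht).differentiableAt⟩
  have h2 := (hf_smooth.fderiv_of_isOpen (m := 0) hopen (by simp)).continuousOn
  refine (h2.clm_apply (continuousOn_const (c := ((0, 0, 1) : E3 × E3 × ℝ)))).congr fun p hp => ?_
  exact (h p hp).deriv

include hζ ht hf hf_smooth hφ hφc in
-- Both sides are the time derivative of `E[φ(ζ(x,t))] = ∫ φ f dw`, computed once on the density and
-- once on the realizations.
lemma integral_test_mul_deriv (x : E3) :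
    ∫ w, φ w * deriv (f w x) t =
      ∑ i, expField ℙ (fun σ => pd i φ (vecField ζ (x, t) σ)) (dirField timeDir (ζ i)) t x := by
  obtain ⟨hcont, hdiff⟩ := continuous_deriv_density hf_smooth
  have h1 := hasDerivAt_expectation_test hζ hφ hφc (p := (x, t)) ht timeDir
  have h2 := hasDerivAt_integral_of_hasCompactSupport hφ.continuous hφc (s₀ := t) (S := Set.Ioi 0)
    (Ioi_mem_nhds ht) (F := fun w s => f w x s) (F' := fun w s => deriv (f w x) s)
    (fun s hs => (contDiff_density hs hf_smooth).continuous.comp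
      (by fun_prop : Continuous fun w => (w, x)))
    (fun w s hs => (hdiff w x s hs).hasDerivAt)
    (hcont.comp (f := fun q : E3 × ℝ => (q.1, x, q.2)) (by fun_prop) fun q hq => hq.2)
  have h3 : HasDerivAt (fun s : ℝ => ∫ w, φ w * f w x (t + s)) (∫ w, φ w * deriv (f w x) t) 0 :=
    HasDerivAt.comp_const_add t 0 (by simpa using h2)
  refine h3.unique (h1.congr_of_eventuallyEq ?_)
  filter_upwards [RandField.eventually_line (p := (x, t)) ht timeDir] with s hs
  have h4 : (x, t) + s • timeDir = (x, t + s) := by simp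
  rw [h4] at hs ⊢
  exact (integral_test_eq hζ hf hφ x hs).symm

include hζ ht hf hf_smooth hφ hφc in
lemma integral_test_mul_pd (k : Fin 3) (x : E3) :
    ∫ w, φ w * pd k (fun z => f w z t) x =
      ∑ i, expField ℙ (fun σ => pd i φ (vecField ζ (x, t) σ))
        (dirField (spaceDir k) (ζ i)) t x := by
  have h1 := hasDerivAt_expectation_test hζ hφ hφc (p := (x, t)) ht (spaceDir k)
  have h2 : HasDerivAt _ _ _ := hasLineDerivAt_integral_of_hasCompactSupport hφ.continuous hφc
    ((contDiff_density ht hf_smooth).of_le (by simp)) x k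
  refine h2.unique (h1.congr_of_eventuallyEq (.of_forall fun s => ?_))
  have h4 : (x, t) + s • spaceDir k = (x + s • unitVec k, t) := by simp
  simp only [h4]
  exact (integral_test_eq hζ hf hφ _ ht).symm

end Evolution

section Transport

variable {Ω : Type*} [MeasurableSpace Ω] {ℙ : Measure Ω} [IsProbabilityMeasure ℙ]
  {ζ : Fin 3 → E3 × ℝ → Ω → ℝ} {t : ℝ}

/-- The derivative of a correlation `E[φ(ζ(x,t)) X(x,t)]` in the common point `x`. -/
lemma integral_test_mul_transport (hζ : ∀ i, RandField ℙ (ζ i)) (ht : 0 < t) {φ : E3 → ℝ}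
    (hφ : ContDiff ℝ ∞ φ) (hφc : HasCompactSupport φ) {X : E3 × ℝ → Ω → ℝ} (hX : RandField ℙ X)
    {g : E3 × E3 → ℝ} (hg : ContDiff ℝ 1 g)
    (h : ∀ x, expField ℙ (fun σ => φ (vecField ζ (x, t) σ)) X t x = ∫ w, φ w * g (w, x))
    (k : Fin 3) (x : E3) :
    ∫ w, φ w * pd k (fun z => g (w, z)) x =
      ∑ i, ∫ σ, pd i φ (vecField ζ (x, t) σ) *
        (X (x, t) σ * dirField (spaceDir k) (ζ i) (x, t) σ) ∂ℙ +
        expField ℙ (fun σ => φ (vecField ζ (x, t) σ)) (dirField (spaceDir k) X) t x := by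
  have hp : (x, t) ∈ posTime := ht
  have h4 : ∀ s : ℝ, (x, t) + s • spaceDir k = (x + s • unitVec k, t) := fun s => by simp
  obtain ⟨A, hA, -, hAb⟩ := hX.bound isCompact_Icc (slab_subset hp)
  obtain ⟨A', hA', -, hAb'⟩ := (hX.dir (spaceDir k)).bound isCompact_Icc (slab_subset hp)
  have h1 := hasDerivAt_expectation_comp_vecField hζ hφ hφc hp (spaceDir k)
    (X := fun s => X ((x, t) + s • spaceDir k))
    (X' := fun s => dirField (spaceDir k) X ((x, t) + s • spaceDir k)) hA hA'
    (fun s hs => hX.measurable _ hs) (fun σ s hs => hX.hasDerivAt_line σ hs)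
    (fun σ s hs => hAb σ _ hs _) (fun σ s hs => hAb' σ _ hs _)
  have h2 : HasDerivAt _ _ _ := hasLineDerivAt_integral_of_hasCompactSupport hφ.continuous hφc hg x k
  simp only [h4, zero_smul, add_zero] at h1
  simp only [← h] at h2
  -- Two computations of the same derivative: under the `w`-integral, and under the expectation by
  -- the product and chain rules.
  rw [h2.unique h1]
  have hm := measurable_vecField hζ hp
  obtain ⟨C, hC⟩ := exists_bound_of_hasCompactSupport hφ.continuous hφc
  have hi' : Integrable (fun σ => φ (vecField ζ (x, t) σ) *
      dirField (spaceDir k) X (x, t) σ) ℙ :=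
    (hX.dir _).integrable_mul hp (hφ.continuous.measurable.comp hm) fun σ => hC _
  have hi : ∀ i, Integrable (fun σ => pd i φ (vecField ζ (x, t) σ) *
      (X (x, t) σ * dirField (spaceDir k) (ζ i) (x, t) σ)) ℙ := fun i => by
    obtain ⟨D, hD⟩ := exists_bound_of_hasCompactSupport (contDiff_pd hφ i).continuous
      (hasCompactSupport_pd hφc i)
    exact ((hX.memLp hp).integrable_mul (((hζ i).dir _).memLp hp)).bdd_mul
      ((contDiff_pd hφ i).continuous.measurable.comp hm).aestronglyMeasurable
      (.of_forall fun σ => hD _)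
  unfold expField
  rw [← integral_finsetSum _ fun i _ => hi i, ← integral_add (integrable_finsetSum _ fun i _ => hi i) hi']
  refine integral_congr_ae (.of_forall fun σ => ?_)
  simp only [Finset.sum_mul]
  congr 1
  exact Finset.sum_congr rfl fun i _ => by ring

end Transport

lemma neg_integral_add_integral {Ω : Type*} [MeasurableSpace Ω] {ℙ : Measure Ω} {F G H : Ω → ℝ}
    {ν : ℝ} (hF : Integrable F ℙ) (hG : Integrable G ℙ) (hH : Integrable H ℙ) :
    -(∫ σ, F σ ∂ℙ) + ((∫ σ, G σ ∂ℙ) + ν * ∫ σ, H σ ∂ℙ) = ∫ σ, (-F σ + (G σ + ν * H σ)) ∂ℙ := by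
  have h : Integrable (fun σ => G σ + ν * H σ) ℙ := hG.add (hH.const_mul ν)
  have hn : Integrable (fun σ => -F σ) ℙ := hF.neg
  rw [integral_add hn h, integral_neg, integral_add hG (hH.const_mul ν), integral_const_mul]

/-! ### The evolution equation, weak and strong -/

section Weak

variable {Ω : Type*} [MeasurableSpace Ω] {ℙ : Measure Ω} [IsProbabilityMeasure ℙ]
  {u : Fin 3 → E3 × ℝ → Ω → ℝ} {f : E3 → E3 → ℝ → ℝ} {f₂ : E3 → E3 → E3 → E3 → ℝ → ℝ} {ν t : ℝ}
  {a : Fin 3 → Fin 3 → E3 → E3 → ℝ → ℝ} {b : Fin 3 → Fin 3 → Fin 3 → E3 → E3 → ℝ → ℝ}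
  (hu : ∀ i, RandField ℙ (u i)) (ht : 0 < t)
  (hdiv : ∀ σ, ∀ p ∈ posTime, ∑ j, dirField (spaceDir j) (u j) p σ = 0)
  (hvort : ∀ σ, ∀ p ∈ posTime, ∀ i, dirField timeDir (vortField u i) p σ +
    ∑ j, u j p σ * dirField (spaceDir j) (vortField u i) p σ =
    ∑ j, vortField u j p σ * dirField (spaceDir j) (u i) p σ +
      ν * ∑ k, dirField (spaceDir k) (dirField (spaceDir k) (vortField u i)) p σ)
  (hf : ∀ x t, 0 < t → IsPDFOf ℙ (vecField (vortField u) (x, t)) (fun w => f w x t))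
  (hf_pos : ∀ w x t, 0 < t → 0 < f w x t)
  (hf_smooth : ContDiffOn ℝ ∞ (fun p : E3 × E3 × ℝ => f p.1 p.2.1 p.2.2) {p | 0 < p.2.2})
  (hf₂ : ∀ x y t, 0 < t → x ≠ y →
    IsPDFOf ℙ (fun σ => (vecField (vortField u) (x, t) σ, vecField (vortField u) (y, t) σ))
    (fun p : E3 × E3 => f₂ p.1 p.2 x y t))
  (hμ : ∀ i, SmoothDecayingIncrement (condMean f f₂ i))
  (hab : ∀ i x w t, 0 < t →
      (fun y : E3 => condMean f f₂ i x y w t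
          - (∑ k, a i k x w t * (y k - x k)
            + ∑ j, ∑ k, b i j k x w t * (y k - x k) * (y j - x j)))
        =o[𝓝 x] fun y : E3 => ‖y - x‖ ^ 2)
  {φ : E3 → ℝ} (hφ : ContDiff ℝ ∞ φ) (hφc : HasCompactSupport φ)

include hu ht hf hf_pos hf_smooth hf₂ hμ hab hφ hφc in
/-- The Laplacian of the density, in weak form. -/
lemma integral_test_mul_lap (x : E3) :
    ∫ w, φ w * lap (fun z => f w z t) x =
      ∑ i, ∫ w, pd i φ w * ∑ k, pd k (fun z => f w z t * a i k z w t) x := by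
  have hζ := randField_vortField hu
  have hfs := contDiff_density ht hf_smooth
  have hfa : ∀ i k, ContDiff ℝ ∞ fun q : E3 × E3 => f q.1 q.2 t * a i k q.2 q.1 t := fun i k =>
    hfs.mul (contDiff_linear_coefficient ht hμ hab i k)
  have hsec : ∀ {g : E3 × E3 → ℝ}, Continuous g → ∀ x, Continuous fun w => g (w, x) :=
    fun hg x => hg.comp (by fun_prop)
  have h1 : ∀ k x, ∫ w, φ w * pd k (fun z => f w z t) x =
      ∑ i, ∫ w, pd i φ w * (f w x t * a i k x w t) := fun k x => by
    rw [integral_test_mul_pd hζ ht hf hf_smooth hφ hφc]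
    refine Finset.sum_congr rfl fun i _ => ?_
    rw [expField_dir_vorticity hu ht hf_pos hf_smooth hf₂ hμ (contDiff_pd hφ i).continuous
      (hasCompactSupport_pd hφc i)]
    refine integral_congr_ae (.of_forall fun w => ?_)
    simp only [(expansion_coefficients ht hμ hab i k x w).1, mul_assoc]
  -- The first-order identity holds at every `x` with `φ` fixed, so it can be differentiated once
  -- more in `x^k`; no second-order chain rule is needed.
  have h2 : ∀ k, ∫ w, φ w * pd k (pd k fun z => f w z t) x =
      ∑ i, ∫ w, pd i φ w * pd k (fun z => f w z t * a i k z w t) x := fun k => by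
    have h3 : HasDerivAt _ _ _ := hasLineDerivAt_integral_of_hasCompactSupport hφ.continuous hφc
      ((contDiff_pd_snd hfs k).of_le (by simp)) x k
    have h4 : ∀ i, HasDerivAt _ _ _ := fun i => hasLineDerivAt_integral_of_hasCompactSupport
      (contDiff_pd hφ i).continuous (hasCompactSupport_pd hφc i) ((hfa i k).of_le (by simp)) x k
    have h5 := HasDerivAt.fun_sum (u := Finset.univ) fun i _ => h4 i
    simp only [h1] at h3
    exact h3.unique h5
  simp only [lap, Finset.mul_sum]
  rw [integral_finsetSum _ fun k _ => ?_]
  · simp only [h2]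
    rw [Finset.sum_comm]
    refine Finset.sum_congr rfl fun i _ => ?_
    rw [integral_finsetSum _ fun k _ => ?_]
    exact ((contDiff_pd hφ i).continuous.mul (hsec (contDiff_pd_snd (hfa i k) k).continuous
      x)).integrable_of_hasCompactSupport (hasCompactSupport_pd hφc i).mul_right
  · exact (hφ.continuous.mul (hsec (contDiff_pd_snd (contDiff_pd_snd hfs k) k).continuous
      x)).integrable_of_hasCompactSupport hφc.mul_right

include hu ht hdiv hf_pos hf_smooth hf₂ hμ hφ hφc in
/-- The convection term, in weak form. -/
lemma integral_test_mul_convection (x : E3) :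
    ∑ i, ∑ j, ∫ σ, pd i φ (vecField (vortField u) (x, t) σ) *
        (u j (x, t) σ * dirField (spaceDir j) (vortField u i) (x, t) σ) ∂ℙ =
      ∫ w, φ w * ∑ j, pd j (fun z => f w z t * fieldB (condMean f f₂) j z w t) x := by
  have hζ := randField_vortField hu
  have hp : (x, t) ∈ posTime := ht
  have hg : ∀ j, ContDiff ℝ 1 fun q : E3 × E3 =>
      f q.1 q.2 t * fieldB (condMean f f₂) j q.2 q.1 t := fun j =>
    ((contDiff_density ht hf_smooth).of_le (by simp)).mul (contDiff_fieldB ht hμ j)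
  obtain ⟨C, hC⟩ := exists_bound_of_hasCompactSupport hφ.continuous hφc
  have h1 : ∀ j, _ := fun j => integral_test_mul_transport hζ ht hφ hφc (hu j) (hg j)
    (fun x => by
      rw [expField_velocity hu ht hf_pos hf_smooth hf₂ hμ hφ.continuous hφc hdiv]
      simp only [mul_assoc]) j x
  -- After summation over `j` this is `E[φ(W) div U] = 0`, so only the transport of `W` by `U`
  -- survives.
  have h2 : ∑ j, expField ℙ (fun σ => φ (vecField (vortField u) (x, t) σ))
      (dirField (spaceDir j) (u j)) t x = 0 := by
    have hi : ∀ j, Integrable (fun σ => φ (vecField (vortField u) (x, t) σ) *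
        dirField (spaceDir j) (u j) (x, t) σ) ℙ := fun j =>
      ((hu j).dir _).integrable_mul hp
        (hφ.continuous.measurable.comp (measurable_vecField hζ hp)) fun σ => hC _
    simp only [expField]
    rw [← integral_finsetSum _ fun j _ => hi j]
    simp only [← Finset.mul_sum, hdiv _ _ hp, mul_zero, integral_zero]
  simp only [Finset.mul_sum]
  rw [integral_finsetSum _ fun j _ => ?_, Finset.sum_congr rfl fun j _ => h1 j,
    Finset.sum_add_distrib, h2, add_zero, Finset.sum_comm]
  exact (hφ.continuous.mul ((continuous_pd_snd (hg j) j).comp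
    (by fun_prop : Continuous fun w => (w, x)))).integrable_of_hasCompactSupport hφc.mul_right

include hu ht hdiv hf_pos hf_smooth hf₂ hμ hφ hφc in
/-- The stretching term, in weak form. -/
lemma sum_expField_stretching (i : Fin 3) (x : E3) :
    ∑ l, expField ℙ (fun σ => pd i φ (vecField (vortField u) (x, t) σ) *
        vecField (vortField u) (x, t) σ l) (dirField (spaceDir l) (u i)) t x =
      ∫ w, pd i φ w * (f w x t * fieldD (condMean f f₂) i x w t) := by
  -- `W^l(x,t)` is a function of the conditioning variable, so it joins the test weight, which
  -- remains compactly supported, and becomes the factor `w^l` in `D`.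
  have hψ : ∀ l : Fin 3, Continuous fun w : E3 => pd i φ w * w l := fun l =>
    (contDiff_pd hφ i).continuous.mul (by fun_prop)
  have hψc : ∀ l : Fin 3, HasCompactSupport fun w : E3 => pd i φ w * w l := fun l =>
    (hasCompactSupport_pd hφc i).mul_right
  rw [Finset.sum_congr rfl fun l _ => expField_dir_velocity hu ht hf_pos hf_smooth hf₂ hμ (hψ l)
    (hψc l) hdiv i l x, ← integral_finsetSum _ fun l _ => ?_]
  · refine integral_congr_ae (.of_forall fun w => ?_)
    simp only [fieldD, Finset.mul_sum]
    exact Finset.sum_congr rfl fun l _ => by ring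
  · exact ((continuous_mul_density ht hf_smooth (hψ l) x).mul
      (contDiff_integral_kernelD ht hμ i l x).continuous).integrable_of_hasCompactSupport
      (hψc l).mul_right.mul_right

include hu ht hf_pos hf_smooth hf₂ hμ hab hφ hφc in
/-- The viscous term, in weak form. -/
lemma sum_expField_viscous (i : Fin 3) (x : E3) :
    ∑ k, expField ℙ (fun σ => pd i φ (vecField (vortField u) (x, t) σ))
        (dirField (spaceDir k) (dirField (spaceDir k) (vortField u i))) t x =
      ∫ w, pd i φ w * (2 * (∑ k, b i k k x w t) * f w x t) := by
  have hψ := (contDiff_pd hφ i).continuous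
  have hψc := hasCompactSupport_pd hφc i
  rw [Finset.sum_congr rfl fun k _ => expField_dir_dir_vorticity hu ht hf_pos hf_smooth hf₂ hμ hψ
    hψc k i x x, ← integral_finsetSum _ fun k _ => ?_]
  · refine integral_congr_ae (.of_forall fun w => ?_)
    simp only [← (expansion_coefficients ht hμ hab i _ x w).2, Finset.mul_sum, Finset.sum_mul]
    exact Finset.sum_congr rfl fun l _ => by ring
  · have h := (contDiff_pd_second (contDiff_pd_second ((hμ i).contDiff ht) k) k).continuous.comp
      (by fun_prop : Continuous fun w : E3 => (x, x, w))
    exact ((continuous_mul_density ht hf_smooth hψ x).mul h).integrable_of_hasCompactSupport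
      hψc.mul_right.mul_right

include hu ht hdiv hvort hf hf_pos hf_smooth hf₂ hμ hab hφ hφc in
/-- The evolution equation of the density, in weak form. -/
lemma weak_evolution (x : E3) :
    ∫ w, φ w * deriv (f w x) t =
      -(∫ w, φ w * ∑ j, pd j (fun z => f w z t * fieldB (condMean f f₂) j z w t) x) +
      ∑ i, ((∫ w, pd i φ w * (f w x t * fieldD (condMean f f₂) i x w t)) +
        ν * ∫ w, pd i φ w * (2 * (∑ k, b i k k x w t) * f w x t)) := by
  have hζ := randField_vortField hu
  have hp : (x, t) ∈ posTime := ht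
  have hm := measurable_vecField hζ hp
  rw [integral_test_mul_deriv hζ ht hf hf_smooth hφ hφc,
    ← integral_test_mul_convection hu ht hdiv hf_pos hf_smooth hf₂ hμ hφ hφc,
    ← Finset.sum_neg_distrib, ← Finset.sum_add_distrib]
  refine Finset.sum_congr rfl fun i _ => ?_
  rw [← sum_expField_stretching hu ht hdiv hf_pos hf_smooth hf₂ hμ hφ hφc,
    ← sum_expField_viscous hu ht hf_pos hf_smooth hf₂ hμ hab hφ hφc]
  obtain ⟨D, hD⟩ := exists_bound_of_hasCompactSupport (contDiff_pd hφ i).continuous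
    (hasCompactSupport_pd hφc i)
  have hξ := (contDiff_pd hφ i).continuous.measurable.comp hm
  have i1 : ∀ j, Integrable (fun σ => pd i φ (vecField (vortField u) (x, t) σ) *
      (u j (x, t) σ * dirField (spaceDir j) (vortField u i) (x, t) σ)) ℙ := fun j =>
    (((hu j).memLp hp).integrable_mul (((hζ i).dir _).memLp hp)).bdd_mul
      hξ.aestronglyMeasurable (.of_forall fun σ => hD _)
  have i2 : ∀ l, Integrable (fun σ => pd i φ (vecField (vortField u) (x, t) σ) *
      vecField (vortField u) (x, t) σ l * dirField (spaceDir l) (u i) (x, t) σ) ℙ := fun l => by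
    simp only [mul_assoc]
    exact (((hζ l).memLp hp).integrable_mul (((hu i).dir _).memLp hp)).bdd_mul
      hξ.aestronglyMeasurable (.of_forall fun σ => hD _)
  have i3 : ∀ k, Integrable (fun σ => pd i φ (vecField (vortField u) (x, t) σ) *
      dirField (spaceDir k) (dirField (spaceDir k) (vortField u i)) (x, t) σ) ℙ := fun k =>
    (((hζ i).dir _).dir _).integrable_mul hp hξ fun σ => hD _
  simp only [expField]
  rw [← integral_finsetSum _ fun j _ => i1 j, ← integral_finsetSum _ fun j _ => i2 j,
    ← integral_finsetSum _ fun j _ => i3 j,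
    neg_integral_add_integral (integrable_finsetSum _ fun j _ => i1 j)
      (integrable_finsetSum _ fun j _ => i2 j) (integrable_finsetSum _ fun j _ => i3 j)]
  refine integral_congr_ae (.of_forall fun σ => ?_)
  -- Realization by realization, the claim is the vorticity equation multiplied by `∂ᵢφ(W)`.
  have h := hvort σ (x, t) hp i
  simp only [mul_assoc, ← Finset.mul_sum]
  have hv : ∀ l, vecField (vortField u) (x, t) σ l = vortField u l (x, t) σ := fun l => rfl
  simp only [hv]
  linear_combination (pd i φ (vecField (vortField u) (x, t) σ)) * h

lemma integral_test_mul_combination {φ T B L : E3 → ℝ} {G : Fin 3 → E3 → ℝ} (hφ : Continuous φ)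
    (hφc : HasCompactSupport φ) (hT : Continuous T) (hB : Continuous B) (hL : Continuous L)
    (hG : ∀ i, Continuous (G i)) (ν : ℝ) :
    ∫ w, φ w * (T w + B w - ν * L w - ∑ i, G i w) =
      (∫ w, φ w * T w) + (∫ w, φ w * B w) - ν * (∫ w, φ w * L w) - ∑ i, ∫ w, φ w * G i w := by
  have hI : ∀ {g : E3 → ℝ}, Continuous g → Integrable fun w => φ w * g w := fun hg =>
    (hφ.mul hg).integrable_of_hasCompactSupport hφc.mul_right
  have h1 : Integrable fun w => φ w * T w + φ w * B w := (hI hT).add (hI hB)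
  have h2 : Integrable fun w => φ w * T w + φ w * B w - ν * (φ w * L w) :=
    h1.sub ((hI hL).const_mul ν)
  rw [← integral_finsetSum _ fun i _ => hI (hG i), ← integral_const_mul,
    ← integral_add (hI hT) (hI hB), ← integral_sub h1 ((hI hL).const_mul ν),
    ← integral_sub h2 (integrable_finsetSum _ fun i _ => hI (hG i))]
  refine integral_congr_ae (.of_forall fun w => ?_)
  simp only [← Finset.mul_sum]; ring

include hu ht hdiv hvort hf hf_pos hf_smooth hf₂ hμ hab in
/-- The evolution equation of the density. -/
lemma strong_evolution (w x : E3) :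
    deriv (f w x) t + ∑ j, pd j (fun z => f w z t * fieldB (condMean f f₂) j z w t) x -
        ν * lap (fun z => f w z t) x =
      ∑ i, pd i (fun v => ν * (∑ k, pd k (fun z => f v z t * a i k z v t) x -
        2 * (∑ k, b i k k x v t) * f v x t) - f v x t * fieldD (condMean f f₂) i x v t) w := by
  have hfs := contDiff_density ht hf_smooth
  have hsec : Continuous fun w : E3 => (w, x) := by fun_prop
  have hA : ∀ i, ContDiff ℝ 1 fun v => ∑ k, pd k (fun z => f v z t * a i k z v t) x := fun i =>
    ContDiff.sum fun k _ => ((contDiff_pd_snd (hfs.mul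
      (contDiff_linear_coefficient ht hμ hab i k)) k).comp
        (by fun_prop : ContDiff ℝ ∞ fun v : E3 => (v, x))).of_le (by simp)
  have hfx : ContDiff ℝ 1 fun v => f v x t :=
    (hfs.comp (by fun_prop : ContDiff ℝ ∞ fun v : E3 => (v, x))).of_le (by simp)
  have hb : ∀ i, ContDiff ℝ 1 fun v => 2 * (∑ k, b i k k x v t) * f v x t := fun i =>
    (contDiff_const.mul ((contDiff_quadratic_coefficient ht hμ hab i x).of_le (by simp))).mul hfx
  have hD : ∀ i, ContDiff ℝ 1 fun v => f v x t * fieldD (condMean f f₂) i x v t := fun i =>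
    hfx.mul (contDiff_fieldD ht hμ i x)
  have hS : ∀ i, ContDiff ℝ 1 fun v => ν * (∑ k, pd k (fun z => f v z t * a i k z v t) x -
        2 * (∑ k, b i k k x v t) * f v x t) - f v x t * fieldD (condMean f f₂) i x v t := fun i =>
    (contDiff_const.mul ((hA i).sub (hb i))).sub (hD i)
  have cS : ∀ i, Continuous (pd i fun v => ν * (∑ k, pd k (fun z => f v z t * a i k z v t) x -
        2 * (∑ k, b i k k x v t) * f v x t) - f v x t * fieldD (condMean f f₂) i x v t) := fun i =>
    ((hS i).continuous_fderiv (by simp)).clm_apply continuous_const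
  have cT : Continuous fun v => deriv (f v x) t :=
    (continuous_deriv_density hf_smooth).1.comp_continuous
      (by fun_prop : Continuous fun v : E3 => (v, x, t)) fun v => ht
  have cB : Continuous fun v => ∑ j, pd j (fun z => f v z t * fieldB (condMean f f₂) j z v t) x :=
    continuous_finsetSum _ fun j _ => (continuous_pd_snd
      (g := fun q : E3 × E3 => f q.1 q.2 t * fieldB (condMean f f₂) j q.2 q.1 t)
      ((hfs.of_le (by simp)).mul (contDiff_fieldB ht hμ j)) j).comp hsec
  have cL : Continuous fun v => lap (fun z => f v z t) x :=
    continuous_finsetSum _ fun k _ =>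
      (contDiff_pd_snd (contDiff_pd_snd hfs k) k).continuous.comp hsec
  -- The difference of the two sides is continuous in `w`, so it vanishes as soon as its integral
  -- against every test function does.
  rw [← sub_eq_zero]
  refine eq_zero_of_integral_test_mul (g := fun w => deriv (f w x) t +
    ∑ j, pd j (fun z => f w z t * fieldB (condMean f f₂) j z w t) x -
    ν * lap (fun z => f w z t) x - ∑ i, pd i (fun v =>
      ν * (∑ k, pd k (fun z => f v z t * a i k z v t) x -
        2 * (∑ k, b i k k x v t) * f v x t) - f v x t * fieldD (condMean f f₂) i x v t) w)
    (((cT.add cB).sub (continuous_const.mul cL)).sub (continuous_finsetSum _ fun i _ => cS i))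
    (fun φ hφ hφc => ?_) w
  have hI : ∀ {g : E3 → ℝ}, Continuous g → Integrable fun w => φ w * g w := fun hg =>
    (hφ.continuous.mul hg).integrable_of_hasCompactSupport hφc.mul_right
  have hI' : ∀ i {g : E3 → ℝ}, Continuous g → Integrable fun w => pd i φ w * g w := fun i g hg =>
    ((contDiff_pd hφ i).continuous.mul hg).integrable_of_hasCompactSupport
      (hasCompactSupport_pd hφc i).mul_right
  have h1 := weak_evolution hu ht hdiv hvort hf hf_pos hf_smooth hf₂ hμ hab hφ hφc x
  have h2 := integral_test_mul_lap hu ht hf hf_pos hf_smooth hf₂ hμ hab hφ hφc x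
  -- Integration by parts in `w` rewrites the divergence terms with the derivatives on `φ`.
  have h3 : ∀ i, _ := fun i => integral_pd_mul (hφ.of_le (by simp)) hφc (hS i) i
  have h4 : ∀ i, ∫ w, pd i φ w * (ν * (∑ k, pd k (fun z => f w z t * a i k z w t) x -
        2 * (∑ k, b i k k x w t) * f w x t) - f w x t * fieldD (condMean f f₂) i x w t) =
      ν * ((∫ w, pd i φ w * ∑ k, pd k (fun z => f w z t * a i k z w t) x) -
        ∫ w, pd i φ w * (2 * (∑ k, b i k k x w t) * f w x t)) -
      ∫ w, pd i φ w * (f w x t * fieldD (condMean f f₂) i x w t) := fun i => by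
    rw [← integral_sub (hI' i (hA i).continuous) (hI' i (hb i).continuous), ← integral_const_mul,
      ← integral_sub _ (hI' i (hD i).continuous)]
    · refine integral_congr_ae (.of_forall fun w => ?_)
      simp only; ring
    · exact ((hI' i (hA i).continuous).sub (hI' i (hb i).continuous)).const_mul ν
  have h5 : ∫ w, φ w * (deriv (f w x) t +
      ∑ j, pd j (fun z => f w z t * fieldB (condMean f f₂) j z w t) x -
      ν * lap (fun z => f w z t) x - ∑ i, pd i (fun v =>
        ν * (∑ k, pd k (fun z => f v z t * a i k z v t) x -
          2 * (∑ k, b i k k x v t) * f v x t) - f v x t * fieldD (condMean f f₂) i x v t) w) =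
      (∫ w, φ w * deriv (f w x) t) +
      (∫ w, φ w * ∑ j, pd j (fun z => f w z t * fieldB (condMean f f₂) j z w t) x) -
      ν * (∫ w, φ w * lap (fun z => f w z t) x) - ∑ i, ∫ w, φ w * pd i (fun v =>
        ν * (∑ k, pd k (fun z => f v z t * a i k z v t) x -
          2 * (∑ k, b i k k x v t) * f v x t) - f v x t * fieldD (condMean f f₂) i x v t) w :=
    integral_test_mul_combination hφ.continuous hφc cT cB cL cS ν
  rw [h5, h1, h2]
  have h6 : ∀ i, _ := fun i => (neg_eq_iff_eq_neg.2 ((h4 i).symm.trans (h3 i)))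
  rw [← Finset.sum_congr rfl fun i _ => h6 i]
  -- Here `c` is the convection term and `p`, `q`, `r` are the terms in `a`, `b`, `D`. By `h2` the
  -- Laplacian contributes `∑ p`, which cancels the `a` term.
  have halg : ∀ (p q r : Fin 3 → ℝ) (c : ℝ), -c + ∑ i, (r i + ν * q i) + c - ν * ∑ i, p i -
      ∑ i, -(ν * (p i - q i) - r i) = 0 := fun p q r c => by
    simp only [Fin.sum_univ_three]; ring
  exact halg _ _ _ _

end Weak

end VorticityPDF

/-! ### The theorem -/

open VorticityPDF in
theorem theorem1
    {Ω : Type*} [MeasurableSpace Ω] (ℙ : Measure Ω) [IsProbabilityMeasure ℙ]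
    (ν : ℝ) (hν : 0 ≤ ν)
    -- the random velocity and pressure
    (U : E3 → ℝ → Ω → E3) (P : E3 → ℝ → Ω → ℝ)
    (hU_meas : ∀ x t, 0 < t → Measurable (U x t))
    (hU_smooth : SmoothFastDecay ℙ U)
    (hNS : SolvesNavierStokes ν U P)
    -- the one-point density `f w x t` of the vorticity
    (f : E3 → E3 → ℝ → ℝ)
    (hf : ∀ x t, 0 < t → IsPDFOf ℙ (vorticity U x t) (fun w => f w x t))
    (hf_pos : ∀ w x t, 0 < t → 0 < f w x t)
    (hf_smooth : ContDiffOn ℝ ∞ (fun p : E3 × E3 × ℝ => f p.1 p.2.1 p.2.2) {p | 0 < p.2.2})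
    (hf_moments : ∀ (n : ℕ) (x : E3) (t : ℝ), 0 < t → Integrable (fun w => ‖w‖ ^ n * f w x t))
    -- the two-point density `f₂ w₁ w₂ x y t` of the vorticity
    (f₂ : E3 → E3 → E3 → E3 → ℝ → ℝ)
    (hf₂ : ∀ x y t, 0 < t → x ≠ y →
      IsPDFOf ℙ (fun σ => (vorticity U x t σ, vorticity U y t σ))
        (fun p : E3 × E3 => f₂ p.1 p.2 x y t))
    (hf₂_pos : ∀ w₁ w₂ x y t, 0 < t → x ≠ y → 0 < f₂ w₁ w₂ x y t)
    (hf₂_smooth : ∀ x y t, 0 < t → x ≠ y →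
      ContDiff ℝ ∞ (fun p : E3 × E3 => f₂ p.1 p.2 x y t))
    -- the conditional mean and its expansion, `a i k x w t` and `b i j k x w t`
    (hμ : ∀ i, SmoothDecayingIncrement (condMean f f₂ i))
    (a : Fin 3 → Fin 3 → E3 → E3 → ℝ → ℝ) (b : Fin 3 → Fin 3 → Fin 3 → E3 → E3 → ℝ → ℝ)
    (ha : ∀ i k, ContinuousOn (fun p : E3 × E3 × ℝ => a i k p.1 p.2.1 p.2.2) {p | 0 < p.2.2})
    (hb : ∀ i j k, ContinuousOn (fun p : E3 × E3 × ℝ => b i j k p.1 p.2.1 p.2.2) {p | 0 < p.2.2})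
    (hab : ∀ i x w t, 0 < t →
      (fun y : E3 => condMean f f₂ i x y w t
          - (∑ k, a i k x w t * (y k - x k)
            + ∑ j, ∑ k, b i j k x w t * (y k - x k) * (y j - x j)))
        =o[𝓝 x] fun y : E3 => ‖y - x‖ ^ 2) :
    ∀ (w x : E3) (t : ℝ), 0 < t →
      -- the integrals and the derivatives in the equation exist
      (∀ i, Integrable (kernelB (condMean f f₂) i x w t)) ∧
      (∀ i l, Integrable (kernelD (condMean f f₂) i l x w t)) ∧
      (∀ i, DifferentiableAt ℝ (fun z => fieldB (condMean f f₂) i z w t) x) ∧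
      (∀ i, DifferentiableAt ℝ (fun v => fieldD (condMean f f₂) i x v t) w) ∧
      (∀ i k, ∀ v, DifferentiableAt ℝ (fun z => a i k z v t) x) ∧
      (∀ i k, DifferentiableAt ℝ (fun v => pd k (fun z => f v z t * a i k z v t) x) w) ∧
      (∀ i, DifferentiableAt ℝ (fun v => ∑ k, b i k k x v t) w) ∧
      -- the equation
      deriv (fun s => f w x s) t
          + (∑ i, pd i (fun z => fieldB (condMean f f₂) i z w t) x) * f w x t
          + ∑ i, fieldB (condMean f f₂) i x w t * pd i (fun z => f w z t) x
          - ν * lap (fun z => f w z t) x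
        = ν * ∑ i, pd i (fun v => ∑ k, pd k (fun z => f v z t * a i k z v t) x
              - 2 * (∑ k, b i k k x v t) * f v x t) w
          - ∑ i, pd i (fun v => f v x t * fieldD (condMean f f₂) i x v t) w := by
  intro w x t ht
  have hu : ∀ i, RandField ℙ fun p σ => U p.1 p.2 σ i :=
    fun i => randField_of_smoothFastDecay hU_meas hU_smooth i
  set u : Fin 3 → E3 × ℝ → Ω → ℝ := fun i p σ => U p.1 p.2 σ i with hu_def
  have hus : ∀ σ i, SmoothPos fun q => u i q σ := fun σ i => (hu i).smooth σ
  have hW : ∀ x t, 0 < t → vorticity U x t = vecField (vortField u) (x, t) := fun x t ht => by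
    funext σ; ext i
    exact vorticity_apply hu x ht σ i
  have hdiv : ∀ σ, ∀ p ∈ posTime, ∑ j, dirField (spaceDir j) (u j) p σ = 0 := fun σ p hp => by
    rw [← ((hNS σ p.2 hp).2 p.1).2]
    exact Finset.sum_congr rfl fun j _ => (pd_slice (hus σ j) p.1 hp j).symm
  have hvort : ∀ σ, ∀ p ∈ posTime, ∀ i, dirField timeDir (vortField u i) p σ +
      ∑ j, u j p σ * dirField (spaceDir j) (vortField u i) p σ =
      ∑ j, vortField u j p σ * dirField (spaceDir j) (u i) p σ +
        ν * ∑ k, dirField (spaceDir k) (dirField (spaceDir k) (vortField u i)) p σ :=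
    fun σ p hp i => by
    refine vorticity_equation (hus σ) hp (hNS σ p.2 hp).1 (fun x i => ?_) (hdiv σ p hp) i
    rw [← lap_slice (hus σ i) x hp, ← ((hNS σ p.2 hp).2 x).1 i]
    congr 1
    · exact (deriv_slice (hus σ i) x hp).symm
    · exact Finset.sum_congr rfl fun j _ => congrArg _ (pd_slice (hus σ i) x hp j).symm
  have hf' : ∀ x t, 0 < t → IsPDFOf ℙ (vecField (vortField u) (x, t)) (fun w => f w x t) :=
    fun x t ht => hW x t ht ▸ hf x t ht
  have hf₂' : ∀ x y t, 0 < t → x ≠ y →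
      IsPDFOf ℙ (fun σ => (vecField (vortField u) (x, t) σ, vecField (vortField u) (y, t) σ))
      (fun p : E3 × E3 => f₂ p.1 p.2 x y t) := fun x y t ht hxy => by
    have := hf₂ x y t ht hxy
    rwa [hW x t ht, hW y t ht] at this
  have hfs := contDiff_density ht hf_smooth
  have hBz : ∀ i, DifferentiableAt ℝ (fun z => fieldB (condMean f f₂) i z w t) x := fun i =>
    ((contDiff_fieldB ht hμ i).comp
      (contDiff_prodMk_right w)).differentiable (by simp) x
  have hDv : ∀ i, DifferentiableAt ℝ (fun v => fieldD (condMean f f₂) i x v t) w := fun i =>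
    (contDiff_fieldD ht hμ i x).differentiable (by simp) w
  have haz : ∀ i k, ∀ v, DifferentiableAt ℝ (fun z => a i k z v t) x := fun i k v =>
    ((contDiff_linear_coefficient ht hμ hab i k).comp
      (contDiff_prodMk_right v)).differentiable (by simp) x
  have hfav : ∀ i k, DifferentiableAt ℝ (fun v => pd k (fun z => f v z t * a i k z v t) x) w :=
    fun i k => ((contDiff_pd_snd (hfs.mul (contDiff_linear_coefficient ht hμ hab i k)) k).comp
      (contDiff_prodMk_left x)).differentiable (by simp) w
  have hbv : ∀ i, DifferentiableAt ℝ (fun v => ∑ k, b i k k x v t) w := fun i =>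
    (contDiff_quadratic_coefficient ht hμ hab i x).differentiable (by simp) w
  refine ⟨fun i => integrable_kernelB ht hμ i x w, fun i l => integrable_kernelD ht hμ i l x w,
    hBz, hDv, haz, hfav, hbv, ?_⟩
  have hfv : DifferentiableAt ℝ (fun v => f v x t) w :=
    (hfs.comp (contDiff_prodMk_left x)).differentiable (by simp) w
  have hfz : DifferentiableAt ℝ (fun z => f w z t) x :=
    (hfs.comp (contDiff_prodMk_right w)).differentiable (by simp) x
  have key := strong_evolution hu ht hdiv hvort hf' hf_pos hf_smooth hf₂' hμ hab w x
  have hS : ∀ i, DifferentiableAt ℝ (fun v => ∑ k, pd k (fun z => f v z t * a i k z v t) x -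
      2 * (∑ k, b i k k x v t) * f v x t) w := fun i =>
    (DifferentiableAt.fun_sum fun k _ => hfav i k).sub (((hbv i).const_mul 2).mul hfv)
  -- The product rule splits `∂_j(f B^j)` into the multiplication term and the advection term of the
  -- statement.
  have h1 : ∀ j, pd j (fun z => f w z t * fieldB (condMean f f₂) j z w t) x =
      f w x t * pd j (fun z => fieldB (condMean f f₂) j z w t) x +
        fieldB (condMean f f₂) j x w t * pd j (fun z => f w z t) x := fun j => pd_mul hfz (hBz j) j
  have h2 : ∀ i, pd i (fun v => ν * (∑ k, pd k (fun z => f v z t * a i k z v t) x -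
      2 * (∑ k, b i k k x v t) * f v x t) - f v x t * fieldD (condMean f f₂) i x v t) w =
      ν * pd i (fun v => ∑ k, pd k (fun z => f v z t * a i k z v t) x -
        2 * (∑ k, b i k k x v t) * f v x t) w -
      pd i (fun v => f v x t * fieldD (condMean f f₂) i x v t) w := fun i => by
    have hSν : DifferentiableAt ℝ (fun v => ν * (∑ k, pd k (fun z => f v z t * a i k z v t) x -
        2 * (∑ k, b i k k x v t) * f v x t)) w := (hS i).const_mul ν
    have hfD : DifferentiableAt ℝ (fun v => f v x t * fieldD (condMean f f₂) i x v t) w :=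
      hfv.mul (hDv i)
    rw [pd_sub hSν hfD, pd_const_mul (hS i)]
  simp only [h1, h2, Finset.sum_add_distrib, Finset.sum_sub_distrib, ← Finset.mul_sum] at key
  rw [← key]
  ring
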